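/- **Setting.** Let $\mathcal T_h$ be a conforming triangulation by finitely many nondegenerate tetrahedra (a finite simplicial complex in $\mathbb R^3$ each of whose simplices is a face of a tetrahedron of the complex), let $\Omega\subset\mathbb R^3$ be the interior of the union of its simplices, and let $\mathcal E_h$ be the set of interior faces. Let $s,m\ge 0$ be integers, let $P_s$ be the polynomials of degree at most $s$, write $\langle\cdot,\cdot\rangle$ for the $L^2(\Omega)$ inner product of scalar or vector fields, and set $$U_h^{\mathrm{div}}=\{u\in H_0(\mathrm{div},\Omega): u|_K\in P_s^3+xP_s\ \ \forall K\in\mathcal T_h\},\qquad U_h^{\mathrm{curl}}=\{u\in H_0(\mathrm{curl},\Omega): u|_K\in P_s^3+x\times P_s^3\ \ \forall K\in\mathcal T_h\},$$ $$F_h=\{f\in L^2(\Omega): f|_K\in P_m\ \ \forall K\in\mathcal T_h\},\qquad Q_h=\{f\in L^2(\Omega): f|_K\in P_s\ \ \forall K\in\mathcal T_h,\ \textstyle\int_\Omega f\,dx=0\}.$$ Here $H_0(\mathrm{div},\Omega)$ is the space of $u\in L^2(\Omega)^3$ with $\mathrm{div}\,u\in L^2(\Omega)$ and $u\cdot n=0$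 on $\partial\Omega$, and $H_0(\mathrm{curl},\Omega)$ is the space of $u\in L^2(\Omega)^3$ with $\nabla\times u\in L^2(\Omega)^3$ and $u\times n=0$ on $\partial\Omega$ (weak derivatives and weak traces). Let $\pi_h^{\mathrm{curl}}$ and $\pi_h$ be the $L^2$-orthogonal projections onto $U_h^{\mathrm{curl}}$ and $F_h$, and put $$a_h(w,u,v)=\int_\Omega w\cdot\nabla\times\pi_h^{\mathrm{curl}}\big(\pi_h^{\mathrm{curl}}u\times\pi_h^{\mathrm{curl}}v\big)\,dx,$$ $$b_h(f,g,u)=-\sum_{K\in\mathcal T_h}\int_K (u\cdot\nabla\pi_hf)\,\pi_hg\,dx+\sum_{e\in\mathcal E_h}\int_e u\cdot[\![\pi_hf]\!]\,\{\pi_hg\}\,ds,$$ where on a face $e=K_1\cap K_2$ we write $[\![f]\!]=f_1n_1+f_2n_2$ and $\{f\}=\frac12(f_1+f_2)$, with $f_i$ the trace of $f$ from $K_i$ and $n_i$ the unit normal to $e$ that points out of $K_i$. **Scheme.** Let $I\subset\mathbb R$ be an interval and $t_0\in I$ the initial time. Consider $u,B:I\to U_h^{\mathrm{div}}$, $\rho:I\to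 F_h$ that are differentiable in time, and $p:I\to Q_h$, such that at every $t\in I$ $$\langle\partial_t(\rho u),v\rangle+\langle\alpha,v\rangle+b_h(\theta,\rho,v)=\langle p,\mathrm{div}\,v\rangle,\qquad \langle\partial_tB,C\rangle+\langle\nabla\times E,C\rangle=0,$$ $$\langle\partial_t\rho,\sigma\rangle+b_h(\sigma,\rho,u)=0,\qquad \langle\mathrm{div}\,u,q\rangle=0$$ for all $v,C\in U_h^{\mathrm{div}}$, $\sigma\in F_h$, $q\in Q_h$, where $\theta\in F_h$ and $w,J,H,U,E,\alpha\in U_h^{\mathrm{curl}}$ satisfy $$\langle w,z\rangle=\langle\rho u,\nabla\times z\rangle,\quad \langle J,z\rangle=\langle B,\nabla\times z\rangle,\quad \langle\theta,\tau\rangle=\tfrac12\langle u\cdot u,\tau\rangle,\quad \langle H,z\rangle=\langle B,z\rangle,\quad \langle U,z\rangle=\langle u,z\rangle,$$ $$\langle E,z\rangle=-\langle U\times H,z\rangle,\qquad \langle\alpha,z\rangle=\langle w\times U-J\times H,z\rangle$$ for all $z\in U_h^{\mathrm{curl}}$, $\tau\in F_h$; or such that, instead of this, at every $t\in I$ and for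 all $v,C\in U_h^{\mathrm{div}}$, $\sigma\in F_h$, $q\in Q_h$, $$\langle\partial_t(\rho u),v\rangle+a_h(\rho u,u,v)-a_h(B,B,v)+\tfrac12b_h(u\cdot u,\rho,v)=\langle p,\mathrm{div}\,v\rangle,$$ $$\langle\partial_tB,C\rangle+a_h(C,B,u)=0,\qquad \langle\partial_t\rho,\sigma\rangle+b_h(\sigma,\rho,u)=0,\qquad\langle\mathrm{div}\,u,q\rangle=0.$$ Assume $\mathrm{div}\,B(t_0)\equiv0$. **Claim.** For every such solution, of either form of the scheme, the quantities $$\int_\Omega\rho\,dx,\qquad\int_\Omega\rho^2\,dx,\qquad\int_\Omega\rho\,u\cdot u+B\cdot B\,dx,\qquad\int_\Omega A\cdot B\,dx$$ have at every $t\in I$ the value that they have at $t_0$; here $A$ is, at each of the two times, any vector field in $H_0(\mathrm{curl},\Omega)$ with $\nabla\times A=B$ (that is, $A\times n=0$ on $\partial\Omega$). If $\rho\equiv1$ on $\Omega\times I$, then $\int_\Omega u\cdot B\,dx$ is preserved as well. Furthermore $\mathrm{div}\,u(t)\equiv0$ and $\mathrm{div}\,B(t)\equiv0$ for every $t\in I$,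 both pointwise in each tetrahedron and weakly in $\Omega$. -/

import Mathlib

open MeasureTheory
open scoped ContDiff

noncomputable section

/-- Three-dimensional Euclidean space; it carries both the points and the vectors. -/
abbrev E3 := EuclideanSpace ℝ (Fin 3)

/-! ### Vector calculus in three dimensions -/

/-- The cross product `u × v`. -/
def cross (u v : E3) : E3 := WithLp.toLp 2 (crossProduct u.ofLp v.ofLp)

/-- The partial derivative `∂ᵢ uⱼ` of a vector field. -/
def pderiv (i j : Fin 3) (u : E3 → E3) (x : E3) : ℝ :=
  (fderiv ℝ u x (EuclideanSpace.single i 1)) j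

/-- The classical divergence `∇ ⬝ u`. -/
def div3 (u : E3 → E3) (x : E3) : ℝ := ∑ i, pderiv i i u x

/-- The classical curl `∇ × u`. -/
def curl3 (u : E3 → E3) (x : E3) : E3 :=
  !₂[pderiv 1 2 u x - pderiv 2 1 u x,
     pderiv 2 0 u x - pderiv 0 2 u x,
     pderiv 0 1 u x - pderiv 1 0 u x]

/-! ### `H₀(div, Ω)` and `H₀(curl, Ω)` -/

/-- `u ∈ H₀(div, Ω)` with `div u = g`: both are square integrable, `g` is the weak divergence of
`u`, and the normal trace of `u` vanishes. The test functions do not have to vanish on `∂Ω`; for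
test functions supported in `Ω` the identity says that `div u = g`, and for the others it then
says that `u ⬝ n = 0` on `∂Ω`. -/
def HasDivZeroTrace (Ω : Set E3) (u : E3 → E3) (g : E3 → ℝ) : Prop :=
  MemLp u 2 (volume.restrict Ω) ∧ MemLp g 2 (volume.restrict Ω) ∧
    ∀ φ : E3 → ℝ, ContDiff ℝ ∞ φ → HasCompactSupport φ →
      ∫ x in Ω, inner ℝ (u x) (gradient φ x) = - ∫ x in Ω, g x * φ x

/-- `u ∈ H₀(curl, Ω)` with `curl u = g`: both are square integrable, `g` is the weak curl of `u`,
and the tangential trace of `u` vanishes. The test fields do not have to vanish on `∂Ω`; for test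
fields supported in `Ω` the identity says that `curl u = g`, and for the others it then says that
`u × n = 0` on `∂Ω`. -/
def HasCurlZeroTrace (Ω : Set E3) (u g : E3 → E3) : Prop :=
  MemLp u 2 (volume.restrict Ω) ∧ MemLp g 2 (volume.restrict Ω) ∧
    ∀ φ : E3 → E3, ContDiff ℝ ∞ φ → HasCompactSupport φ →
      ∫ x in Ω, inner ℝ (u x) (curl3 φ x) = ∫ x in Ω, inner ℝ (g x) (φ x)

/-- Scalar polynomial functions of total degree at most `s`. -/
def IsPolyFun (s : ℕ) (f : E3 → ℝ) : Prop :=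
  ∃ p : MvPolynomial (Fin 3) ℝ, p.totalDegree ≤ s ∧ ∀ x, f x = MvPolynomial.eval x.ofLp p

/-- Polynomial vector fields all of whose components have total degree at most `s`. -/
def IsPolyVec (s : ℕ) (u : E3 → E3) : Prop := ∀ i, IsPolyFun s (fun x => u x i)

/-! ### Triangulations -/

/-- A conforming tetrahedral mesh: a finite geometric simplicial complex in `ℝ³`, each of whose
simplices is a face of a (nondegenerate) tetrahedron of the complex. -/
structure Triangulation extends Geometry.SimplicialComplex ℝ E3 where
  finite_faces : faces.Finite
  pure_dim : ∀ e ∈ faces, ∃ K ∈ faces, K.card = 4 ∧ e ⊆ K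

namespace Triangulation

variable (T : Triangulation)

/-- The polyhedral domain `Ω` that is triangulated. -/
def domain : Set E3 := interior T.toSimplicialComplex.space

/-- The tetrahedra of the mesh (each given by its set of four vertices). -/
abbrev Cell := {K : Finset E3 // K ∈ T.faces ∧ K.card = 4}

instance : Finite T.Cell := (T.finite_faces.subset fun _ h => h.1).to_subtype

instance : Fintype T.Cell := Fintype.ofFinite T.Cell

variable {T} in
/-- The closed tetrahedron with the given vertices. -/
def Cell.hull (K : T.Cell) : Set E3 := convexHull ℝ (K.1 : Set E3)

/-- The interior faces: triangles of the mesh that are shared by two different tetrahedra. -/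
def IsInteriorFace (e : Finset E3) : Prop :=
  e ∈ T.faces ∧ e.card = 3 ∧ ∃ K L : T.Cell, K ≠ L ∧ e ⊆ K.1 ∧ e ⊆ L.1

abbrev InteriorFace := {e : Finset E3 // T.IsInteriorFace e}

instance : Finite T.InteriorFace := (T.finite_faces.subset fun _ h => h.1).to_subtype

instance : Fintype T.InteriorFace := Fintype.ofFinite T.InteriorFace

/-! ### Piecewise smooth fields

A piecewise smooth field is given by its pieces, one function for each tetrahedron `K`. All pieces
used below are polynomials, so the piece on `K` is determined by its values in `K`, and its values
on `∂K` are the traces taken from inside `K`. -/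

/-- Piecewise defined scalar fields. -/
abbrev SField := T.Cell → E3 → ℝ

/-- Piecewise defined vector fields. -/
abbrev VField := T.Cell → E3 → E3

variable {T}

/-- The function on `Ω` (up to the null set formed by the faces) with the given pieces. -/
def glue {V : Type*} [AddCommMonoid V] (f : T.Cell → E3 → V) (x : E3) : V :=
  ∑ K, (interior K.hull).indicator (f K) x

/-- The integral over `Ω` of a piecewise defined function. -/
def integral (f : T.SField) : ℝ := ∫ x in T.domain, glue f x

/-- `⟨f, g⟩ = ∫_Ω f g dx`. -/
def ip (f g : T.SField) : ℝ := integral fun K x => f K x * g K x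

/-- `⟨u, v⟩ = ∫_Ω u ⬝ v dx`. -/
def ipV (u v : T.VField) : ℝ := integral fun K x => inner ℝ (u K x) (v K x)

/-- The product `ρ u`. -/
def smulF (ρ : T.SField) (u : T.VField) : T.VField := fun K x => ρ K x • u K x

/-- The pointwise product `u ⬝ v`. -/
def dotF (u v : T.VField) : T.SField := fun K x => inner ℝ (u K x) (v K x)

/-- The pointwise product `u × v`. -/
def crossF (u v : T.VField) : T.VField := fun K x => cross (u K x) (v K x)

/-- The divergence, taken piece by piece. -/
def divF (u : T.VField) : T.SField := fun K => div3 (u K)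

/-- The curl, taken piece by piece. -/
def curlF (u : T.VField) : T.VField := fun K => curl3 (u K)

/-- The divergence vanishes at every point of every tetrahedron. -/
def DivFree (u : T.VField) : Prop := ∀ K : T.Cell, ∀ x ∈ K.hull, divF u K x = 0

/-! ### The finite element spaces -/

variable (T)

/-- The discontinuous Galerkin space `DG_s`. -/
def DG (s : ℕ) : Set T.SField := {f | ∀ K, IsPolyFun s (f K)}

/-- The elements of `DG_s` with mean zero over `Ω`. -/
def DGZero (s : ℕ) : Set T.SField := {f | f ∈ T.DG s ∧ integral f = 0}

/-- The Raviart-Thomas space `RT_s`: on each tetrahedron `u ∈ P_s³ + x P_s`, and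
`u ∈ H₀(div, Ω)`. -/
def RT (s : ℕ) : Set T.VField :=
  {u | (∀ K, ∃ (p : E3 → E3) (q : E3 → ℝ), IsPolyVec s p ∧ IsPolyFun s q ∧
          ∀ x, u K x = p x + q x • x) ∧
        ∃ g, HasDivZeroTrace T.domain (glue u) g}

/-- The space `NED_s` of Nedelec elements of the first kind: on each tetrahedron
`u ∈ P_s³ + x × P_s³`, and `u ∈ H₀(curl, Ω)`. -/
def NED (s : ℕ) : Set T.VField :=
  {u | (∀ K, ∃ p q : E3 → E3, IsPolyVec s p ∧ IsPolyVec s q ∧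
          ∀ x, u K x = p x + cross x (q x)) ∧
        ∃ g, HasCurlZeroTrace T.domain (glue u) g}

/-! ### Projections and trilinear forms -/

variable {T}

open Classical in
/-- The `L²`-orthogonal projection onto `DG_m`. -/
def projDG (m : ℕ) (f : T.SField) : T.SField :=
  if h : ∃ P ∈ T.DG m, ∀ σ ∈ T.DG m, ip P σ = ip f σ then h.choose else 0

open Classical in
/-- The `L²`-orthogonal projection onto `NED_s`. -/
def projCurl (s : ℕ) (u : T.VField) : T.VField :=
  if h : ∃ P ∈ T.NED s, ∀ z ∈ T.NED s, ipV P z = ipV u z then h.choose else 0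

/-- The helicity-preserving form
`a_h(w,u,v) = ∫_Ω w ⬝ ∇ × π_curl (π_curl u × π_curl v) dx`. -/
def aForm (s : ℕ) (w u v : T.VField) : ℝ :=
  ipV w (curlF (projCurl s (crossF (projCurl s u) (projCurl s v))))

/-- The barycentre of a finite set of points. -/
def barycentre (e : Finset E3) : E3 := (e.card : ℝ)⁻¹ • ∑ v ∈ e, v

/-- The unit normal on the face `e` of the tetrahedron `K` that points out of `K`: the normalized
component, orthogonal to the plane of `e`, of a vector that leads from the barycentre of `K` to
that of `e`. -/
def outwardNormal (K e : Finset E3) : E3 :=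
  let d := (vectorSpan ℝ (e : Set E3))ᗮ.starProjection (barycentre e - barycentre K)
  ‖d‖⁻¹ • d

open Classical in
/-- The two tetrahedra that share an interior face. -/
def adjacent (e : T.InteriorFace) : Finset T.Cell := {K | e.1 ⊆ K.1}

/-- The jump `f₁ n₁ + f₂ n₂` of a piecewise smooth function across an interior face. -/
def jump (f : T.SField) (e : T.InteriorFace) (x : E3) : E3 :=
  ∑ K ∈ adjacent e, f K x • outwardNormal K.1 e.1

/-- The average of the two traces on an interior face. -/
def avg {V : Type*} [AddCommGroup V] [Module ℝ V] (f : T.Cell → E3 → V) (e : T.InteriorFace)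
    (x : E3) : V :=
  (1 / 2 : ℝ) • ∑ K ∈ adjacent e, f K x

/-- The discontinuous Galerkin advection form
`b_h(f,g,u) = - ∑_K ∫_K (u ⬝ ∇ π_h f) π_h g dx + ∑_e ∫_e u ⬝ ⟦π_h f⟧ {π_h g} ds`, where `ds` is
the surface measure. A jump is normal to the face, so that only the normal component of `u` enters
the second sum; for `u ∈ H₀(div, Ω)` it is the same from both sides, and therefore the average of
the two traces of `u` has this normal component too. -/
def bForm (m : ℕ) (f g : T.SField) (u : T.VField) : ℝ :=
  -(∑ K : T.Cell, ∫ x in K.hull,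
      inner ℝ (u K x) (gradient (projDG m f K) x) * projDG m g K x) +
    (∑ e : T.InteriorFace, ∫ x in convexHull ℝ (e.1 : Set E3),
      inner ℝ (avg u e x) (jump (projDG m f) e x) * avg (projDG m g) e x ∂(μHE[2] : Measure E3))

/-! ### The semidiscrete schemes -/

/-- The time derivative, at time `t` in the time interval `I`, of a time-dependent field
(one-sided if `t` is an endpoint that belongs to `I`). -/
def dt {V : Type*} [NormedAddCommGroup V] [NormedSpace ℝ V] (I : Set ℝ)
    (f : ℝ → T.Cell → E3 → V) (t : ℝ) : T.Cell → E3 → V :=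
  fun K x => derivWithin (fun τ => f τ K x) I t

/-- `f` is differentiable in time on `I`. -/
def TimeDiff {V : Type*} [NormedAddCommGroup V] [NormedSpace ℝ V] (I : Set ℝ)
    (f : ℝ → T.Cell → E3 → V) : Prop :=
  ∀ K x, DifferentiableOn ℝ (fun τ => f τ K x) I

/-- `(u, B, ρ, p)` solves, on the time interval `I`, the semidiscrete scheme written with the
trilinear forms `a_h` and `b_h`. -/
structure SolvesForms (s m : ℕ) (I : Set ℝ) (u B : ℝ → T.VField) (ρ p : ℝ → T.SField) :
    Prop where
  diff_u : TimeDiff I u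
  diff_B : TimeDiff I B
  diff_ρ : TimeDiff I ρ
  mem_u : ∀ t ∈ I, u t ∈ T.RT s
  mem_B : ∀ t ∈ I, B t ∈ T.RT s
  mem_ρ : ∀ t ∈ I, ρ t ∈ T.DG m
  mem_p : ∀ t ∈ I, p t ∈ T.DGZero s
  momentum : ∀ t ∈ I, ∀ v ∈ T.RT s,
    ipV (dt I (fun τ => smulF (ρ τ) (u τ)) t) v + aForm s (smulF (ρ t) (u t)) (u t) v
      - aForm s (B t) (B t) v + 1 / 2 * bForm m (dotF (u t) (u t)) (ρ t) v = ip (p t) (divF v)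
  magnetic : ∀ t ∈ I, ∀ C ∈ T.RT s, ipV (dt I B t) C + aForm s C (B t) (u t) = 0
  density : ∀ t ∈ I, ∀ σ ∈ T.DG m, ip (dt I ρ t) σ + bForm m σ (ρ t) (u t) = 0
  incompressible : ∀ t ∈ I, ∀ q ∈ T.DGZero s, ip (divF (u t)) q = 0

/-- `(u, B, ρ, p)`, with the auxiliary fields `θ, w, J, H, U, E, α`, solves on the time interval
`I` the semidiscrete scheme in its implementable form. -/
structure SolvesMixed (s m : ℕ) (I : Set ℝ) (u B : ℝ → T.VField) (ρ p θ : ℝ → T.SField)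
    (w J H U E α : ℝ → T.VField) : Prop where
  diff_u : TimeDiff I u
  diff_B : TimeDiff I B
  diff_ρ : TimeDiff I ρ
  mem_u : ∀ t ∈ I, u t ∈ T.RT s
  mem_B : ∀ t ∈ I, B t ∈ T.RT s
  mem_ρ : ∀ t ∈ I, ρ t ∈ T.DG m
  mem_p : ∀ t ∈ I, p t ∈ T.DGZero s
  mem_θ : ∀ t ∈ I, θ t ∈ T.DG m
  mem_aux : ∀ t ∈ I, w t ∈ T.NED s ∧ J t ∈ T.NED s ∧ H t ∈ T.NED s ∧ U t ∈ T.NED s ∧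
    E t ∈ T.NED s ∧ α t ∈ T.NED s
  momentum : ∀ t ∈ I, ∀ v ∈ T.RT s,
    ipV (dt I (fun τ => smulF (ρ τ) (u τ)) t) v + ipV (α t) v + bForm m (θ t) (ρ t) v
      = ip (p t) (divF v)
  magnetic : ∀ t ∈ I, ∀ C ∈ T.RT s, ipV (dt I B t) C + ipV (curlF (E t)) C = 0
  density : ∀ t ∈ I, ∀ σ ∈ T.DG m, ip (dt I ρ t) σ + bForm m σ (ρ t) (u t) = 0
  incompressible : ∀ t ∈ I, ∀ q ∈ T.DGZero s, ip (divF (u t)) q = 0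
  eq_w : ∀ t ∈ I, ∀ z ∈ T.NED s, ipV (w t) z = ipV (smulF (ρ t) (u t)) (curlF z)
  eq_J : ∀ t ∈ I, ∀ z ∈ T.NED s, ipV (J t) z = ipV (B t) (curlF z)
  eq_θ : ∀ t ∈ I, ∀ τ ∈ T.DG m, ip (θ t) τ = 1 / 2 * ip (dotF (u t) (u t)) τ
  eq_H : ∀ t ∈ I, ∀ z ∈ T.NED s, ipV (H t) z = ipV (B t) z
  eq_U : ∀ t ∈ I, ∀ z ∈ T.NED s, ipV (U t) z = ipV (u t) z
  eq_E : ∀ t ∈ I, ∀ z ∈ T.NED s, ipV (E t) z = - ipV (crossF (U t) (H t)) z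
  eq_α : ∀ t ∈ I, ∀ z ∈ T.NED s,
    ipV (α t) z = ipV (crossF (w t) (U t) - crossF (J t) (H t)) z

end Triangulation

end

noncomputable section

/-! ### Polynomial functions -/

/-! Every balance follows from an admissible test function together with an antisymmetry of `a_h` or
`b_h`. The implementable scheme reduces to the one written with these forms, because its auxiliary
fields are projections and `⟨α, v⟩` is a difference of two values of `a_h`
(`SolvesMixed.solvesForms`).

Constraints: `div u` belongs to `Q_h` (`divF_mem_DGZero`), so it can be tested against itself and
vanishes. The curl maps Nedelec fields to Raviart-Thomas fields (`curlF_mem_RT`), so the magnetic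
equation holds strongly, `∂ₜB = -curl G` with `G = π(πB × πu)`, and `div B` cannot change.

Mass uses `σ = 1`. Squared density uses `σ = ρ` and `b_h(ρ,ρ,u) = 0` (`bForm_self`). Energy uses `v
= u`, `C = B`, `σ = π_h(u·u)`: the values `a_h(B,B,u)` cancel, as do those of `b_h(u·u,ρ,u)`, and
`a_h(ρu,u,u) = 0`. Cross-helicity uses `v = B`, `C = u`, the swap rule for `a_h` and `b_h(·,1,B) =
0` (`bForm_const_right`).

Magnetic helicity rests on two facts. First, `⟨G,B⟩ = ⟨G,πB⟩ = ⟨πB × πu, πB⟩ = 0` (`ipV_emf_self`).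
Second, the curl is symmetric on `H₀(curl, Ω)` (`HasCurlZeroTrace.integral_inner_comm`), so that the
helicity does not depend on the potential and `∫ A·curl G = ∫ G·B`. Symmetry is proved by mollifying
zero extensions and using Fubini; no regularity of `∂Ω` and no density theorem enters. An arbitrary
family of potentials need not be differentiable in time, so one works with `A₀ + Z(t)`, where `Z` is
a discrete potential of `B(t) - B(t₀)` that depends linearly on it.

The identities for `b_h` need the divergence theorem on a tetrahedron with Hausdorff surface measure
(`integral_div3_tetrahedron`) and the continuity of normal components of Raviart-Thomas fields
(`fluxJump_eq_zero`), which has to be extracted from the weak definition of `H₀(div, Ω)`.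

All fields live in finite-dimensional spaces. There linear functionals are continuous even for
pointwise convergence, so pointwise differentiability in time suffices to differentiate integrals
(`hasDerivWithinAt_of_linear`). -/

/-- The partial derivative `∂ᵢ f` of a scalar function. -/
def dpart (i : Fin 3) (f : E3 → ℝ) (x : E3) : ℝ := fderiv ℝ f x (EuclideanSpace.single i 1)

lemma MvPolynomial.totalDegree_pderiv_le (i : Fin 3) (p : MvPolynomial (Fin 3) ℝ) :
    (MvPolynomial.pderiv i p).totalDegree ≤ p.totalDegree - 1 := by
  classical
  conv_lhs => rw [p.as_sum, map_sum]
  refine (MvPolynomial.totalDegree_finsetSum_le fun s hs => ?_)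
  rw [MvPolynomial.pderiv_monomial]
  by_cases h0 : s i = 0
  · simp [h0]
  refine (MvPolynomial.totalDegree_monomial_le _ _).trans ?_
  have h1 := MvPolynomial.le_totalDegree hs
  have h2 : (s.sum fun _ => id) = ((s - Finsupp.single i 1).sum fun _ => id) + 1 := by
    conv_lhs => rw [← tsub_add_cancel_of_le (Finsupp.single_le_iff.2 (Nat.one_le_iff_ne_zero.2 h0))]
    rw [Finsupp.sum_add_index' (by simp) (by simp), Finsupp.sum_single_index (by simp)]
    rfl
  have h3 : (s.sum fun _ e => e) = (s.sum fun _ => id) := rfl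
  omega

/-- Differentiation lowers the degree by one and the variable restores it. This keeps `div (q x)`
and `curl (x × q)` within degree `s`. Constants are treated apart because `totalDegree - 1` is
truncated at zero; their derivative is zero. -/
lemma MvPolynomial.totalDegree_X_mul_pderiv_le (i j : Fin 3) (p : MvPolynomial (Fin 3) ℝ) :
    (MvPolynomial.X j * MvPolynomial.pderiv i p).totalDegree ≤ p.totalDegree := by
  have h := MvPolynomial.totalDegree_pderiv_le i p
  rcases Nat.eq_zero_or_pos p.totalDegree with h0 | h0
  · rw [MvPolynomial.totalDegree_eq_zero_iff_eq_C.1 h0]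
    simp
  · refine (MvPolynomial.totalDegree_mul _ _).trans ?_
    rw [MvPolynomial.totalDegree_X]
    omega

lemma MvPolynomial.hasFDerivAt_eval_ofLp (p : MvPolynomial (Fin 3) ℝ) (x : E3) :
    HasFDerivAt (fun y : E3 => MvPolynomial.eval y.ofLp p)
      (∑ i, MvPolynomial.eval x.ofLp (MvPolynomial.pderiv i p) •
        (EuclideanSpace.proj i : E3 →L[ℝ] ℝ)) x := by
  induction p using MvPolynomial.induction_on with
  | C a => simpa using hasFDerivAt_const a x
  | add p q hp hq =>
    simp only [map_add, add_smul, Finset.sum_add_distrib]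
    exact hp.add hq
  | mul_X p j hp =>
    have hj : HasFDerivAt (fun y : E3 => y.ofLp j) (EuclideanSpace.proj j : E3 →L[ℝ] ℝ) x :=
      (EuclideanSpace.proj j : E3 →L[ℝ] ℝ).hasFDerivAt
    have h := hp.mul hj
    simp only [map_mul, MvPolynomial.eval_X]
    refine h.congr_fderiv ?_
    simp only [Derivation.leibniz, MvPolynomial.pderiv_X, smul_eq_mul, map_add, map_mul,
      MvPolynomial.eval_X, add_smul, Finset.sum_add_distrib, Finset.smul_sum, smul_smul]
    congr 1
    rw [Finset.sum_eq_single j]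
    · simp
    · intro b _ hb
      simp [hb]
    · simp

lemma MvPolynomial.contDiff_eval_ofLp (p : MvPolynomial (Fin 3) ℝ) {n : WithTop ℕ∞} :
    ContDiff ℝ n (fun y : E3 => MvPolynomial.eval y.ofLp p) := by
  induction p using MvPolynomial.induction_on with
  | C a => simpa using contDiff_const
  | add p q hp hq => simpa using hp.add hq
  | mul_X p j hp =>
    simp only [map_mul, MvPolynomial.eval_X]
    exact hp.mul (EuclideanSpace.proj j : E3 →L[ℝ] ℝ).contDiff

lemma MvPolynomial.dpart_eval_ofLp (p : MvPolynomial (Fin 3) ℝ) (i : Fin 3) (x : E3) :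
    dpart i (fun y : E3 => MvPolynomial.eval y.ofLp p) x =
      MvPolynomial.eval x.ofLp (MvPolynomial.pderiv i p) := by
  rw [dpart, (MvPolynomial.hasFDerivAt_eval_ofLp p x).fderiv]
  simp only [sum_apply, smul_apply]
  rw [Finset.sum_eq_single i]
  · simp
  · intro b _ hb
    simp [hb]
  · simp

namespace IsPolyFun

variable {s t : ℕ} {f g : E3 → ℝ}

lemma contDiff (hf : IsPolyFun s f) {n : WithTop ℕ∞} : ContDiff ℝ n f := by
  obtain ⟨p, -, hp⟩ := hf
  rw [funext hp]
  exact p.contDiff_eval_ofLp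

lemma continuous (hf : IsPolyFun s f) : Continuous f := (hf.contDiff (n := 0)).continuous

lemma differentiable (hf : IsPolyFun s f) : Differentiable ℝ f :=
  (hf.contDiff (n := 1)).differentiable (by simp)

lemma mono (hf : IsPolyFun s f) (h : s ≤ t) : IsPolyFun t f := by
  obtain ⟨p, hd, hp⟩ := hf
  exact ⟨p, hd.trans h, hp⟩

lemma const (s : ℕ) (c : ℝ) : IsPolyFun s (fun _ => c) := ⟨MvPolynomial.C c, by simp, by simp⟩

lemma coord (i : Fin 3) : IsPolyFun 1 (fun x => x i) := ⟨MvPolynomial.X i, by simp, by simp⟩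

lemma add (hf : IsPolyFun s f) (hg : IsPolyFun s g) : IsPolyFun s (fun x => f x + g x) := by
  obtain ⟨p, hd, hp⟩ := hf
  obtain ⟨q, hd', hq⟩ := hg
  exact ⟨p + q, (MvPolynomial.totalDegree_add _ _).trans (max_le hd hd'), by simp [hp, hq]⟩

lemma mul (hf : IsPolyFun s f) (hg : IsPolyFun t g) : IsPolyFun (s + t) (fun x => f x * g x) := by
  obtain ⟨p, hd, hp⟩ := hf
  obtain ⟨q, hd', hq⟩ := hg
  exact ⟨p * q, (MvPolynomial.totalDegree_mul _ _).trans (add_le_add hd hd'), by simp [hp, hq]⟩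

lemma const_mul (hf : IsPolyFun s f) (c : ℝ) : IsPolyFun s (fun x => c * f x) := by
  simpa using (IsPolyFun.const 0 c).mul hf

lemma neg (hf : IsPolyFun s f) : IsPolyFun s (fun x => - f x) := by
  simpa using hf.const_mul (-1)

lemma sub (hf : IsPolyFun s f) (hg : IsPolyFun s g) : IsPolyFun s (fun x => f x - g x) := by
  simpa [sub_eq_add_neg] using hf.add hg.neg

lemma sum {ι : Type*} {S : Finset ι} {F : ι → E3 → ℝ} (h : ∀ i ∈ S, IsPolyFun s (F i)) :
    IsPolyFun s (fun x => ∑ i ∈ S, F i x) := by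
  classical
  induction S using Finset.induction_on with
  | empty => simpa using IsPolyFun.const s 0
  | insert a S ha ih =>
    simp only [Finset.sum_insert ha]
    exact (h a (by simp)).add (ih fun i hi => h i (by simp [hi]))

lemma dpart (hf : IsPolyFun s f) (i : Fin 3) : IsPolyFun s (dpart i f) := by
  obtain ⟨p, hd, hp⟩ := hf
  rw [funext hp]
  exact ⟨MvPolynomial.pderiv i p,
    ((MvPolynomial.totalDegree_pderiv_le i p).trans (Nat.sub_le _ _)).trans hd,
    MvPolynomial.dpart_eval_ofLp p i⟩

lemma coord_mul_dpart (hf : IsPolyFun s f) (i j : Fin 3) :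
    IsPolyFun s (fun x => x j * _root_.dpart i f x) := by
  obtain ⟨p, hd, hp⟩ := hf
  rw [funext hp]
  refine ⟨MvPolynomial.X j * MvPolynomial.pderiv i p,
    (MvPolynomial.totalDegree_X_mul_pderiv_le i j p).trans hd, fun x => ?_⟩
  show x j * _root_.dpart i _ x = _
  rw [MvPolynomial.dpart_eval_ofLp]
  simp

lemma analyticOnNhd (hf : IsPolyFun s f) : AnalyticOnNhd ℝ f Set.univ := by
  obtain ⟨p, hd, hp⟩ := hf
  rw [funext hp]
  exact AnalyticOnNhd.aeval_mvPolynomial (f := fun x : E3 => x.ofLp) (s := Set.univ)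
    (fun i x _ => (EuclideanSpace.proj i : E3 →L[ℝ] ℝ).analyticAt x) p

/-- A polynomial function that vanishes on a nonempty open set is zero. -/
lemma eq_zero_of_isOpen (hf : IsPolyFun s f) {U : Set E3} (hU : IsOpen U) (hne : U.Nonempty)
    (h : ∀ x ∈ U, f x = 0) : f = 0 := by
  obtain ⟨x, hx⟩ := hne
  refine hf.analyticOnNhd.eq_of_eventuallyEq (z₀ := x)
    (g := 0) (fun _ _ => analyticAt_const) ?_
  filter_upwards [hU.mem_nhds hx] with y hy using h y hy

end IsPolyFun

/-- The space of polynomial functions of degree at most `s`. -/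
def polySub (s : ℕ) : Submodule ℝ (E3 → ℝ) where
  carrier := {f | IsPolyFun s f}
  add_mem' hf hg := IsPolyFun.add hf hg
  zero_mem' := IsPolyFun.const s 0
  smul_mem' c _ hf := IsPolyFun.const_mul hf c

instance (s : ℕ) : FiniteDimensional ℝ (polySub s) := by
  let L : MvPolynomial (Fin 3) ℝ →ₗ[ℝ] (E3 → ℝ) :=
    { toFun := fun p x => MvPolynomial.eval x.ofLp p
      map_add' := fun p q => by ext x; simp
      map_smul' := fun c p => by ext x; simp [MvPolynomial.smul_eval] }
  have h : polySub s ≤ (MvPolynomial.restrictTotalDegree (Fin 3) ℝ s).map L := by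
    rintro f ⟨p, hd, hp⟩
    exact ⟨p, (MvPolynomial.mem_restrictTotalDegree _ _ _).2 hd, (funext hp).symm⟩
  exact Submodule.finiteDimensional_of_le h

/-! ### Vector fields -/

lemma pderiv_eq_dpart {u : E3 → E3} {x : E3} (hu : DifferentiableAt ℝ u x) (i j : Fin 3) :
    pderiv i j u x = dpart i (fun y => u y j) x := by
  have h := ((EuclideanSpace.proj j : E3 →L[ℝ] ℝ).hasFDerivAt (x := u x)).comp x hu.hasFDerivAt
  have h' : fderiv ℝ (fun y => u y j) x = (EuclideanSpace.proj j : E3 →L[ℝ] ℝ).comp (fderiv ℝ u x) :=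
    h.fderiv
  rw [dpart, h']
  rfl

lemma E3.ext {x y : E3} (h0 : x 0 = y 0) (h1 : x 1 = y 1) (h2 : x 2 = y 2) : x = y := by
  ext i
  fin_cases i <;> assumption

lemma E3.inner_eq (x y : E3) : inner ℝ x y = x 0 * y 0 + x 1 * y 1 + x 2 * y 2 := by
  simp [PiLp.inner_apply, Fin.sum_univ_three]
  ring

lemma cross_zero_apply (u v : E3) : cross u v 0 = u 1 * v 2 - u 2 * v 1 := by
  simp [cross, cross_apply]

lemma cross_one_apply (u v : E3) : cross u v 1 = u 2 * v 0 - u 0 * v 2 := by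
  simp [cross, cross_apply]

lemma cross_two_apply (u v : E3) : cross u v 2 = u 0 * v 1 - u 1 * v 0 := by
  simp [cross, cross_apply]

lemma cross_self_eq_zero (u : E3) : cross u u = 0 := by
  apply E3.ext <;> simp [cross_zero_apply, cross_one_apply, cross_two_apply, mul_comm]

lemma cross_swap (u v : E3) : cross u v = - cross v u := by
  apply E3.ext <;> simp [cross_zero_apply, cross_one_apply, cross_two_apply] <;> ring

lemma inner_cross_comm (u v w : E3) : inner ℝ (cross u v) w = inner ℝ u (cross v w) := by
  simp only [E3.inner_eq, cross_zero_apply, cross_one_apply, cross_two_apply]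
  ring

lemma inner_gradient_eq (f : E3 → ℝ) (x v : E3) :
    inner ℝ v (gradient f x) = v 0 * dpart 0 f x + v 1 * dpart 1 f x + v 2 * dpart 2 f x := by
  rw [real_inner_comm, gradient, InnerProductSpace.toDual_symm_apply]
  have hv : v = v 0 • EuclideanSpace.single 0 (1 : ℝ) + v 1 • EuclideanSpace.single 1 (1 : ℝ)
      + v 2 • EuclideanSpace.single 2 (1 : ℝ) := by
    apply E3.ext <;> simp
  conv_lhs => rw [hv]
  simp [dpart]

lemma gradient_apply (f : E3 → ℝ) (x : E3) (i : Fin 3) :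
    gradient f x i = dpart i f x := by
  have h := inner_gradient_eq f x (EuclideanSpace.single i (1 : ℝ))
  rw [EuclideanSpace.inner_single_left] at h
  fin_cases i <;> simpa using h

namespace IsPolyVec

variable {s t : ℕ} {u v : E3 → E3}

lemma contDiff (hu : IsPolyVec s u) {n : WithTop ℕ∞} : ContDiff ℝ n u :=
  contDiff_euclidean.2 fun i => (hu i).contDiff

lemma continuous (hu : IsPolyVec s u) : Continuous u := (hu.contDiff (n := 0)).continuous

lemma differentiable (hu : IsPolyVec s u) : Differentiable ℝ u :=
  (hu.contDiff (n := 1)).differentiable (by simp)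

lemma mono (hu : IsPolyVec s u) (h : s ≤ t) : IsPolyVec t u := fun i => (hu i).mono h

lemma add (hu : IsPolyVec s u) (hv : IsPolyVec s v) : IsPolyVec s (fun x => u x + v x) :=
  fun i => (hu i).add (hv i)

lemma const_smul (hu : IsPolyVec s u) (c : ℝ) : IsPolyVec s (fun x => c • u x) :=
  fun i => (hu i).const_mul c

lemma smul (hu : IsPolyVec s u) {f : E3 → ℝ} (hf : IsPolyFun t f) :
    IsPolyVec (t + s) (fun x => f x • u x) := fun i => hf.mul (hu i)

lemma inner (hu : IsPolyVec s u) (hv : IsPolyVec t v) :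
    IsPolyFun (s + t) (fun x => inner ℝ (u x) (v x)) := by
  simp only [E3.inner_eq]
  exact (((hu 0).mul (hv 0)).add ((hu 1).mul (hv 1))).add ((hu 2).mul (hv 2))

lemma cross (hu : IsPolyVec s u) (hv : IsPolyVec t v) :
    IsPolyVec (s + t) (fun x => cross (u x) (v x)) := by
  intro i
  fin_cases i
  · simpa [cross_zero_apply] using ((hu 1).mul (hv 2)).sub ((hu 2).mul (hv 1))
  · simpa [cross_one_apply] using ((hu 2).mul (hv 0)).sub ((hu 0).mul (hv 2))
  · simpa [cross_two_apply] using ((hu 0).mul (hv 1)).sub ((hu 1).mul (hv 0))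

lemma id : IsPolyVec 1 (fun x => x) := IsPolyFun.coord

lemma pderiv (hu : IsPolyVec s u) (i j : Fin 3) : IsPolyFun s (pderiv i j u) := by
  rw [funext fun x => pderiv_eq_dpart (hu.differentiable x) i j]
  exact (hu j).dpart i

lemma coord_mul_pderiv (hu : IsPolyVec s u) (i j k : Fin 3) :
    IsPolyFun s (fun x => x k * _root_.pderiv i j u x) := by
  simp only [pderiv_eq_dpart (hu.differentiable _) i j]
  exact (hu j).coord_mul_dpart i k

lemma div3 (hu : IsPolyVec s u) : IsPolyFun s (div3 u) := IsPolyFun.sum fun i _ => hu.pderiv i i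

lemma curl3 (hu : IsPolyVec s u) : IsPolyVec s (curl3 u) := by
  intro i
  fin_cases i
  · exact (hu.pderiv 1 2).sub (hu.pderiv 2 1)
  · exact (hu.pderiv 2 0).sub (hu.pderiv 0 2)
  · exact (hu.pderiv 0 1).sub (hu.pderiv 1 0)

end IsPolyVec

/-! ### Rules of calculus -/

section dpart

variable {f g : E3 → ℝ} {x : E3} (i j : Fin 3)

lemma dpart_add (hf : DifferentiableAt ℝ f x) (hg : DifferentiableAt ℝ g x) :
    dpart i (fun y => f y + g y) x = dpart i f x + dpart i g x := by
  simp only [dpart]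
  rw [(hf.hasFDerivAt.fun_add hg.hasFDerivAt).fderiv]
  rfl

lemma dpart_sub (hf : DifferentiableAt ℝ f x) (hg : DifferentiableAt ℝ g x) :
    dpart i (fun y => f y - g y) x = dpart i f x - dpart i g x := by
  simp only [dpart]
  rw [(hf.hasFDerivAt.fun_sub hg.hasFDerivAt).fderiv]
  rfl

lemma dpart_mul (hf : DifferentiableAt ℝ f x) (hg : DifferentiableAt ℝ g x) :
    dpart i (fun y => f y * g y) x = dpart i f x * g x + f x * dpart i g x := by
  simp only [dpart]
  rw [(hf.hasFDerivAt.fun_mul hg.hasFDerivAt).fderiv]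
  simp
  ring

lemma dpart_const (c : ℝ) : dpart i (fun _ => c) x = 0 := by
  simp [dpart]

lemma dpart_const_mul (c : ℝ) (hf : DifferentiableAt ℝ f x) :
    dpart i (fun y => c * f y) x = c * dpart i f x := by
  rw [dpart_mul i (by fun_prop) hf, dpart_const]
  ring

lemma dpart_coord : dpart i (fun y : E3 => y j) x = if i = j then 1 else 0 := by
  have h : HasFDerivAt (fun y : E3 => y j) (EuclideanSpace.proj j : E3 →L[ℝ] ℝ) x :=
    (EuclideanSpace.proj j : E3 →L[ℝ] ℝ).hasFDerivAt
  simp [dpart, h.fderiv, eq_comm]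

lemma contDiff_dpart {n m : WithTop ℕ∞} (hf : ContDiff ℝ n f) (h : m + 1 ≤ n) :
    ContDiff ℝ m (dpart i f) :=
  (hf.fderiv_right h).clm_apply contDiff_const

lemma dpart_comm (hf : ContDiff ℝ 2 f) : dpart i (dpart j f) x = dpart j (dpart i f) x := by
  have hd : DifferentiableAt ℝ (fderiv ℝ f) x :=
    (hf.fderiv_right (m := 1) (by norm_num)).differentiable (by simp) x
  have key : ∀ k l : Fin 3, dpart k (dpart l f) x =
      fderiv ℝ (fderiv ℝ f) x (EuclideanSpace.single k 1) (EuclideanSpace.single l 1) := by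
    intro k l
    have := (hd.hasFDerivAt.clm_apply (hasFDerivAt_const (EuclideanSpace.single l (1 : ℝ)) x)).fderiv
    rw [dpart]
    change fderiv ℝ (fun y => fderiv ℝ f y (EuclideanSpace.single l 1)) x _ = _
    rw [this]
    simp
  rw [key, key]
  exact second_derivative_symmetric (f := f) (f' := fderiv ℝ f)
    (fun y => ((hf.differentiable (by simp)) y).hasFDerivAt) hd.hasFDerivAt _ _

end dpart

section vector

variable {u v : E3 → E3} {f : E3 → ℝ} {x : E3}

lemma DifferentiableAt.coord (hu : DifferentiableAt ℝ u x) (j : Fin 3) :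
    DifferentiableAt ℝ (fun y => u y j) x := differentiableAt_euclidean.1 hu j

lemma div3_eq (hu : DifferentiableAt ℝ u x) :
    div3 u x = dpart 0 (fun y => u y 0) x + dpart 1 (fun y => u y 1) x
      + dpart 2 (fun y => u y 2) x := by
  simp [div3, Fin.sum_univ_three, pderiv_eq_dpart hu]

lemma curl3_zero (hu : DifferentiableAt ℝ u x) :
    curl3 u x 0 = dpart 1 (fun y => u y 2) x - dpart 2 (fun y => u y 1) x := by
  simp [curl3, pderiv_eq_dpart hu]

lemma curl3_one (hu : DifferentiableAt ℝ u x) :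
    curl3 u x 1 = dpart 2 (fun y => u y 0) x - dpart 0 (fun y => u y 2) x := by
  simp [curl3, pderiv_eq_dpart hu]

lemma curl3_two (hu : DifferentiableAt ℝ u x) :
    curl3 u x 2 = dpart 0 (fun y => u y 1) x - dpart 1 (fun y => u y 0) x := by
  simp [curl3, pderiv_eq_dpart hu]

lemma div3_add (hu : DifferentiableAt ℝ u x) (hv : DifferentiableAt ℝ v x) :
    div3 (fun y => u y + v y) x = div3 u x + div3 v x := by
  rw [div3_eq (hu.fun_add hv), div3_eq hu, div3_eq hv]
  simp only [PiLp.add_apply, dpart_add _ (hu.coord _) (hv.coord _)]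
  ring

lemma div3_const_smul (c : ℝ) (hu : DifferentiableAt ℝ u x) :
    div3 (fun y => c • u y) x = c * div3 u x := by
  rw [div3_eq (hu.fun_const_smul c), div3_eq hu]
  simp only [PiLp.smul_apply, smul_eq_mul, dpart_const_mul _ c (hu.coord _)]
  ring

lemma div3_smul (hf : DifferentiableAt ℝ f x) (hu : DifferentiableAt ℝ u x) :
    div3 (fun y => f y • u y) x = inner ℝ (u x) (gradient f x) + f x * div3 u x := by
  rw [div3_eq (hf.fun_smul hu), div3_eq hu, inner_gradient_eq]
  simp only [PiLp.smul_apply, smul_eq_mul, dpart_mul _ hf (hu.coord _)]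
  ring

lemma curl3_add (hu : DifferentiableAt ℝ u x) (hv : DifferentiableAt ℝ v x) :
    curl3 (fun y => u y + v y) x = curl3 u x + curl3 v x := by
  apply E3.ext <;>
    simp only [curl3_zero, curl3_one, curl3_two, hu, hv, hu.fun_add hv, PiLp.add_apply,
      dpart_add _ (hu.coord _) (hv.coord _)] <;> ring

lemma curl3_const_smul (c : ℝ) (hu : DifferentiableAt ℝ u x) :
    curl3 (fun y => c • u y) x = c • curl3 u x := by
  apply E3.ext <;>
    simp only [curl3_zero, curl3_one, curl3_two, hu, hu.fun_const_smul c, PiLp.smul_apply,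
      smul_eq_mul, dpart_const_mul _ c (hu.coord _)] <;> ring

lemma DifferentiableAt.cross (hu : DifferentiableAt ℝ u x) (hv : DifferentiableAt ℝ v x) :
    DifferentiableAt ℝ (fun y => cross (u y) (v y)) x := by
  rw [differentiableAt_euclidean]
  intro i
  fin_cases i
  · simpa [cross_zero_apply] using
      ((hu.coord 1).fun_mul (hv.coord 2)).fun_sub ((hu.coord 2).fun_mul (hv.coord 1))
  · simpa [cross_one_apply] using
      ((hu.coord 2).fun_mul (hv.coord 0)).fun_sub ((hu.coord 0).fun_mul (hv.coord 2))
  · simpa [cross_two_apply] using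
      ((hu.coord 0).fun_mul (hv.coord 1)).fun_sub ((hu.coord 1).fun_mul (hv.coord 0))

lemma div3_cross (hu : DifferentiableAt ℝ u x) (hv : DifferentiableAt ℝ v x) :
    div3 (fun y => cross (u y) (v y)) x =
      inner ℝ (curl3 u x) (v x) - inner ℝ (u x) (curl3 v x) := by
  have h (a b : Fin 3) := (hu.coord a).fun_mul (hv.coord b)
  rw [div3_eq (hu.cross hv), E3.inner_eq, E3.inner_eq, curl3_zero hu, curl3_one hu, curl3_two hu,
    curl3_zero hv, curl3_one hv, curl3_two hv]
  simp only [cross_zero_apply, cross_one_apply, cross_two_apply]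
  rw [dpart_sub 0 (h 1 2) (h 2 1), dpart_sub 1 (h 2 0) (h 0 2), dpart_sub 2 (h 0 1) (h 1 0)]
  simp only [dpart_mul _ (hu.coord _) (hv.coord _)]
  ring

lemma div3_curl3 (hu : ContDiff ℝ 2 u) : div3 (curl3 u) x = 0 := by
  have hu1 : Differentiable ℝ u := hu.differentiable (by simp)
  have hc (j : Fin 3) : ContDiff ℝ 2 (fun y => u y j) := contDiff_euclidean.1 hu j
  have hd (i j : Fin 3) : Differentiable ℝ (dpart i fun y => u y j) :=
    (contDiff_dpart (m := 1) i (hc j) (by norm_num)).differentiable (by simp)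
  have hcurl : DifferentiableAt ℝ (curl3 u) x := by
    rw [differentiableAt_euclidean]
    intro i
    fin_cases i
    · simp only [Fin.zero_eta, curl3_zero (hu1 _)]
      exact (hd 1 2 x).sub (hd 2 1 x)
    · simp only [Fin.mk_one, curl3_one (hu1 _)]
      exact (hd 2 0 x).sub (hd 0 2 x)
    · simp only [Fin.reduceFinMk, curl3_two (hu1 _)]
      exact (hd 0 1 x).sub (hd 1 0 x)
  rw [div3_eq hcurl]
  simp only [curl3_zero (hu1 _), curl3_one (hu1 _), curl3_two (hu1 _)]
  rw [dpart_sub 0 (hd 1 2 x) (hd 2 1 x), dpart_sub 1 (hd 2 0 x) (hd 0 2 x),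
    dpart_sub 2 (hd 0 1 x) (hd 1 0 x)]
  change dpart 0 (dpart 1 fun y => u y 2) x - dpart 0 (dpart 2 fun y => u y 1) x +
    (dpart 1 (dpart 2 fun y => u y 0) x - dpart 1 (dpart 0 fun y => u y 2) x) +
    (dpart 2 (dpart 0 fun y => u y 1) x - dpart 2 (dpart 1 fun y => u y 0) x) = 0
  rw [dpart_comm 1 0 (hc 2), dpart_comm 2 0 (hc 1), dpart_comm 2 1 (hc 0)]
  ring

lemma contDiff_gradient (hf : ContDiff ℝ ∞ f) : ContDiff ℝ ∞ (gradient f) := by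
  rw [contDiff_euclidean]
  intro i
  simp only [gradient_apply]
  exact contDiff_dpart i hf (by simp)

lemma curl3_gradient (hf : ContDiff ℝ ∞ f) : curl3 (gradient f) x = 0 := by
  have hg : DifferentiableAt ℝ (gradient f) x := (contDiff_gradient hf).differentiable (by simp) x
  have hf2 : ContDiff ℝ 2 f := hf.of_le (by norm_cast)
  apply E3.ext
  · rw [curl3_zero hg]
    simp only [gradient_apply]
    exact sub_eq_zero.2 (dpart_comm 1 2 hf2)
  · rw [curl3_one hg]
    simp only [gradient_apply]
    exact sub_eq_zero.2 (dpart_comm 2 0 hf2)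
  · rw [curl3_two hg]
    simp only [gradient_apply]
    exact sub_eq_zero.2 (dpart_comm 0 1 hf2)

end vector

/-! ### The local Raviart-Thomas and Nedelec spaces -/

/-- The local Raviart-Thomas space `P_s³ + x P_s`. -/
def IsLocalRT (s : ℕ) (u : E3 → E3) : Prop :=
  ∃ (p : E3 → E3) (q : E3 → ℝ), IsPolyVec s p ∧ IsPolyFun s q ∧ ∀ x, u x = p x + q x • x

/-- The local Nedelec space `P_s³ + x × P_s³`. -/
def IsLocalNED (s : ℕ) (u : E3 → E3) : Prop :=
  ∃ p q : E3 → E3, IsPolyVec s p ∧ IsPolyVec s q ∧ ∀ x, u x = p x + cross x (q x)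

namespace IsLocalRT

variable {s : ℕ} {u v : E3 → E3}

lemma isPolyVec (hu : IsLocalRT s u) : IsPolyVec (s + 1) u := by
  obtain ⟨p, q, hp, hq, h⟩ := hu
  rw [funext h]
  exact (hp.mono (Nat.le_succ s)).add (IsPolyVec.id.smul hq)

lemma add (hu : IsLocalRT s u) (hv : IsLocalRT s v) : IsLocalRT s (u + v) := by
  obtain ⟨p, q, hp, hq, h⟩ := hu
  obtain ⟨p', q', hp', hq', h'⟩ := hv
  refine ⟨_, _, hp.add hp', hq.add hq', fun x => ?_⟩
  rw [Pi.add_apply, h, h', add_smul]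
  abel

lemma smul (c : ℝ) (hu : IsLocalRT s u) : IsLocalRT s (c • u) := by
  obtain ⟨p, q, hp, hq, h⟩ := hu
  refine ⟨_, _, hp.const_smul c, hq.const_mul c, fun x => ?_⟩
  rw [Pi.smul_apply, h, smul_add, smul_smul]

lemma zero (s : ℕ) : IsLocalRT s 0 :=
  ⟨0, 0, fun _ => IsPolyFun.const s 0, IsPolyFun.const s 0, by simp⟩

/-- Since `div (q x) = x·∇q + 3q`, the extra factor `x` costs no degree; the divergence is therefore
eligible as a pressure test function. -/
lemma isPolyFun_div3 (hu : IsLocalRT s u) : IsPolyFun s (div3 u) := by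
  obtain ⟨p, q, hp, hq, h⟩ := hu
  have hd : ∀ x, div3 u x = div3 p x + (x 0 * dpart 0 q x + x 1 * dpart 1 q x + x 2 * dpart 2 q x
      + q x * 3) := by
    intro x
    rw [funext h, div3_add (hp.differentiable x)
      ((hq.differentiable x).fun_smul differentiableAt_fun_id),
      div3_smul (u := fun y => y) (hq.differentiable x) differentiableAt_fun_id, inner_gradient_eq,
      div3_eq (u := fun y => y) differentiableAt_fun_id]
    simp only [dpart_coord]
    norm_num
  rw [funext hd]
  refine hp.div3.add ((((hq.coord_mul_dpart 0 0).add (hq.coord_mul_dpart 1 1)).add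
    (hq.coord_mul_dpart 2 2)).add ?_)
  simpa [mul_comm] using hq.const_mul 3

end IsLocalRT

namespace IsLocalNED

variable {s : ℕ} {u v : E3 → E3}

lemma isPolyVec (hu : IsLocalNED s u) : IsPolyVec (s + 1) u := by
  obtain ⟨p, q, hp, hq, h⟩ := hu
  rw [funext h]
  refine (hp.mono (Nat.le_succ s)).add ?_
  rw [Nat.succ_eq_one_add]
  exact IsPolyVec.id.cross hq

lemma add (hu : IsLocalNED s u) (hv : IsLocalNED s v) : IsLocalNED s (u + v) := by
  obtain ⟨p, q, hp, hq, h⟩ := hu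
  obtain ⟨p', q', hp', hq', h'⟩ := hv
  refine ⟨_, _, hp.add hp', hq.add hq', fun x => ?_⟩
  rw [Pi.add_apply, h, h']
  apply E3.ext <;> simp [cross_zero_apply, cross_one_apply, cross_two_apply] <;> ring

lemma smul (c : ℝ) (hu : IsLocalNED s u) : IsLocalNED s (c • u) := by
  obtain ⟨p, q, hp, hq, h⟩ := hu
  refine ⟨_, _, hp.const_smul c, hq.const_smul c, fun x => ?_⟩
  rw [Pi.smul_apply, h]
  apply E3.ext <;> simp [cross_zero_apply, cross_one_apply, cross_two_apply] <;> ring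

lemma zero (s : ℕ) : IsLocalNED s 0 := by
  refine ⟨0, 0, fun _ => IsPolyFun.const s 0, fun _ => IsPolyFun.const s 0, fun x => ?_⟩
  apply E3.ext <;> simp [cross_zero_apply, cross_one_apply, cross_two_apply]

/-- The identity behind this is `curl (x × q) = -2q - (x·∇)q + (div q) x`: the first two terms have
degree at most `s`, the last is of the form `x P_s`. -/
lemma isLocalRT_curl3 (hu : IsLocalNED s u) : IsLocalRT s (curl3 u) := by
  obtain ⟨p, q, hp, hq, h⟩ := hu
  have hqd (x : E3) := hq.differentiable x
  have hcoord (x : E3) (i : Fin 3) : DifferentiableAt ℝ (fun y : E3 => y i) x :=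
    (IsPolyFun.coord i).differentiable x
  refine ⟨fun x => curl3 p x + !₂[
      -2 * q x 0 - (x 0 * pderiv 0 0 q x + x 1 * pderiv 1 0 q x + x 2 * pderiv 2 0 q x),
      -2 * q x 1 - (x 0 * pderiv 0 1 q x + x 1 * pderiv 1 1 q x + x 2 * pderiv 2 1 q x),
      -2 * q x 2 - (x 0 * pderiv 0 2 q x + x 1 * pderiv 1 2 q x + x 2 * pderiv 2 2 q x)],
    div3 q, hp.curl3.add ?_, hq.div3, fun x => ?_⟩
  · have key (j : Fin 3) := ((hq j).const_mul (-2)).sub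
      (((hq.coord_mul_pderiv 0 j 0).add (hq.coord_mul_pderiv 1 j 1)).add
        (hq.coord_mul_pderiv 2 j 2))
    intro i
    fin_cases i
    · exact key 0
    · exact key 1
    · exact key 2
  · have hm (a b : Fin 3) := (hcoord x a).fun_mul ((hqd x).coord b)
    rw [funext h, curl3_add (hp.differentiable x) (DifferentiableAt.cross (u := fun y => y) differentiableAt_fun_id (hqd x)),
      add_assoc]
    congr 1
    have hcr := DifferentiableAt.cross (u := fun y => y) differentiableAt_fun_id (hqd x)
    apply E3.ext
    · rw [curl3_zero hcr]
      simp only [cross_one_apply, cross_two_apply]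
      rw [dpart_sub 1 (hm 0 1) (hm 1 0), dpart_sub 2 (hm 2 0) (hm 0 2)]
      simp only [dpart_mul _ (hcoord x _) ((hqd x).coord _), dpart_coord, div3_eq (hqd x),
        pderiv_eq_dpart (hqd x)]
      simp
      ring
    · rw [curl3_one hcr]
      simp only [cross_zero_apply, cross_two_apply]
      rw [dpart_sub 2 (hm 1 2) (hm 2 1), dpart_sub 0 (hm 0 1) (hm 1 0)]
      simp only [dpart_mul _ (hcoord x _) ((hqd x).coord _), dpart_coord, div3_eq (hqd x),
        pderiv_eq_dpart (hqd x)]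
      simp
      ring
    · rw [curl3_two hcr]
      simp only [cross_zero_apply, cross_one_apply]
      rw [dpart_sub 0 (hm 2 0) (hm 0 2), dpart_sub 1 (hm 1 2) (hm 2 1)]
      simp only [dpart_mul _ (hcoord x _) ((hqd x).coord _), dpart_coord, div3_eq (hqd x),
        pderiv_eq_dpart (hqd x)]
      simp
      ring

end IsLocalNED

/-! ### Integration over simplices -/

/-- The simplex `{y | 0 ≤ y, ∑ yᵢ ≤ 1}` in `ℝⁿ`. -/
def cornerSimplex (n : ℕ) : Set (Fin n → ℝ) := {y | (∀ i, 0 ≤ y i) ∧ ∑ i, y i ≤ 1}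

lemma isClosed_cornerSimplex (n : ℕ) : IsClosed (cornerSimplex n) := by
  have : cornerSimplex n = (⋂ i, {y : Fin n → ℝ | 0 ≤ y i}) ∩ {y | ∑ i, y i ≤ 1} := by
    ext; simp [cornerSimplex]
  rw [this]
  exact (isClosed_iInter fun i => isClosed_le continuous_const (continuous_apply i)).inter
    (isClosed_le (by fun_prop) continuous_const)

lemma isCompact_cornerSimplex (n : ℕ) : IsCompact (cornerSimplex n) := by
  refine (isCompact_Icc (a := (0 : Fin n → ℝ)) (b := 1)).of_isClosed_subset
    (isClosed_cornerSimplex n) fun y hy => ⟨hy.1, fun i => ?_⟩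
  exact (Finset.single_le_sum (fun j _ => hy.1 j) (Finset.mem_univ i)).trans hy.2

lemma convexHull_range_eq_image_cornerSimplex {E : Type*} [AddCommGroup E] [Module ℝ E] {n : ℕ}
    (a : Fin (n + 1) → E) :
    convexHull ℝ (Set.range a) =
      (fun y : Fin n → ℝ => a 0 + ∑ i, y i • (a i.succ - a 0)) '' cornerSimplex n := by
  let L : (Fin (n + 1) → ℝ) →ₗ[ℝ] E := Fintype.linearCombination ℝ a
  have h1 : Set.range a = L '' (Set.range fun i j => if i = j then (1 : ℝ) else 0) := by
    rw [← Set.range_comp]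
    congr 1
    ext i
    simp [L, Fintype.linearCombination_apply]
  rw [h1, ← LinearMap.image_convexHull, convexHull_basis_eq_stdSimplex]
  ext x
  constructor
  · rintro ⟨w, ⟨hw0, hw1⟩, rfl⟩
    rw [Fin.sum_univ_succ] at hw1
    refine ⟨fun i => w i.succ, ⟨fun i => hw0 _, by linarith [hw0 0]⟩, ?_⟩
    simp only [L, Fintype.linearCombination_apply, Fin.sum_univ_succ, smul_sub,
      Finset.sum_sub_distrib, ← Finset.sum_smul]
    rw [← eq_sub_iff_add_eq] at hw1
    rw [hw1, sub_smul, one_smul]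
    abel
  · rintro ⟨y, ⟨hy0, hy1⟩, rfl⟩
    refine ⟨Fin.cons (1 - ∑ i, y i) y, ⟨fun i => ?_, ?_⟩, ?_⟩
    · refine Fin.cases ?_ (fun j => ?_) i
      · simpa using hy1
      · simpa using hy0 j
    · simp [Fin.sum_univ_succ]
    · simp only [L, Fintype.linearCombination_apply, Fin.sum_univ_succ, smul_sub,
        Finset.sum_sub_distrib, ← Finset.sum_smul, Fin.cons_zero, Fin.cons_succ, sub_smul, one_smul]
      abel

lemma setIntegral_affine_image {n : ℕ} (w : Fin n → EuclideanSpace ℝ (Fin n))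
    (p : EuclideanSpace ℝ (Fin n)) (hdet : (Matrix.of fun i j => w j i).det ≠ 0)
    {S : Set (Fin n → ℝ)} (hS : MeasurableSet S) (f : EuclideanSpace ℝ (Fin n) → ℝ) :
    ∫ x in (fun y : Fin n → ℝ => p + ∑ i, y i • w i) '' S, f x =
      |(Matrix.of fun i j => w j i).det| * ∫ y in S, f (p + ∑ i, y i • w i) := by
  set W : Matrix (Fin n) (Fin n) ℝ := Matrix.of fun i j => w j i
  have hemb : MeasurableEmbedding (WithLp.toLp 2 : (Fin n → ℝ) → EuclideanSpace ℝ (Fin n)) :=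
    (MeasurableEquiv.toLp 2 (Fin n → ℝ)).measurableEmbedding
  have hg : ∀ y : Fin n → ℝ, p + ∑ i, y i • w i =
      WithLp.toLp 2 (p.ofLp + Matrix.toLin' W y) := by
    intro y
    ext i
    simp [W, Matrix.mulVec, dotProduct, mul_comm]
  have himg : (fun y : Fin n → ℝ => p + ∑ i, y i • w i) '' S =
      WithLp.toLp 2 '' ((fun y => p.ofLp + Matrix.toLin' W y) '' S) := by
    rw [Set.image_image]
    exact Set.image_congr fun y _ => hg y
  have hinj : Function.Injective (fun y : Fin n → ℝ => p.ofLp + Matrix.toLin' W y) := by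
    refine (add_right_injective _).comp ?_
    intro x y hxy
    exact Matrix.mulVec_injective_iff_isUnit.2
      ((Matrix.isUnit_iff_isUnit_det W).2 (isUnit_iff_ne_zero.2 hdet))
      (by simpa only [Matrix.toLin'_apply] using hxy)
  let M : (Fin n → ℝ) →L[ℝ] (Fin n → ℝ) := LinearMap.toContinuousLinearMap (Matrix.toLin' W)
  have hder : ∀ y ∈ S, HasFDerivWithinAt (fun y : Fin n → ℝ => p.ofLp + Matrix.toLin' W y) M S y :=
    fun y _ => (M.hasFDerivAt.const_add _).hasFDerivWithinAt
  have hM : M.det = W.det := by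
    change LinearMap.det (M : (Fin n → ℝ) →ₗ[ℝ] (Fin n → ℝ)) = _
    simp [M, LinearMap.det_toLin']
  rw [himg, (PiLp.volume_preserving_toLp (Fin n)).setIntegral_image_emb hemb,
    integral_image_eq_integral_abs_det_fderiv_smul volume hS hder hinj.injOn]
  simp only [hM, smul_eq_mul, ← hg]
  rw [integral_const_mul]

/-- Integration of a derivative along the first coordinate over the corner simplex. -/
lemma integral_cornerSimplex_deriv {n : ℕ} {g g' : (Fin (n + 1) → ℝ) → ℝ} (hg : Continuous g')
    (hd : ∀ z : Fin n → ℝ, ∀ s : ℝ,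
      HasDerivAt (fun s => g (Fin.cons s z)) (g' (Fin.cons s z)) s) :
    ∫ y in cornerSimplex (n + 1), g' y =
      ∫ z in cornerSimplex n, (g (Fin.cons (1 - ∑ i, z i) z) - g (Fin.cons 0 z)) := by
  have hms := (isClosed_cornerSimplex (n + 1)).measurableSet
  have hmp := (volume_preserving_piFinSuccAbove (fun _ : Fin (n + 1) => ℝ) 0)
  have hsymm : ∀ z : ℝ × (Fin n → ℝ),
      (MeasurableEquiv.piFinSuccAbove (fun _ : Fin (n + 1) => ℝ) 0).symm z = Fin.cons z.1 z.2 := by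
    intro z
    ext i
    refine Fin.cases ?_ (fun j => ?_) i <;> simp
  have hint : Integrable ((cornerSimplex (n + 1)).indicator g') :=
    (integrable_indicator_iff hms).2 (hg.continuousOn.integrableOn_compact (isCompact_cornerSimplex _))
  have hint2 := (hmp.symm.integrable_comp_emb
    (MeasurableEquiv.measurableEmbedding _)).2 hint
  rw [← integral_indicator hms, ← hmp.symm.integral_comp (MeasurableEquiv.measurableEmbedding _),
    ← integral_indicator (isClosed_cornerSimplex n).measurableSet, Measure.volume_eq_prod,
    integral_prod_symm]
  swap
  · exact hint2
  congr 1
  ext z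
  simp only [hsymm]
  by_cases hz : z ∈ cornerSimplex n
  · rw [Set.indicator_of_mem hz]
    have hle : (0 : ℝ) ≤ 1 - ∑ i, z i := by linarith [hz.2]
    -- Over a point `z` of the lower-dimensional simplex, the slice in the first coordinate is the
    -- interval from `0` to `1 - ∑ zᵢ`; over other points it is empty.
    have hind : (fun s : ℝ => (cornerSimplex (n + 1)).indicator g' (Fin.cons s z)) =
        (Set.Icc 0 (1 - ∑ i, z i)).indicator (fun s => g' (Fin.cons s z)) := by
      ext s
      have : (Fin.cons s z : Fin (n + 1) → ℝ) ∈ cornerSimplex (n + 1) ↔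
          s ∈ Set.Icc 0 (1 - ∑ i, z i) := by
        constructor
        · rintro ⟨h1, h2⟩
          refine ⟨by simpa using h1 0, ?_⟩
          simp [Fin.sum_univ_succ] at h2
          linarith
        · rintro ⟨h1, h2⟩
          refine ⟨fun i => Fin.cases (by simpa using h1) (fun j => by simpa using hz.1 j) i, ?_⟩
          simp [Fin.sum_univ_succ]
          linarith
      by_cases h : s ∈ Set.Icc 0 (1 - ∑ i, z i)
      · rw [Set.indicator_of_mem h, Set.indicator_of_mem (this.2 h)]
      · rw [Set.indicator_of_notMem h, Set.indicator_of_notMem (fun h' => h (this.1 h'))]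
    rw [hind, integral_indicator measurableSet_Icc, integral_Icc_eq_integral_Ioc,
      ← intervalIntegral.integral_of_le hle,
      intervalIntegral.integral_eq_sub_of_hasDerivAt (fun s _ => hd z s)]
    refine Continuous.intervalIntegrable ?_ _ _
    exact hg.comp (Continuous.finCons continuous_id continuous_const)
  · rw [Set.indicator_of_notMem hz]
    refine integral_eq_zero_of_ae (Filter.Eventually.of_forall fun s => ?_)
    refine Set.indicator_of_notMem (fun h => hz ⟨fun i => by simpa using h.1 i.succ, ?_⟩) _
    have h1 := h.2
    have h0 := h.1 0
    simp [Fin.sum_univ_succ] at h0 h1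
    linarith

/-! ### Determinants and faces -/

/-- The determinant of three vectors. -/
def det3 (u v w : E3) : ℝ := (Matrix.of fun i j => (![u, v, w] : Fin 3 → E3) j i).det

lemma det3_eq (u v w : E3) : det3 u v w = u 0 * v 1 * w 2 - u 0 * w 1 * v 2 - v 0 * u 1 * w 2
    + v 0 * w 1 * u 2 + w 0 * u 1 * v 2 - w 0 * v 1 * u 2 := by
  simp [det3, Matrix.det_fin_three]

lemma det3_eq_basis_det (u v w : E3) :
    det3 u v w = (EuclideanSpace.basisFun (Fin 3) ℝ).toBasis.det ![u, v, w] := by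
  rw [det3, Module.Basis.det_apply]
  congr 1

lemma det3_ne_zero_of_linearIndependent {u v w : E3} (h : LinearIndependent ℝ ![u, v, w]) :
    det3 u v w ≠ 0 := by
  rw [det3_eq_basis_det]
  exact (((Module.Basis.is_basis_iff_det _).1
    ⟨h, h.span_eq_top_of_card_eq_finrank' (by simp)⟩)).ne_zero

lemma abs_det3_eq_of_orthonormalBasis (b : OrthonormalBasis (Fin 3) ℝ E3) (u v w : E3) :
    |det3 u v w| = |(Matrix.of fun i j => inner ℝ (b i) ((![u, v, w] : Fin 3 → E3) j)).det| := by
  set e := EuclideanSpace.basisFun (Fin 3) ℝ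
  have h1 : det3 u v w = e.toBasis.det ![u, v, w] := det3_eq_basis_det u v w
  have h2 : (Matrix.of fun i j => inner ℝ (b i) ((![u, v, w] : Fin 3 → E3) j)).det =
      b.toBasis.det ![u, v, w] := by
    rw [Module.Basis.det_apply]
    congr 1
    ext i j
    simp [Module.Basis.toMatrix_apply, b.repr_apply_apply]
  rw [h1, h2, AlternatingMap.eq_smul_basis_det b.toBasis e.toBasis.det]
  rcases e.det_to_matrix_orthonormalBasis_real b with h | h <;> simp [h]

/-- The surface integral over a triangle, in affine coordinates. -/
lemma integral_triangle (a : Fin 3 → E3) (ν : E3) (hν : ‖ν‖ = 1)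
    (h1 : inner ℝ ν (a 1 - a 0) = 0) (h2 : inner ℝ ν (a 2 - a 0) = 0)
    {v₀ : E3} (hdet : det3 v₀ (a 1 - a 0) (a 2 - a 0) ≠ 0) :
    (μHE[2] : Measure E3) (convexHull ℝ (Set.range a)) < ⊤ ∧ ∀ (v : E3) (f : E3 → ℝ),
    |inner ℝ v ν| * ∫ x in convexHull ℝ (Set.range a), f x ∂(μHE[2] : Measure E3) =
      |det3 v (a 1 - a 0) (a 2 - a 0)| *
        ∫ y in cornerSimplex 2, f (a 0 + ∑ i, y i • (a i.succ - a 0)) := by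
  -- With `ν` as the third vector of an orthonormal basis, the other two parametrize the plane of
  -- the triangle isometrically, so Hausdorff measure there is Lebesgue measure in two coordinates.
  obtain ⟨b, hb⟩ := Orthonormal.exists_orthonormalBasis_extension_of_card_eq (𝕜 := ℝ) (E := E3)
    (ι := Fin 3) (by simp) (v := fun _ => ν) (s := {2}) (by
      rw [orthonormal_iff_ite]
      rintro ⟨i, rfl⟩ ⟨j, rfl⟩
      simp [hν])
  have hb2 : b 2 = ν := hb 2 rfl
  let ι : EuclideanSpace ℝ (Fin 2) → E3 := fun z => a 0 + (z 0 • b 0 + z 1 • b 1)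
  have hb00 : ∀ i j, inner ℝ (b i) (b j) = if i = j then (1 : ℝ) else 0 := fun i j =>
    orthonormal_iff_ite.1 b.orthonormal i j
  have hι : Isometry ι := by
    refine Isometry.of_dist_eq fun x y => ?_
    rw [dist_eq_norm, dist_eq_norm]
    have : ι x - ι y = (x 0 - y 0) • b 0 + (x 1 - y 1) • b 1 := by
      simp only [ι, sub_smul]; abel
    rw [this, ← sq_eq_sq₀ (norm_nonneg _) (norm_nonneg _), ← real_inner_self_eq_norm_sq (_ • _ + _ • _),
      ← real_inner_self_eq_norm_sq (x - y)]
    simp only [inner_add_left, inner_add_right, inner_smul_left, inner_smul_right, hb00,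
      PiLp.inner_apply, Fin.sum_univ_two]
    simp
    ring
  let w : Fin 2 → EuclideanSpace ℝ (Fin 2) := fun j =>
    !₂[inner ℝ (b 0) (a j.succ - a 0), inner ℝ (b 1) (a j.succ - a 0)]
  have hw : ∀ j : Fin 2, w j 0 • b 0 + w j 1 • b 1 = a j.succ - a 0 := by
    intro j
    conv_rhs => rw [← b.sum_repr' (a j.succ - a 0)]
    rw [Fin.sum_univ_three, hb2]
    have : inner ℝ ν (a j.succ - a 0) = 0 := by
      fin_cases j
      · exact h1
      · exact h2
    simp [w, this]
  have hιw : ∀ y : Fin 2 → ℝ, ι (0 + ∑ i, y i • w i) = a 0 + ∑ i, y i • (a i.succ - a 0) := by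
    intro y
    simp only [ι, Fin.sum_univ_two, ← hw]
    simp only [PiLp.add_apply, PiLp.smul_apply, PiLp.zero_apply, smul_eq_mul]
    module
  -- In the basis `b` the edge vectors have no third component, so the determinant splits into `u·ν`
  -- times a planar determinant. Keeping the factor `|v·ν|` in the formula avoids any explicit area.
  have hdetw : ∀ u : E3, |det3 u (a 1 - a 0) (a 2 - a 0)| =
      |inner ℝ u ν| * |(Matrix.of fun i j => w j i).det| := by
    intro u
    rw [abs_det3_eq_of_orthonormalBasis b, ← abs_mul]
    congr 1
    simp only [Matrix.det_fin_three, Matrix.det_fin_two, Matrix.of_apply, hb2, w]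
    simp [h1, h2, real_inner_comm]
    ring
  -- The vector `v₀` serves only here, to show that the triangle is nondegenerate.
  have hW : (Matrix.of fun i j => w j i).det ≠ 0 := by
    intro h0
    have := hdetw v₀
    rw [h0] at this
    simp [hdet] at this
  have himg : convexHull ℝ (Set.range a) =
      ι '' ((fun y : Fin 2 → ℝ => 0 + ∑ i, y i • w i) '' cornerSimplex 2) := by
    rw [convexHull_range_eq_image_cornerSimplex, Set.image_image]
    exact Set.image_congr fun y _ => (hιw y).symm
  have hsub : convexHull ℝ (Set.range a) ⊆ Set.range ι := by
    rw [himg]; exact Set.image_subset_range _ _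
  have hemb : MeasurableEmbedding ι := hι.isClosedEmbedding.measurableEmbedding
  have hpre : ι ⁻¹' (convexHull ℝ (Set.range a)) =
      (fun y : Fin 2 → ℝ => 0 + ∑ i, y i • w i) '' cornerSimplex 2 := by
    rw [himg, Set.preimage_image_eq _ hι.injective]
  refine ⟨?_, fun v f => ?_⟩
  · rw [himg, hι.euclideanHausdorffMeasure_image,
      EuclideanSpace.euclideanHausdorffMeasure_eq_volume]
    exact ((isCompact_cornerSimplex 2).image (by fun_prop)).measure_lt_top
  have hres : (μHE[2] : Measure E3).restrict (convexHull ℝ (Set.range a)) =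
      (Measure.map ι volume).restrict (convexHull ℝ (Set.range a)) := by
    rw [← EuclideanSpace.euclideanHausdorffMeasure_eq_volume, hι.map_euclideanHausdorffMeasure,
      Measure.restrict_restrict_of_subset hsub]
  rw [hres, hemb.setIntegral_map, hpre,
    setIntegral_affine_image w 0 hW (isClosed_cornerSimplex 2).measurableSet, hdetw v, mul_assoc]
  simp only [hιw]

/-- Integration of the derivative along an edge over a tetrahedron. -/
lemma integral_tetrahedron_edge (a : Fin 4 → E3)
    (hdet : det3 (a 1 - a 0) (a 2 - a 0) (a 3 - a 0) ≠ 0) {f : E3 → ℝ} (hf : ContDiff ℝ 1 f) :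
    ∫ x in convexHull ℝ (Set.range a), fderiv ℝ f x (a 1 - a 0) =
      |det3 (a 1 - a 0) (a 2 - a 0) (a 3 - a 0)| *
        ((∫ z in cornerSimplex 2, f (a 1 + (z 0 • (a 2 - a 1) + z 1 • (a 3 - a 1)))) -
          ∫ z in cornerSimplex 2, f (a 0 + (z 0 • (a 2 - a 0) + z 1 • (a 3 - a 0)))) := by
  let w : Fin 3 → E3 := fun i => a i.succ - a 0
  have hdw : (Matrix.of fun i j => w j i).det = det3 (a 1 - a 0) (a 2 - a 0) (a 3 - a 0) := by
    simp only [det3, Matrix.det_fin_three, w]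
    rfl
  rw [convexHull_range_eq_image_cornerSimplex,
    setIntegral_affine_image w (a 0) (by rwa [hdw]) (isClosed_cornerSimplex 3).measurableSet, hdw]
  congr 1
  have hcont : Continuous fun y : Fin 3 → ℝ => a 0 + ∑ i, y i • w i := by fun_prop
  have hf' : Continuous (fderiv ℝ f) := hf.continuous_fderiv (by simp)
  -- In these coordinates `a 1 - a 0` is the first coordinate direction. The upper end of each slice
  -- lies on the face opposite `a 0`, the lower end on the face opposite `a 1`.
  rw [integral_cornerSimplex_deriv (g := fun y => f (a 0 + ∑ i, y i • w i))
    (g' := fun y => fderiv ℝ f (a 0 + ∑ i, y i • w i) (a 1 - a 0))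
    ((hf'.comp hcont).clm_apply continuous_const)]
  · have hc1 : Continuous fun z : Fin 2 → ℝ => a 1 + (z 0 • (a 2 - a 1) + z 1 • (a 3 - a 1)) := by
      fun_prop
    have hc0 : Continuous fun z : Fin 2 → ℝ => a 0 + (z 0 • (a 2 - a 0) + z 1 • (a 3 - a 0)) := by
      fun_prop
    have hi1 : IntegrableOn (fun z : Fin 2 → ℝ => f (a 1 + (z 0 • (a 2 - a 1) + z 1 • (a 3 - a 1))))
        (cornerSimplex 2) :=
      (hf.continuous.comp hc1).continuousOn.integrableOn_compact (isCompact_cornerSimplex 2)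
    have hi0 : IntegrableOn (fun z : Fin 2 → ℝ => f (a 0 + (z 0 • (a 2 - a 0) + z 1 • (a 3 - a 0))))
        (cornerSimplex 2) :=
      (hf.continuous.comp hc0).continuousOn.integrableOn_compact (isCompact_cornerSimplex 2)
    rw [← integral_sub hi1 hi0]
    congr 1
    ext z
    congr 2
    · simp only [Fin.sum_univ_succ, w, Fin.cons_zero, Fin.cons_succ]
      simp
      module
    · simp only [Fin.sum_univ_succ, w, Fin.cons_zero, Fin.cons_succ]
      simp
  · intro z s
    have h1 : HasDerivAt (fun s : ℝ => a 0 + ∑ i, (Fin.cons s z : Fin 3 → ℝ) i • w i) (a 1 - a 0) s := by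
      simp only [Fin.sum_univ_succ (n := 2), Fin.cons_zero, Fin.cons_succ]
      have := ((hasDerivAt_id s).smul_const (w 0)).add_const (∑ i : Fin 2, z i • w i.succ)
      simpa [w] using this.const_add (a 0)
    exact ((hf.differentiable (by simp) _).hasFDerivAt).comp_hasDerivAt s h1

namespace Triangulation

/-! ### Normals and the divergence theorem on a tetrahedron -/

lemma barycentre_sub_mem_vectorSpan {e : Finset E3} {b : E3} (hb : b ∈ e) :
    barycentre e - b ∈ vectorSpan ℝ (e : Set E3) := by
  have hc : (e.card : ℝ) ≠ 0 := by
    exact_mod_cast Finset.card_ne_zero_of_mem hb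
  have : barycentre e - b = (e.card : ℝ)⁻¹ • ∑ v ∈ e, (v - b) := by
    rw [Finset.sum_sub_distrib, Finset.sum_const, smul_sub, ← Nat.cast_smul_eq_nsmul ℝ, smul_smul,
      inv_mul_cancel₀ hc, one_smul, barycentre]
  rw [this]
  exact Submodule.smul_mem _ _ (Submodule.sum_mem _ fun v hv => vsub_mem_vectorSpan ℝ hv hb)

lemma notMem_affineSpan_erase {K : Finset E3}
    (hK : AffineIndependent ℝ ((↑) : K → E3)) {a : E3} (ha : a ∈ K) :
    a ∉ affineSpan ℝ ((K.erase a : Finset E3) : Set E3) := by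
  have h := hK.notMem_affineSpan_sdiff ⟨a, ha⟩ Set.univ
  convert h using 3
  ext x
  simp [and_comm, eq_comm]

/-- The difference of barycentres is a positive multiple of `barycentre e - a`. Its normal part is
nonzero because `a` is outside the affine span of the face, and it points away from `a`, which gives
the sign. -/
lemma outwardNormal_spec {K : Finset E3} (hK : AffineIndependent ℝ ((↑) : K → E3)) {a : E3}
    (ha : a ∈ K) (hne : (K.erase a).Nonempty) :
    ‖outwardNormal K (K.erase a)‖ = 1 ∧
    (∀ b ∈ K.erase a, ∀ c ∈ K.erase a, inner ℝ (outwardNormal K (K.erase a)) (c - b) = 0) ∧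
    ∀ b ∈ K.erase a, inner ℝ (outwardNormal K (K.erase a)) (a - b) < 0 := by
  set e := K.erase a with he
  set V := vectorSpan ℝ (e : Set E3)
  have hcard : (K.card : ℝ) = e.card + 1 := by
    exact_mod_cast (Finset.card_erase_add_one ha).symm
  have hepos : (0 : ℝ) < e.card := by exact_mod_cast hne.card_pos
  have hbary : barycentre e - barycentre K = (K.card : ℝ)⁻¹ • (barycentre e - a) := by
    have h1 : ∑ v ∈ K, v = (e.card : ℝ) • barycentre e + a := by
      rw [barycentre, smul_smul, mul_inv_cancel₀ hepos.ne', one_smul, he,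
        Finset.sum_erase_add K _ ha]
    have hKc : (e.card + 1 : ℝ) ≠ 0 := by positivity
    rw [barycentre.eq_1 K, h1, hcard, smul_add, smul_sub, ← sub_sub, smul_smul]
    congr 1
    nth_rewrite 1 [← one_smul ℝ (barycentre e)]
    rw [← sub_smul]
    congr 1
    field_simp
    ring
  set d := Vᗮ.starProjection (barycentre e - barycentre K) with hd
  have hdV : d ∈ Vᗮ := Submodule.starProjection_apply_mem _ _
  have hdsub : (barycentre e - barycentre K) - d ∈ V := by
    have := Submodule.sub_starProjection_mem_orthogonal (K := Vᗮ) (barycentre e - barycentre K)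
    rwa [Submodule.orthogonal_orthogonal] at this
  have hd0 : d ≠ 0 := by
    intro h0
    rw [h0, sub_zero, hbary] at hdsub
    have h2 : barycentre e - a ∈ V := by
      have := V.smul_mem (K.card : ℝ) hdsub
      rwa [smul_smul, mul_inv_cancel₀ (by rw [hcard]; positivity), one_smul] at this
    obtain ⟨b, hb⟩ := hne
    have h3 : a - b ∈ V := by
      have := V.sub_mem (barycentre_sub_mem_vectorSpan hb) h2
      simpa using this
    refine notMem_affineSpan_erase hK ha ?_
    have := (AffineSubspace.vadd_mem_iff_mem_direction (s := affineSpan ℝ (e : Set E3)) (a - b)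
      (subset_affineSpan ℝ _ hb)).2 (by rwa [direction_affineSpan])
    simpa only [vadd_eq_add, sub_add_cancel] using this
  have hν : outwardNormal K e = ‖d‖⁻¹ • d := rfl
  have hdn : 0 < ‖d‖ := norm_pos_iff.2 hd0
  have horth : ∀ x ∈ V, inner ℝ d x = 0 := fun x hx => by
    rw [real_inner_comm]; exact hdV x hx
  refine ⟨?_, fun b hb c hc => ?_, fun b hb => ?_⟩
  · rw [hν, norm_smul, norm_inv, norm_norm, inv_mul_cancel₀ hdn.ne']
  · rw [hν, inner_smul_left, horth (c - b) (vsub_mem_vectorSpan ℝ hc hb), mul_zero]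
  · have h1 : inner ℝ d (barycentre e - barycentre K) = ‖d‖ ^ 2 := by
      have := horth _ hdsub
      rw [inner_sub_right, real_inner_self_eq_norm_sq] at this
      linarith
    have h2 : inner ℝ d (a - b) = - (K.card * ‖d‖ ^ 2) := by
      have h3 : a - b = (barycentre e - b) - (K.card : ℝ) • (barycentre e - barycentre K) := by
        rw [hbary, smul_smul, mul_inv_cancel₀ (by rw [hcard]; positivity), one_smul]
        abel
      rw [h3, inner_sub_right, inner_smul_right, h1, horth _ (barycentre_sub_mem_vectorSpan hb)]
      ring
    rw [hν, inner_smul_left, h2, hcard]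
    simp only [conj_trivial]
    have : 0 < ‖d‖⁻¹ * ((e.card + 1) * ‖d‖ ^ 2) := by positivity
    linarith

/-- A list of the vertices of a tetrahedron that starts with two given ones. -/
lemma exists_vertices {K : Finset E3} (hc : K.card = 4) {a₀ a₁ : E3} (h0 : a₀ ∈ K) (h1 : a₁ ∈ K)
    (h01 : a₀ ≠ a₁) : ∃ a₂ a₃, K = {a₀, a₁, a₂, a₃} ∧ a₀ ≠ a₂ ∧ a₀ ≠ a₃ ∧ a₁ ≠ a₂ ∧ a₁ ≠ a₃ ∧
      a₂ ≠ a₃ := by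
  have h1' : a₁ ∈ K.erase a₀ := Finset.mem_erase.2 ⟨h01.symm, h1⟩
  have hc2 : ((K.erase a₀).erase a₁).card = 2 := by
    rw [Finset.card_erase_of_mem h1', Finset.card_erase_of_mem h0, hc]
  obtain ⟨a₂, a₃, h23, he⟩ := Finset.card_eq_two.1 hc2
  have hm2 : a₂ ∈ (K.erase a₀).erase a₁ := by rw [he]; simp
  have hm3 : a₃ ∈ (K.erase a₀).erase a₁ := by rw [he]; simp
  simp only [Finset.mem_erase] at hm2 hm3
  refine ⟨a₂, a₃, ?_, hm2.2.1.symm, hm3.2.1.symm, hm2.1.symm, hm3.1.symm, h23⟩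
  rw [← he, Finset.insert_erase h1', Finset.insert_erase h0]

lemma det3_ne_zero_of_affineIndependent {a₀ a₁ a₂ a₃ : E3} {K : Finset E3}
    (hK : AffineIndependent ℝ ((↑) : K → E3)) (hKe : K = {a₀, a₁, a₂, a₃}) (h01 : a₀ ≠ a₁)
    (h02 : a₀ ≠ a₂) (h03 : a₀ ≠ a₃) (h12 : a₁ ≠ a₂) (h13 : a₁ ≠ a₃) (h23 : a₂ ≠ a₃) :
    det3 (a₁ - a₀) (a₂ - a₀) (a₃ - a₀) ≠ 0 := by
  have hli := (affineIndependent_iff_linearIndependent_vsub ℝ ((↑) : K → E3)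
    ⟨a₀, by simp [hKe]⟩).1 hK
  apply det3_ne_zero_of_linearIndependent
  let φ : Fin 3 → {x : K // x ≠ ⟨a₀, by simp [hKe]⟩} :=
    ![⟨⟨a₁, by simp [hKe]⟩, by simp [h01.symm]⟩, ⟨⟨a₂, by simp [hKe]⟩, by simp [h02.symm]⟩,
      ⟨⟨a₃, by simp [hKe]⟩, by simp [h03.symm]⟩]
  have hφ : Function.Injective φ := by
    intro i j hij
    fin_cases i <;> fin_cases j <;> simp_all [φ, Subtype.ext_iff]
  have h := hli.comp φ hφ
  have he : ![a₁ - a₀, a₂ - a₀, a₃ - a₀] =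
      (fun i : {x : K // x ≠ ⟨a₀, by simp [hKe]⟩} => (i : E3) -ᵥ a₀) ∘ φ := by
    ext i : 1
    fin_cases i <;> rfl
  rw [he]
  exact h

/-- Surface integrals over a face of a tetrahedron. -/
lemma integral_face {K : Finset E3} (hK : AffineIndependent ℝ ((↑) : K → E3))
    {a p q r : E3} (hKe : K = {a, p, q, r}) (hap : a ≠ p) (haq : a ≠ q) (har : a ≠ r)
    (hpq : p ≠ q) (hpr : p ≠ r) (hqr : q ≠ r) :
    (μHE[2] : Measure E3) (convexHull ℝ ((K.erase a : Finset E3) : Set E3)) < ⊤ ∧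
    ∀ (v : E3) (f : E3 → ℝ), |inner ℝ v (outwardNormal K (K.erase a))| *
      ∫ x in convexHull ℝ ((K.erase a : Finset E3) : Set E3), f x ∂(μHE[2] : Measure E3) =
      |det3 v (q - p) (r - p)| *
        ∫ z in cornerSimplex 2, f (p + (z 0 • (q - p) + z 1 • (r - p))) := by
  have he : K.erase a = {p, q, r} := by
    rw [hKe, Finset.erase_insert]
    simp [hap, haq, har]
  have hr : ((K.erase a : Finset E3) : Set E3) = Set.range ![p, q, r] := by
    rw [he]; ext x; simp; tauto
  obtain ⟨h1, h2, -⟩ := outwardNormal_spec hK (a := a) (by simp [hKe]) (by simp [he])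
  have hK' : K = {p, a, q, r} := by rw [hKe, Finset.insert_comm]
  have hdet := det3_ne_zero_of_affineIndependent hK hK' hap.symm hpq hpr haq har hqr
  have := integral_triangle ![p, q, r] (outwardNormal K (K.erase a)) h1
    (h2 p (by simp [he]) q (by simp [he])) (h2 p (by simp [he]) r (by simp [he])) hdet
  rw [hr]
  simpa [Fin.sum_univ_two] using this

lemma face_measure_lt_top {K : Finset E3} (hK : AffineIndependent ℝ ((↑) : K → E3))
    (hc : K.card = 4) {a : E3} (ha : a ∈ K) :
    (μHE[2] : Measure E3) (convexHull ℝ ((K.erase a : Finset E3) : Set E3)) < ⊤ := by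
  obtain ⟨p, hp⟩ : (K.erase a).Nonempty := by
    rw [← Finset.card_pos, Finset.card_erase_of_mem ha, hc]; norm_num
  obtain ⟨q, r, hKe, h1, h2, h3, h4, h5⟩ :=
    exists_vertices hc ha (Finset.mem_of_mem_erase hp) (Finset.ne_of_mem_erase hp).symm
  exact (integral_face hK hKe (Finset.ne_of_mem_erase hp).symm h1 h2 h3 h4 h5).1

lemma isCompact_convexHull_finset (e : Finset E3) : IsCompact (convexHull ℝ (e : Set E3)) :=
  e.finite_toSet.isCompact_convexHull ℝ

lemma integrableOn_face {K : Finset E3} (hK : AffineIndependent ℝ ((↑) : K → E3))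
    (hc : K.card = 4) {a : E3} (ha : a ∈ K) {f : E3 → ℝ} (hf : Continuous f) :
    IntegrableOn f (convexHull ℝ ((K.erase a : Finset E3) : Set E3)) (μHE[2] : Measure E3) := by
  have hcomp := isCompact_convexHull_finset (K.erase a)
  obtain ⟨C, hC⟩ := hcomp.exists_bound_of_continuousOn hf.continuousOn
  exact Measure.integrableOn_of_bounded (face_measure_lt_top hK hc ha).ne
    hf.aestronglyMeasurable (M := C)
    ((ae_restrict_iff' hcomp.measurableSet).2 (Filter.Eventually.of_forall hC))

/-- The edge is tangent to the two faces that contain it, so only the faces opposite `a₀` and `a₁`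
contribute. These are the ends of the integration along the edge; both parametrizations carry the
same determinant, and outwardness of the normals supplies the signs. -/
lemma integral_fderiv_tetrahedron_edge {K : Finset E3} (hK : AffineIndependent ℝ ((↑) : K → E3))
    (hc : K.card = 4) {a₀ a₁ : E3} (h0 : a₀ ∈ K) (h1 : a₁ ∈ K) (h01 : a₀ ≠ a₁) {f : E3 → ℝ}
    (hf : ContDiff ℝ 1 f) :
    ∫ x in convexHull ℝ (K : Set E3), fderiv ℝ f x (a₁ - a₀) =
      ∑ a ∈ K, inner ℝ (a₁ - a₀) (outwardNormal K (K.erase a)) *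
        ∫ x in convexHull ℝ ((K.erase a : Finset E3) : Set E3), f x ∂(μHE[2] : Measure E3) := by
  obtain ⟨a₂, a₃, hKe, h02, h03, h12, h13, h23⟩ := exists_vertices hc h0 h1 h01
  have hdet := det3_ne_zero_of_affineIndependent hK hKe h01 h02 h03 h12 h13 h23
  have hv : ∫ x in convexHull ℝ (Set.range ![a₀, a₁, a₂, a₃]), fderiv ℝ f x (a₁ - a₀) =
      |det3 (a₁ - a₀) (a₂ - a₀) (a₃ - a₀)| *
        ((∫ z in cornerSimplex 2, f (a₁ + (z 0 • (a₂ - a₁) + z 1 • (a₃ - a₁)))) -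
          ∫ z in cornerSimplex 2, f (a₀ + (z 0 • (a₂ - a₀) + z 1 • (a₃ - a₀)))) :=
    integral_tetrahedron_edge ![a₀, a₁, a₂, a₃] hdet hf
  have hr : (K : Set E3) = Set.range ![a₀, a₁, a₂, a₃] := by
    rw [hKe]; ext x; simp; tauto
  have hne (a : E3) (ha : a ∈ K) : (K.erase a).Nonempty := by
    rw [← Finset.card_pos, Finset.card_erase_of_mem ha, hc]; norm_num
  have h2 : a₂ ∈ K := by simp [hKe]
  have h3 : a₃ ∈ K := by simp [hKe]
  have hz (a : E3) (ha : a ∈ K) (ha0 : a₀ ≠ a) (ha1 : a₁ ≠ a) :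
      inner ℝ (a₁ - a₀) (outwardNormal K (K.erase a)) = 0 := by
    rw [real_inner_comm]
    exact (outwardNormal_spec hK ha (hne a ha)).2.1 _ (Finset.mem_erase.2 ⟨ha0, h0⟩) _
      (Finset.mem_erase.2 ⟨ha1, h1⟩)
  have hpos : 0 < inner ℝ (a₁ - a₀) (outwardNormal K (K.erase a₀)) := by
    have := (outwardNormal_spec hK h0 (hne _ h0)).2.2 a₁ (Finset.mem_erase.2 ⟨h01.symm, h1⟩)
    rw [real_inner_comm, ← neg_sub a₁ a₀, inner_neg_left] at this
    linarith
  have hneg : inner ℝ (a₁ - a₀) (outwardNormal K (K.erase a₁)) < 0 := by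
    have := (outwardNormal_spec hK h1 (hne _ h1)).2.2 a₀ (Finset.mem_erase.2 ⟨h01, h0⟩)
    rwa [real_inner_comm] at this
  have hf0 := (integral_face hK hKe h01 h02 h03 h12 h13 h23).2 (a₁ - a₀) f
  have hKe' : K = {a₁, a₀, a₂, a₃} := by rw [hKe, Finset.insert_comm]
  have hf1 := (integral_face hK hKe' h01.symm h12 h13 h02 h03 h23).2 (a₁ - a₀) f
  rw [abs_of_pos hpos] at hf0
  rw [abs_of_neg hneg] at hf1
  have hdeteq : det3 (a₁ - a₀) (a₂ - a₁) (a₃ - a₁) = det3 (a₁ - a₀) (a₂ - a₀) (a₃ - a₀) := by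
    simp only [det3_eq, PiLp.sub_apply]
    ring
  have hsum : ∀ F : E3 → ℝ, ∑ a ∈ K, F a = F a₀ + (F a₁ + (F a₂ + F a₃)) := by
    intro F
    conv_lhs => rw [hKe]
    rw [Finset.sum_insert (by simp [h01, h02, h03]), Finset.sum_insert (by simp [h12, h13]),
      Finset.sum_insert (by simp [h23]), Finset.sum_singleton]
  rw [hsum, hz a₂ h2 h02 h12, hz a₃ h3 h03 h13, hf0, hdeteq, hr, hv]
  linarith

lemma vectorSpan_tetrahedron {K : Finset E3} (hK : AffineIndependent ℝ ((↑) : K → E3))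
    (hc : K.card = 4) : vectorSpan ℝ (K : Set E3) = ⊤ := by
  have := hK.vectorSpan_eq_top_of_card_eq_finrank_add_one (by simp [hc])
  simpa using this

/-- Both sides are linear in `v`, and the edges span the whole space. -/
lemma integral_fderiv_tetrahedron {K : Finset E3} (hK : AffineIndependent ℝ ((↑) : K → E3))
    (hc : K.card = 4) {f : E3 → ℝ} (hf : ContDiff ℝ 1 f) (v : E3) :
    ∫ x in convexHull ℝ (K : Set E3), fderiv ℝ f x v =
      ∑ a ∈ K, inner ℝ v (outwardNormal K (K.erase a)) *
        ∫ x in convexHull ℝ ((K.erase a : Finset E3) : Set E3), f x ∂(μHE[2] : Measure E3) := by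
  have hcomp := isCompact_convexHull_finset K
  have hint (w : E3) : IntegrableOn (fun x => fderiv ℝ f x w) (convexHull ℝ (K : Set E3)) :=
    ((hf.continuous_fderiv (by simp)).clm_apply continuous_const).continuousOn.integrableOn_compact
      hcomp
  have hv : v ∈ Submodule.span ℝ ((K : Set E3) -ᵥ (K : Set E3)) := by
    rw [← vectorSpan_def, vectorSpan_tetrahedron hK hc]
    trivial
  induction hv using Submodule.span_induction with
  | mem x hx =>
    obtain ⟨b, hb, c, hc', rfl⟩ := hx
    simp only [vsub_eq_sub]
    by_cases h : c = b
    · simp [h]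
    · exact integral_fderiv_tetrahedron_edge hK hc hc' hb h hf
  | zero => simp
  | add x y _ _ hx hy =>
    simp only [map_add, inner_add_left, add_mul, Finset.sum_add_distrib]
    rw [integral_add (hint x) (hint y), hx, hy]
  | smul c x _ hx =>
    simp only [map_smul, inner_smul_left, smul_eq_mul, mul_assoc, ← Finset.mul_sum]
    rw [integral_const_mul, hx]
    simp

/-- The divergence theorem on a tetrahedron. -/
theorem integral_div3_tetrahedron {K : Finset E3} (hK : AffineIndependent ℝ ((↑) : K → E3))
    (hc : K.card = 4) {F : E3 → E3} (hF : ContDiff ℝ 1 F) :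
    ∫ x in convexHull ℝ (K : Set E3), div3 F x =
      ∑ a ∈ K, ∫ x in convexHull ℝ ((K.erase a : Finset E3) : Set E3),
        inner ℝ (F x) (outwardNormal K (K.erase a)) ∂(μHE[2] : Measure E3) := by
  have hcomp := isCompact_convexHull_finset K
  have hFi (i : Fin 3) : ContDiff ℝ 1 (fun x => F x i) := contDiff_euclidean.1 hF i
  have hint (i : Fin 3) : IntegrableOn (dpart i fun x => F x i) (convexHull ℝ (K : Set E3)) :=
    (contDiff_dpart (m := 0) i (hFi i) (by simp)).continuous.continuousOn.integrableOn_compact hcomp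
  simp only [div3_eq (hF.differentiable (by simp) _)]
  have h2 := integral_add ((hint 0).add (hint 1)) (hint 2)
  simp only [Pi.add_apply] at h2
  rw [h2, integral_add (hint 0) (hint 1)]
  simp only [dpart, integral_fderiv_tetrahedron hK hc (hFi _), ← Finset.sum_add_distrib]
  refine Finset.sum_congr rfl fun a ha => ?_
  have hi (i : Fin 3) := integrableOn_face hK hc ha ((hFi i).continuous.mul
    (continuous_const (y := outwardNormal K (K.erase a) i)))
  simp only [E3.inner_eq]
  have h01 := integral_add (hi 0) (hi 1)
  have h012 := integral_add ((hi 0).add (hi 1)) (hi 2)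
  simp only [Pi.add_apply, Pi.mul_apply] at h01 h012
  rw [h012, h01]
  simp only [integral_mul_const]
  simp
  ring

end Triangulation

namespace Triangulation

variable {T : Triangulation}

/-! ### The cells of a triangulation -/

lemma Cell.affineIndependent (K : T.Cell) : AffineIndependent ℝ ((↑) : K.1 → E3) :=
  T.indep K.2.1

lemma Cell.isCompact_hull (K : T.Cell) : IsCompact K.hull := isCompact_convexHull_finset K.1

lemma Cell.convex_hull (K : T.Cell) : Convex ℝ K.hull := convex_convexHull ℝ _

lemma Cell.interior_nonempty (K : T.Cell) : (interior K.hull).Nonempty := by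
  rw [Cell.hull, interior_convexHull_nonempty_iff_affineSpan_eq_top]
  have h := K.affineIndependent.affineSpan_eq_top_iff_card_eq_finrank_add_one.2 (by simp [K.2.2])
  simpa using h

lemma Cell.interior_ae_eq (K : T.Cell) : (interior K.hull : Set E3) =ᵐ[volume] K.hull :=
  interior_ae_eq_of_null_frontier (K.convex_hull.addHaar_frontier volume)

lemma Cell.interior_subset_domain (K : T.Cell) : interior K.hull ⊆ T.domain :=
  interior_mono (Geometry.SimplicialComplex.convexHull_subset_space K.2.1)

/-- By conformity the intersection lies in the hull of the common vertices. If it had interior,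
these would span the space affinely, including a vertex of `K` that is not in `L`, against affine
independence. -/
lemma Cell.disjoint_interior {K L : T.Cell} (h : K ≠ L) :
    Disjoint (interior K.hull) (interior L.hull) := by
  obtain ⟨a, haK, haL⟩ : ∃ a ∈ K.1, a ∉ L.1 := by
    by_contra! hsub
    exact h (Subtype.ext (Finset.eq_of_subset_of_card_le hsub (by rw [K.2.2, L.2.2])))
  rw [Set.disjoint_iff_inter_eq_empty, ← interior_inter, Cell.hull, Cell.hull]
  by_contra hne
  have h1 := (Set.nonempty_iff_ne_empty.2 hne).mono
    (interior_mono (T.inter_subset_convexHull K.2.1 L.2.1))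
  rw [interior_convexHull_nonempty_iff_affineSpan_eq_top] at h1
  refine notMem_affineSpan_erase K.affineIndependent haK ?_
  refine affineSpan_mono ℝ (s₁ := (K.1 ∩ L.1 : Set E3)) ?_ (by rw [h1]; trivial)
  intro x hx
  simp only [Finset.coe_erase]
  exact ⟨hx.1, fun hxa => haL (hxa ▸ hx.2)⟩

variable (T) in
lemma space_eq_iUnion : T.space = ⋃ K : T.Cell, K.hull := by
  ext x
  simp only [Geometry.SimplicialComplex.mem_space_iff, Set.mem_iUnion]
  constructor
  · rintro ⟨e, he, hx⟩
    obtain ⟨K, hK, hc, heK⟩ := T.pure_dim e he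
    exact ⟨⟨K, hK, hc⟩, convexHull_mono (by exact_mod_cast heK) hx⟩
  · rintro ⟨K, hx⟩
    exact ⟨K.1, K.2.1, hx⟩

variable (T) in
lemma isCompact_space : IsCompact T.space := by
  rw [space_eq_iUnion]
  exact isCompact_iUnion fun K => K.isCompact_hull

variable (T) in
lemma isOpen_domain : IsOpen T.domain := isOpen_interior

variable (T) in
lemma domain_subset_space : T.domain ⊆ T.space := interior_subset

/-! ### Integrals of piecewise continuous functions -/

/-- All pieces are continuous. -/
def Cont {V : Type*} [TopologicalSpace V] (f : T.Cell → E3 → V) : Prop := ∀ K, Continuous (f K)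

section

variable {V : Type*} [NormedAddCommGroup V] {f g : T.Cell → E3 → V}

lemma Cont.add (hf : Cont f) (hg : Cont g) : Cont (f + g) := fun K => (hf K).add (hg K)

lemma Cont.neg (hf : Cont f) : Cont (-f) := fun K => (hf K).neg

lemma Cont.smul [NormedSpace ℝ V] (hf : Cont f) (c : ℝ) : Cont (c • f) := fun K => (hf K).const_smul c

end

lemma glue_eq_of_mem {V : Type*} [AddCommMonoid V] (f : T.Cell → E3 → V) {K : T.Cell} {x : E3}
    (hx : x ∈ interior K.hull) : glue f x = f K x := by
  rw [glue, Finset.sum_eq_single K, Set.indicator_of_mem hx]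
  · intro L _ hL
    exact Set.indicator_of_notMem (fun h => (Cell.disjoint_interior hL).ne_of_mem h hx rfl) _
  · simp

lemma glue_eq_zero {V : Type*} [AddCommMonoid V] (f : T.Cell → E3 → V) {x : E3}
    (hx : ∀ K : T.Cell, x ∉ interior K.hull) : glue f x = 0 :=
  Finset.sum_eq_zero fun K _ => Set.indicator_of_notMem (hx K) _

lemma glue_map {V W : Type*} [AddCommMonoid V] [AddCommMonoid W] (f : T.Cell → E3 → V) (x : E3)
    (g : V → W) (h0 : g 0 = 0) : g (glue f x) = glue (fun K y => g (f K y)) x := by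
  by_cases hx : ∃ K : T.Cell, x ∈ interior K.hull
  · obtain ⟨K, hK⟩ := hx
    rw [glue_eq_of_mem _ hK, glue_eq_of_mem _ hK]
  · push Not at hx
    rw [glue_eq_zero _ hx, glue_eq_zero _ hx, h0]

lemma inner_glue (u : T.VField) (w : E3 → E3) (x : E3) :
    inner ℝ (glue u x) (w x) = glue (fun K y => inner ℝ (u K y) (w y)) x := by
  by_cases hx : ∃ K : T.Cell, x ∈ interior K.hull
  · obtain ⟨K, hK⟩ := hx
    rw [glue_eq_of_mem _ hK, glue_eq_of_mem _ hK]
  · push Not at hx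
    rw [glue_eq_zero _ hx, glue_eq_zero _ hx, inner_zero_left]

lemma glue_mul (f : T.SField) (w : E3 → ℝ) (x : E3) :
    glue f x * w x = glue (fun K y => f K y * w y) x := by
  by_cases hx : ∃ K : T.Cell, x ∈ interior K.hull
  · obtain ⟨K, hK⟩ := hx
    rw [glue_eq_of_mem _ hK, glue_eq_of_mem _ hK]
  · push Not at hx
    rw [glue_eq_zero _ hx, glue_eq_zero _ hx, zero_mul]

lemma glue_inner_glue (u v : T.VField) (x : E3) :
    inner ℝ (glue u x) (glue v x) = glue (fun K y => inner ℝ (u K y) (v K y)) x := by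
  by_cases hx : ∃ K : T.Cell, x ∈ interior K.hull
  · obtain ⟨K, hK⟩ := hx
    rw [glue_eq_of_mem _ hK, glue_eq_of_mem _ hK, glue_eq_of_mem _ hK]
  · push Not at hx
    rw [glue_eq_zero _ hx, glue_eq_zero _ hx, glue_eq_zero _ hx, inner_zero_left]

lemma glue_add {V : Type*} [AddCommMonoid V] (f g : T.Cell → E3 → V) (x : E3) :
    glue (f + g) x = glue f x + glue g x := by
  simp only [glue, ← Finset.sum_add_distrib, Pi.add_apply, Set.indicator_add', Pi.add_apply]

lemma glue_smul {V : Type*} [AddCommGroup V] [Module ℝ V] (c : ℝ) (f : T.Cell → E3 → V) (x : E3) :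
    glue (c • f) x = c • glue f x := by
  simp only [glue, Finset.smul_sum]
  refine Finset.sum_congr rfl fun K _ => ?_
  exact Set.indicator_const_smul_apply _ c (f K) x

lemma Cont.integrableOn {V : Type*} [NormedAddCommGroup V] {f : T.Cell → E3 → V}
    (hf : Cont f) (K : T.Cell) : IntegrableOn (f K) K.hull :=
  (hf K).continuousOn.integrableOn_compact K.isCompact_hull

lemma integral_domain_glue {V : Type*} [NormedAddCommGroup V] [NormedSpace ℝ V]
    {f : T.Cell → E3 → V} (hf : Cont f) :
    ∫ x in T.domain, glue f x = ∑ K : T.Cell, ∫ x in K.hull, f K x := by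
  unfold glue
  rw [integral_finsetSum]
  · refine Finset.sum_congr rfl fun K _ => ?_
    rw [setIntegral_indicator isOpen_interior.measurableSet,
      Set.inter_eq_right.2 K.interior_subset_domain, setIntegral_congr_set K.interior_ae_eq]
  · intro K _
    refine Integrable.integrableOn ?_
    exact (integrable_indicator_iff isOpen_interior.measurableSet).2
      ((hf.integrableOn K).mono_set interior_subset)

lemma integral_eq {f : T.SField} (hf : Cont f) : integral f = ∑ K : T.Cell, ∫ x in K.hull, f K x :=
  integral_domain_glue hf

lemma integral_add {f g : T.SField} (hf : Cont f) (hg : Cont g) :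
    integral (fun K x => f K x + g K x) = integral f + integral g := by
  rw [integral_eq hf, integral_eq hg, integral_eq (f := fun K x => f K x + g K x) (fun K => (hf K).add (hg K)),
    ← Finset.sum_add_distrib]
  exact Finset.sum_congr rfl fun K _ =>
    MeasureTheory.integral_add (hf.integrableOn K) (hg.integrableOn K)

lemma integral_const_mul (c : ℝ) (f : T.SField) :
    integral (fun K x => c * f K x) = c * integral f := by
  rw [integral, integral, ← MeasureTheory.integral_const_mul]
  congr 1
  ext x
  exact glue_smul c f x

lemma integral_nonneg_eq_zero {f : T.SField} (hf : Cont f) (h0 : ∀ K x, 0 ≤ f K x)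
    (h : integral f = 0) (K : T.Cell) : ∀ x ∈ interior K.hull, f K x = 0 := by
  rw [integral_eq hf, Finset.sum_eq_zero_iff_of_nonneg
    (fun K _ => setIntegral_nonneg K.isCompact_hull.measurableSet fun x _ => h0 K x)] at h
  have h1 := h K (Finset.mem_univ K)
  rw [setIntegral_eq_zero_iff_of_nonneg_ae (Filter.Eventually.of_forall (h0 K))
    (hf.integrableOn K)] at h1
  have h2 : f K =ᵐ[volume.restrict (interior K.hull)] 0 :=
    ae_restrict_of_ae_restrict_of_subset interior_subset h1
  exact Measure.eqOn_open_of_ae_eq h2 isOpen_interior (hf K).continuousOn continuousOn_const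

section

variable {V : Type*} [NormedAddCommGroup V]

lemma Cont.exists_bound_glue {f : T.Cell → E3 → V} (hf : Cont f) :
    ∃ C, ∀ x, ‖glue f x‖ ≤ C := by
  have h : ∀ K : T.Cell, ∃ C, ∀ x ∈ K.hull, ‖f K x‖ ≤ C := fun K =>
    K.isCompact_hull.exists_bound_of_continuousOn (hf K).continuousOn
  choose C hC using h
  refine ⟨∑ K, max (C K) 0, fun x => (norm_sum_le _ _).trans (Finset.sum_le_sum fun K _ => ?_)⟩
  by_cases hx : x ∈ interior K.hull
  · rw [Set.indicator_of_mem hx]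
    exact (hC K x (interior_subset hx)).trans (le_max_left _ _)
  · rw [Set.indicator_of_notMem hx, norm_zero]
    exact le_max_right _ _

lemma Cont.aestronglyMeasurable_glue [SecondCountableTopologyEither E3 V]
    {f : T.Cell → E3 → V} (hf : Cont f) (μ : Measure E3) :
    AEStronglyMeasurable (glue f) μ := by
  have : glue f = ∑ K, (interior K.hull).indicator (f K) := by
    ext x; simp [glue]
  rw [this]
  exact Finset.aestronglyMeasurable_sum _ fun K _ =>
    ((hf K).aestronglyMeasurable).indicator isOpen_interior.measurableSet

instance : IsFiniteMeasure (volume.restrict T.domain) :=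
  ⟨by
    rw [Measure.restrict_apply_univ]
    exact (measure_mono T.domain_subset_space).trans_lt T.isCompact_space.measure_lt_top⟩

lemma Cont.memLp_glue [SecondCountableTopologyEither E3 V]
    {f : T.Cell → E3 → V} (hf : Cont f) (p : ENNReal) :
    MemLp (glue f) p (volume.restrict T.domain) := by
  obtain ⟨C, hC⟩ := hf.exists_bound_glue
  exact MemLp.of_bound (hf.aestronglyMeasurable_glue _) C (Filter.Eventually.of_forall hC)

end

/-! ### Bilinearity of the inner products -/

section ip

variable {f g f' : T.SField} {u v u' : T.VField}

lemma ip_comm (f g : T.SField) : ip f g = ip g f := by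
  simp only [ip, mul_comm]

lemma ipV_comm (u v : T.VField) : ipV u v = ipV v u := by
  simp only [ipV, real_inner_comm]

lemma ip_add_left (hf : Cont f) (hf' : Cont f') (hg : Cont g) :
    ip (f + f') g = ip f g + ip f' g := by
  rw [ip, ip, ip, ← integral_add (f := fun K x => f K x * g K x) (g := fun K x => f' K x * g K x)
    (fun K => (hf K).mul (hg K)) (fun K => (hf' K).mul (hg K))]
  simp only [Pi.add_apply, add_mul]

lemma ip_smul_left (c : ℝ) : ip (c • f) g = c * ip f g := by
  rw [ip, ip, ← integral_const_mul]
  simp only [Pi.smul_apply, smul_eq_mul, mul_assoc]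

lemma ipV_add_left (hu : Cont u) (hu' : Cont u') (hv : Cont v) :
    ipV (u + u') v = ipV u v + ipV u' v := by
  rw [ipV, ipV, ipV, ← integral_add (fun K => (hu K).inner (hv K)) (fun K => (hu' K).inner (hv K))]
  simp only [Pi.add_apply, inner_add_left]

lemma ipV_smul_left (c : ℝ) : ipV (c • u) v = c * ipV u v := by
  rw [ipV, ipV, ← integral_const_mul]
  simp only [Pi.smul_apply, inner_smul_left, conj_trivial]

lemma ipV_add_right (hu : Cont u) (hv : Cont v) (hv' : Cont u') :
    ipV u (v + u') = ipV u v + ipV u u' := by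
  rw [ipV_comm, ipV_add_left hv hv' hu, ipV_comm v, ipV_comm u']

lemma ipV_smul_right (c : ℝ) : ipV u (c • v) = c * ipV u v := by
  rw [ipV_comm, ipV_smul_left, ipV_comm]

lemma ip_add_right (hf : Cont f) (hg : Cont g) (hf' : Cont f') :
    ip f (g + f') = ip f g + ip f f' := by
  rw [ip_comm, ip_add_left hg hf' hf, ip_comm g, ip_comm f']

lemma ip_smul_right (c : ℝ) : ip f (c • g) = c * ip f g := by
  rw [ip_comm, ip_smul_left, ip_comm]

lemma ipV_neg_left : ipV (-u) v = - ipV u v := by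
  rw [← neg_one_smul ℝ, ipV_smul_left, neg_one_mul]

lemma ipV_sub_left (hu : Cont u) (hu' : Cont u') (hv : Cont v) :
    ipV (u - u') v = ipV u v - ipV u' v := by
  rw [sub_eq_add_neg, ipV_add_left hu hu'.neg hv, ipV_neg_left, sub_eq_add_neg]

lemma ip_zero_left : ip (0 : T.SField) g = 0 := by
  rw [← zero_smul ℝ (0 : T.SField), ip_smul_left, zero_mul]

lemma ipV_zero_left : ipV (0 : T.VField) v = 0 := by
  rw [← zero_smul ℝ (0 : T.VField), ipV_smul_left, zero_mul]

end ip

end Triangulation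

/-! ### Integration by parts with compactly supported fields -/

lemma hasCompactSupport_coord {F : E3 → E3} (hF : HasCompactSupport F) (i : Fin 3) :
    HasCompactSupport (fun x => F x i) :=
  hF.comp_left (g := fun v : E3 => v i) rfl

lemma integral_dpart_eq_zero {f : E3 → ℝ} (hf : ContDiff ℝ 1 f) (hc : HasCompactSupport f)
    (i : Fin 3) : ∫ x, dpart i f x = 0 := by
  have hd : Continuous (dpart i f) := (contDiff_dpart (m := 0) i hf (by simp)).continuous
  have hcd : HasCompactSupport (dpart i f) := hc.fderiv_apply (𝕜 := ℝ) _
  have hi : Integrable (fun x => fderiv ℝ f x (EuclideanSpace.single i 1)) :=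
    hd.integrable_of_hasCompactSupport hcd
  have h := integral_mul_fderiv_eq_neg_fderiv_mul_of_integrable (𝕜 := ℝ) (μ := (volume : Measure E3))
    (f := fun _ => (1 : ℝ)) (g := f) (v := EuclideanSpace.single i 1) (by simp)
    (by simpa only [one_mul] using hi)
    (by simpa only [one_mul] using hf.continuous.integrable_of_hasCompactSupport hc)
    (fun x _ => differentiableAt_const _) (fun x _ => hf.differentiable (by simp) x)
  simpa [dpart] using h

lemma integral_div3_eq_zero {F : E3 → E3} (hF : ContDiff ℝ 1 F) (hc : HasCompactSupport F) :
    ∫ x, div3 F x = 0 := by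
  have hFi (i : Fin 3) : ContDiff ℝ 1 (fun x => F x i) := contDiff_euclidean.1 hF i
  have hi (i : Fin 3) : Integrable (dpart i fun x => F x i) :=
    (contDiff_dpart (m := 0) i (hFi i) (by simp)).continuous.integrable_of_hasCompactSupport
      ((hasCompactSupport_coord hc i).fderiv_apply (𝕜 := ℝ) _)
  simp only [div3_eq (hF.differentiable (by simp) _)]
  have h2 := integral_add ((hi 0).add (hi 1)) (hi 2)
  simp only [Pi.add_apply] at h2
  rw [h2, integral_add (hi 0) (hi 1)]
  simp only [integral_dpart_eq_zero (hFi _) (hasCompactSupport_coord hc _)]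
  simp

lemma div3_eq_zero_of_notMem_tsupport {F : E3 → E3} {x : E3} (hx : x ∉ tsupport F) :
    div3 F x = 0 := by
  have h : fderiv ℝ F x = 0 := by
    by_contra hne
    exact hx (support_fderiv_subset ℝ hne)
  simp [div3, pderiv, h]

lemma curl3_eq_zero_of_notMem_tsupport {F : E3 → E3} {x : E3} (hx : x ∉ tsupport F) :
    curl3 F x = 0 := by
  have h : fderiv ℝ F x = 0 := by
    by_contra hne
    exact hx (support_fderiv_subset ℝ hne)
  apply E3.ext <;> simp [curl3, pderiv, h]

lemma gradient_eq_zero_of_notMem_tsupport {f : E3 → ℝ} {x : E3} (hx : x ∉ tsupport f) :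
    gradient f x = 0 := by
  have h : fderiv ℝ f x = 0 := by
    by_contra hne
    exact hx (support_fderiv_subset ℝ hne)
  simp [gradient, h]

lemma setIntegral_div3_eq_zero {F : E3 → E3} (hF : ContDiff ℝ 1 F) (hc : HasCompactSupport F)
    {S : Set E3} (hS : tsupport F ⊆ S) : ∫ x in S, div3 F x = 0 := by
  rw [setIntegral_eq_integral_of_forall_compl_eq_zero, integral_div3_eq_zero hF hc]
  exact fun x hx => div3_eq_zero_of_notMem_tsupport fun h => hx (hS h)

lemma hasCompactSupport_gradient {f : E3 → ℝ} (hc : HasCompactSupport f) :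
    HasCompactSupport (gradient f) :=
  (hc.fderiv ℝ).comp_left (g := (InnerProductSpace.toDual ℝ E3).symm) (by simp)

lemma continuous_curl3 {u : E3 → E3} (hu : ContDiff ℝ 1 u) : Continuous (curl3 u) := by
  have hd (i j : Fin 3) : Continuous (pderiv i j u) :=
    ((EuclideanSpace.proj j : E3 →L[ℝ] ℝ).continuous).comp
      ((hu.continuous_fderiv (by simp)).clm_apply continuous_const)
  unfold curl3
  refine (PiLp.continuous_toLp 2 _).comp (continuous_pi fun i => ?_)
  fin_cases i
  · exact (hd 1 2).sub (hd 2 1)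
  · exact (hd 2 0).sub (hd 0 2)
  · exact (hd 0 1).sub (hd 1 0)

lemma continuous_div3 {u : E3 → E3} (hu : ContDiff ℝ 1 u) : Continuous (div3 u) := by
  unfold div3
  exact continuous_finsetSum _ fun i _ => ((EuclideanSpace.proj i : E3 →L[ℝ] ℝ).continuous).comp
      ((hu.continuous_fderiv (by simp)).clm_apply continuous_const)

lemma continuous_gradient {f : E3 → ℝ} (hf : ContDiff ℝ 1 f) : Continuous (gradient f) :=
  (InnerProductSpace.toDual ℝ E3).symm.continuous.comp (hf.continuous_fderiv (by simp))

lemma ContDiff.cross3 {n : WithTop ℕ∞} {u v : E3 → E3} (hu : ContDiff ℝ n u)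
    (hv : ContDiff ℝ n v) : ContDiff ℝ n (fun x => cross (u x) (v x)) := by
  have h (a b : Fin 3) := (contDiff_euclidean.1 hu a).mul (contDiff_euclidean.1 hv b)
  rw [contDiff_euclidean]
  intro i
  fin_cases i
  · simpa only [Fin.zero_eta, cross_zero_apply] using (h 1 2).sub (h 2 1)
  · simpa only [Fin.mk_one, cross_one_apply] using (h 2 0).sub (h 0 2)
  · simpa only [Fin.reduceFinMk, cross_two_apply] using (h 0 1).sub (h 1 0)

namespace Triangulation

variable {T : Triangulation}

/-! ### Weak derivatives of piecewise smooth fields -/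

variable (T) in
lemma ae_mem_interior : ∀ᵐ x ∂volume.restrict T.domain, ∃ K : T.Cell, x ∈ interior K.hull := by
  have h0 : volume (⋃ K : T.Cell, frontier K.hull) = 0 :=
    measure_iUnion_null fun K => K.convex_hull.addHaar_frontier volume
  rw [ae_restrict_iff' T.isOpen_domain.measurableSet]
  filter_upwards [measure_eq_zero_iff_ae_notMem.1 h0] with x hx hxd
  have hxs := T.domain_subset_space hxd
  rw [space_eq_iUnion, Set.mem_iUnion] at hxs
  obtain ⟨K, hK⟩ := hxs
  refine ⟨K, ?_⟩
  by_contra h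
  exact hx (Set.mem_iUnion.2 ⟨K, subset_closure hK, h⟩)

/-- Restriction of an integral over the domain to a cell. -/
lemma setIntegral_domain_eq_cell {f : E3 → ℝ} (K : T.Cell) (hf : ∀ x, x ∉ interior K.hull → f x = 0) :
    ∫ x in T.domain, f x = ∫ x in interior K.hull, f x :=
  (setIntegral_eq_of_subset_of_forall_sdiff_eq_zero T.isOpen_domain.measurableSet
    K.interior_subset_domain fun x hx => hf x hx.2)

/-- The fundamental lemma of the calculus of variations applies in each open cell, and the
boundaries of the cells are null sets. It serves to identify weak derivatives with elementwise ones.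
-/
lemma ae_eq_glue_of_forall_cell {f : E3 → ℝ} (g : T.SField) (hg : Cont g)
    (hf : LocallyIntegrableOn f T.domain)
    (h : ∀ K : T.Cell, ∀ φ : E3 → ℝ, ContDiff ℝ ∞ φ → HasCompactSupport φ →
      tsupport φ ⊆ interior K.hull → ∫ x in interior K.hull, φ x * (f x - g K x) = 0) :
    f =ᵐ[volume.restrict T.domain] glue g := by
  have key : ∀ᵐ x, ∀ K : T.Cell, x ∈ interior K.hull → f x - g K x = 0 := by
    rw [ae_all_iff]
    intro K
    refine isOpen_interior.ae_eq_zero_of_integral_contDiff_smul_eq_zero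
      (f := fun x => f x - g K x) ?_ fun φ h1 h2 h3 => ?_
    · exact (hf.mono_set K.interior_subset_domain).sub
        ((hg K).locallyIntegrable.locallyIntegrableOn _)
    · rw [← h K φ h1 h2 h3]
      refine (setIntegral_eq_integral_of_forall_compl_eq_zero fun x hx => ?_).symm
      rw [image_eq_zero_of_notMem_tsupport fun h' => hx (h3 h'), zero_smul]
  filter_upwards [ae_restrict_of_ae key, T.ae_mem_interior] with x hx ⟨K, hK⟩
  rw [glue_eq_of_mem _ hK]
  exact sub_eq_zero.1 (hx K hK)

lemma locallyIntegrableOn_domain {V : Type*} [NormedAddCommGroup V] {f : E3 → V}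
    (hf : MemLp f 2 (volume.restrict T.domain)) : LocallyIntegrableOn f T.domain :=
  IntegrableOn.locallyIntegrableOn (hf.integrable (by norm_num))

lemma integrableOn_cell {V : Type*} [NormedAddCommGroup V] {f : E3 → V} (hf : Continuous f)
    (K : T.Cell) : IntegrableOn f (interior K.hull) :=
  (hf.continuousOn.integrableOn_compact K.isCompact_hull).mono_set interior_subset

/-- A test function supported inside one cell sees only the piece there, and `div (φ u)` integrates
to zero. -/
lemma weakDiv_ae_eq {u : T.VField} (hu : ∀ K, ContDiff ℝ 1 (u K)) {g : E3 → ℝ}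
    (h : HasDivZeroTrace T.domain (glue u) g) :
    g =ᵐ[volume.restrict T.domain] glue (divF u) := by
  obtain ⟨-, hg, h⟩ := h
  refine ae_eq_glue_of_forall_cell _ (fun K => continuous_div3 (hu K))
    (locallyIntegrableOn_domain hg) fun K φ h1 h2 h3 => ?_
  have h1' : ContDiff ℝ 1 φ := h1.of_le (by norm_cast)
  have hgi : IntegrableOn g (interior K.hull) :=
    (show IntegrableOn g T.domain volume from hg.integrable (by norm_num)).mono_set
      K.interior_subset_domain
  have hz : ∀ x, x ∉ interior K.hull → φ x = 0 :=
    fun x hx => image_eq_zero_of_notMem_tsupport fun h' => hx (h3 h')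
  have e1 := h φ h1 h2
  rw [setIntegral_domain_eq_cell K fun x hx => by
      rw [gradient_eq_zero_of_notMem_tsupport fun h' => hx (h3 h'), inner_zero_right],
    setIntegral_domain_eq_cell K fun x hx => by rw [hz x hx, mul_zero],
    setIntegral_congr_fun isOpen_interior.measurableSet
      (g := fun x => inner ℝ (u K x) (gradient φ x))
      fun x hx => by simp only [glue_eq_of_mem _ hx]] at e1
  have hF : ContDiff ℝ 1 (fun x => φ x • u K x) := h1'.smul (hu K)
  have e2 := setIntegral_div3_eq_zero hF (h2.smul_right) (S := interior K.hull)
    ((tsupport_smul_subset_left _ _).trans h3)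
  simp only [div3_smul (h1'.differentiable (by simp) _) ((hu K).differentiable (by simp) _)] at e2
  have i1 : IntegrableOn (fun x => inner ℝ (u K x) (gradient φ x)) (interior K.hull) :=
    integrableOn_cell ((hu K).continuous.inner (continuous_gradient h1')) K
  have i2 : IntegrableOn (fun x => φ x * div3 (u K) x) (interior K.hull) :=
    integrableOn_cell (h1.continuous.mul (continuous_div3 (hu K))) K
  rw [MeasureTheory.integral_add i1 i2] at e2
  obtain ⟨C, hC⟩ := h1.continuous.bounded_above_of_compact_support h2
  have i3 : IntegrableOn (fun x => φ x * g x) (interior K.hull) :=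
    hgi.bdd_mul h1.continuous.aestronglyMeasurable (Filter.Eventually.of_forall hC)
  simp only [mul_sub, divF]
  rw [integral_sub i3 i2]
  simp only [mul_comm (g _)] at e1
  linarith

lemma weakCurl_ae_eq {u : T.VField} (hu : ∀ K, ContDiff ℝ 1 (u K)) {g : E3 → E3}
    (h : HasCurlZeroTrace T.domain (glue u) g) :
    g =ᵐ[volume.restrict T.domain] glue (curlF u) := by
  obtain ⟨-, hg, h⟩ := h
  have hcomp : ∀ i : Fin 3, (fun x => g x i) =ᵐ[volume.restrict T.domain]
      glue (fun K x => curlF u K x i) := by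
    intro i
    have hgi' : MemLp (fun x => g x i) 2 (volume.restrict T.domain) := hg.eval_piLp i
    refine ae_eq_glue_of_forall_cell _ (fun K => (EuclideanSpace.proj i : E3 →L[ℝ] ℝ).continuous.comp
      (continuous_curl3 (hu K))) (locallyIntegrableOn_domain hgi') fun K φ h1 h2 h3 => ?_
    have h1' : ContDiff ℝ 1 φ := h1.of_le (by norm_cast)
    have hgi : IntegrableOn (fun x => g x i) (interior K.hull) :=
      (show IntegrableOn (fun x => g x i) T.domain volume from hgi'.integrable (by norm_num)).mono_set
        K.interior_subset_domain
    -- The `i`-th component of the curl is isolated by the test field `φ eᵢ`; integration by parts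
    -- is the vanishing integral of `div (u × Φ)`.
    set Φ : E3 → E3 := fun x => φ x • EuclideanSpace.single i (1 : ℝ) with hΦ
    have hΦs : ContDiff ℝ ∞ Φ := h1.smul contDiff_const
    have hΦ1 : ContDiff ℝ 1 Φ := h1'.smul contDiff_const
    have hΦc : HasCompactSupport Φ := h2.smul_right
    have hΦt : tsupport Φ ⊆ interior K.hull := (tsupport_smul_subset_left _ _).trans h3
    have hin : ∀ v x, inner ℝ v (Φ x) = φ x * v i := by
      intro v x
      rw [hΦ, inner_smul_right, EuclideanSpace.inner_single_right]
      simp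
    have hz : ∀ x, x ∉ interior K.hull → Φ x = 0 :=
      fun x hx => image_eq_zero_of_notMem_tsupport fun h' => hx (hΦt h')
    have e1 := h Φ hΦs hΦc
    rw [setIntegral_domain_eq_cell K fun x hx => by
        rw [curl3_eq_zero_of_notMem_tsupport fun h' => hx (hΦt h'), inner_zero_right],
      setIntegral_domain_eq_cell K fun x hx => by rw [hz x hx, inner_zero_right],
      setIntegral_congr_fun isOpen_interior.measurableSet
        (g := fun x => inner ℝ (u K x) (curl3 Φ x))
        fun x hx => by simp only [glue_eq_of_mem _ hx]] at e1
    have hct : tsupport (fun x => cross (u K x) (Φ x)) ⊆ tsupport Φ := by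
      refine closure_mono fun x hx h0 => hx ?_
      simp only [h0]
      apply E3.ext <;> simp [cross_zero_apply, cross_one_apply, cross_two_apply]
    have e2 := setIntegral_div3_eq_zero ((hu K).cross3 hΦ1)
      (hΦc.mono' (subset_closure.trans hct)) (S := interior K.hull) (hct.trans hΦt)
    simp only [div3_cross ((hu K).differentiable (by simp) _) (hΦ1.differentiable (by simp) _)] at e2
    have i1 : IntegrableOn (fun x => inner ℝ (u K x) (curl3 Φ x)) (interior K.hull) :=
      integrableOn_cell ((hu K).continuous.inner (continuous_curl3 hΦ1)) K
    have i2 : IntegrableOn (fun x => inner ℝ (curl3 (u K) x) (Φ x)) (interior K.hull) :=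
      integrableOn_cell ((continuous_curl3 (hu K)).inner hΦ1.continuous) K
    rw [integral_sub i2 i1] at e2
    obtain ⟨C, hC⟩ := h1.continuous.bounded_above_of_compact_support h2
    have i3 : IntegrableOn (fun x => φ x * g x i) (interior K.hull) :=
      hgi.bdd_mul h1.continuous.aestronglyMeasurable (Filter.Eventually.of_forall hC)
    simp only [hin] at e1 e2 i2
    simp only [mul_sub, curlF]
    rw [integral_sub i3 i2]
    linarith
  filter_upwards [hcomp 0, hcomp 1, hcomp 2] with x h0 h1 h2
  have hgl (i : Fin 3) := glue_map (curlF u) x (fun v : E3 => v i) rfl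
  apply E3.ext
  · rw [h0, ← hgl 0]
  · rw [h1, ← hgl 1]
  · rw [h2, ← hgl 2]

/-! ### The conforming spaces as submodules -/

lemma cont_of_contDiff {V : Type*} [NormedAddCommGroup V] [NormedSpace ℝ V] {f : T.Cell → E3 → V}
    (hf : ∀ K, ContDiff ℝ 1 (f K)) : Cont f := fun K => (hf K).continuous

/-- The unknown weak divergence is replaced by the elementwise one. What remains is a family of
linear conditions on `u`, which is the form used to see that Raviart-Thomas fields form a subspace.
-/
lemma hasDivZeroTrace_glue_iff {u : T.VField} (hu : ∀ K, ContDiff ℝ 1 (u K)) :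
    (∃ g, HasDivZeroTrace T.domain (glue u) g) ↔
      ∀ φ : E3 → ℝ, ContDiff ℝ ∞ φ → HasCompactSupport φ →
        integral (fun K x => inner ℝ (u K x) (gradient φ x) + divF u K x * φ x) = 0 := by
  have key : ∀ φ : E3 → ℝ, ContDiff ℝ ∞ φ →
      integral (fun K x => inner ℝ (u K x) (gradient φ x) + divF u K x * φ x) =
      (∫ x in T.domain, inner ℝ (glue u x) (gradient φ x)) + ∫ x in T.domain, glue (divF u) x * φ x := by
    intro φ hφ
    rw [integral_add (f := fun K x => inner ℝ (u K x) (gradient φ x))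
      (g := fun K x => divF u K x * φ x)
      (fun K => (hu K).continuous.inner (contDiff_gradient hφ).continuous)
      (fun K => (continuous_div3 (hu K)).mul hφ.continuous)]
    simp only [inner_glue, glue_mul]
    rfl
  constructor
  · rintro ⟨g, hg⟩ φ h1 h2
    rw [key φ h1, hg.2.2 φ h1 h2]
    have : ∫ x in T.domain, g x * φ x = ∫ x in T.domain, glue (divF u) x * φ x := by
      refine integral_congr_ae ?_
      filter_upwards [weakDiv_ae_eq hu hg] with x hx
      rw [hx]
    rw [this]
    ring
  · intro h
    refine ⟨glue (divF u), (cont_of_contDiff hu).memLp_glue 2,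
      Cont.memLp_glue (fun K => continuous_div3 (hu K)) 2, fun φ h1 h2 => ?_⟩
    have := h φ h1 h2
    rw [key φ h1] at this
    linarith

lemma hasCurlZeroTrace_glue_iff {u : T.VField} (hu : ∀ K, ContDiff ℝ 1 (u K)) :
    (∃ g, HasCurlZeroTrace T.domain (glue u) g) ↔
      ∀ φ : E3 → E3, ContDiff ℝ ∞ φ → HasCompactSupport φ →
        integral (fun K x => inner ℝ (u K x) (curl3 φ x) + (-1) * inner ℝ (curlF u K x) (φ x)) = 0 := by
  have key : ∀ φ : E3 → E3, ContDiff ℝ ∞ φ →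
      integral (fun K x => inner ℝ (u K x) (curl3 φ x) + (-1) * inner ℝ (curlF u K x) (φ x)) =
      (∫ x in T.domain, inner ℝ (glue u x) (curl3 φ x)) -
        ∫ x in T.domain, inner ℝ (glue (curlF u) x) (φ x) := by
    intro φ hφ
    have hφ1 : ContDiff ℝ 1 φ := hφ.of_le (by norm_cast)
    rw [integral_add (f := fun K x => inner ℝ (u K x) (curl3 φ x))
      (g := fun K x => (-1) * inner ℝ (curlF u K x) (φ x))
      (fun K => (hu K).continuous.inner (continuous_curl3 hφ1))
      (fun K => continuous_const.mul ((continuous_curl3 (hu K)).inner hφ.continuous)),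
      integral_const_mul]
    simp only [inner_glue, neg_one_mul, sub_eq_add_neg]
    rfl
  constructor
  · rintro ⟨g, hg⟩ φ h1 h2
    rw [key φ h1, hg.2.2 φ h1 h2]
    have : ∫ x in T.domain, inner ℝ (g x) (φ x) = ∫ x in T.domain, inner ℝ (glue (curlF u) x) (φ x) := by
      refine integral_congr_ae ?_
      filter_upwards [weakCurl_ae_eq hu hg] with x hx
      rw [hx]
    rw [this, sub_self]
  · intro h
    refine ⟨glue (curlF u), (cont_of_contDiff hu).memLp_glue 2,
      Cont.memLp_glue (fun K => continuous_curl3 (hu K)) 2, fun φ h1 h2 => ?_⟩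
    have := h φ h1 h2
    rw [key φ h1] at this
    linarith

end Triangulation

/-! ### Finite-dimensionality and representation of functionals -/

/-- The space of polynomial vector fields of degree at most `s`. -/
def polyVecSub (s : ℕ) : Submodule ℝ (E3 → E3) where
  carrier := {u | IsPolyVec s u}
  add_mem' hu hv := IsPolyVec.add hu hv
  zero_mem' := fun _ => IsPolyFun.const s 0
  smul_mem' c _ hu := IsPolyVec.const_smul hu c

instance (s : ℕ) : FiniteDimensional ℝ (polyVecSub s) := by
  let L : polyVecSub s →ₗ[ℝ] (Fin 3 → polySub s) :=
    { toFun := fun u i => ⟨fun x => u.1 x i, u.2 i⟩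
      map_add' := fun u v => rfl
      map_smul' := fun c u => rfl }
  refine FiniteDimensional.of_injective L fun u v h => ?_
  ext x i
  exact congrFun (congrArg Subtype.val (congrFun h i)) x

namespace IsPolyVec

lemma eq_zero_of_isOpen {s : ℕ} {u : E3 → E3} (hu : IsPolyVec s u) {U : Set E3} (hU : IsOpen U)
    (hne : U.Nonempty) (h : ∀ x ∈ U, u x = 0) : u = 0 := by
  ext x i
  exact congrFun ((hu i).eq_zero_of_isOpen hU hne fun y hy => by rw [h y hy]; rfl) x

end IsPolyVec

/-- Representation of linear functionals by a definite bilinear form on a finite-dimensional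
space. -/
lemma exists_eq_of_definite {V : Type*} [AddCommGroup V] [Module ℝ V] [FiniteDimensional ℝ V]
    (β : V →ₗ[ℝ] V →ₗ[ℝ] ℝ) (hβ : ∀ v, β v v = 0 → v = 0) (ℓ : V →ₗ[ℝ] ℝ) : ∃ v, β v = ℓ := by
  have hinj : Function.Injective β := by
    rw [← LinearMap.ker_eq_bot, LinearMap.ker_eq_bot']
    exact fun v hv => hβ v (by rw [hv]; rfl)
  exact (LinearMap.injective_iff_surjective_of_finrank_eq_finrank
    (Subspace.dual_finrank_eq (K := ℝ) (V := V)).symm).1 hinj ℓ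

namespace Triangulation

variable {T : Triangulation}

/-! ### The finite element spaces as submodules -/

variable (T) in
/-- The space `DG_s` as a submodule. -/
def dgSub (s : ℕ) : Submodule ℝ T.SField := Submodule.pi Set.univ fun _ => polySub s

lemma mem_dgSub {s : ℕ} {f : T.SField} : f ∈ T.dgSub s ↔ f ∈ T.DG s := by
  simp [dgSub, Submodule.mem_pi, DG]
  rfl

variable (T) in
/-- The space of piecewise polynomial vector fields of degree at most `s`. -/
def pvSub (s : ℕ) : Submodule ℝ T.VField := Submodule.pi Set.univ fun _ => polyVecSub s

lemma mem_pvSub {s : ℕ} {u : T.VField} : u ∈ T.pvSub s ↔ ∀ K, IsPolyVec s (u K) := by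
  simp [pvSub, Submodule.mem_pi]
  rfl

instance (s : ℕ) : FiniteDimensional ℝ (T.dgSub s) := by
  let L : T.dgSub s →ₗ[ℝ] (T.Cell → polySub s) :=
    { toFun := fun f K => ⟨f.1 K, mem_dgSub.1 f.2 K⟩
      map_add' := fun u v => rfl
      map_smul' := fun c u => rfl }
  refine FiniteDimensional.of_injective L fun u v h => ?_
  ext K : 2
  exact congrArg Subtype.val (congrFun h K)

instance (s : ℕ) : FiniteDimensional ℝ (T.pvSub s) := by
  let L : T.pvSub s →ₗ[ℝ] (T.Cell → polyVecSub s) :=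
    { toFun := fun f K => ⟨f.1 K, mem_pvSub.1 f.2 K⟩
      map_add' := fun u v => rfl
      map_smul' := fun c u => rfl }
  refine FiniteDimensional.of_injective L fun u v h => ?_
  ext K : 2
  exact congrArg Subtype.val (congrFun h K)

lemma DG.cont {s : ℕ} {f : T.SField} (hf : f ∈ T.DG s) : Cont f := fun K => (hf K).continuous

lemma cont_of_mem_pvSub {s : ℕ} {u : T.VField} (hu : u ∈ T.pvSub s) : Cont u :=
  fun K => (mem_pvSub.1 hu K).continuous

lemma mem_RT_iff {s : ℕ} {u : T.VField} : u ∈ T.RT s ↔ (∀ K, IsLocalRT s (u K)) ∧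
    ∀ φ : E3 → ℝ, ContDiff ℝ ∞ φ → HasCompactSupport φ →
      integral (fun K x => inner ℝ (u K x) (gradient φ x) + divF u K x * φ x) = 0 :=
  and_congr_right fun h => hasDivZeroTrace_glue_iff fun K => IsPolyVec.contDiff
    (IsLocalRT.isPolyVec (h K))

lemma mem_NED_iff {s : ℕ} {u : T.VField} : u ∈ T.NED s ↔ (∀ K, IsLocalNED s (u K)) ∧
    ∀ φ : E3 → E3, ContDiff ℝ ∞ φ → HasCompactSupport φ →
      integral (fun K x => inner ℝ (u K x) (curl3 φ x) + (-1) * inner ℝ (curlF u K x) (φ x)) = 0 :=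
  and_congr_right fun h => hasCurlZeroTrace_glue_iff fun K => IsPolyVec.contDiff
    (IsLocalNED.isPolyVec (h K))

section calculus

variable {u v : T.VField}

lemma divF_add (hu : ∀ K, Differentiable ℝ (u K)) (hv : ∀ K, Differentiable ℝ (v K)) :
    divF (u + v) = divF u + divF v := by
  ext K x
  exact div3_add (hu K x) (hv K x)

lemma divF_smul (c : ℝ) (hu : ∀ K, Differentiable ℝ (u K)) : divF (c • u) = c • divF u := by
  ext K x
  exact div3_const_smul c (hu K x)

lemma curlF_add (hu : ∀ K, Differentiable ℝ (u K)) (hv : ∀ K, Differentiable ℝ (v K)) :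
    curlF (u + v) = curlF u + curlF v := by
  ext K x : 2
  exact curl3_add (hu K x) (hv K x)

lemma curlF_smul (c : ℝ) (hu : ∀ K, Differentiable ℝ (u K)) : curlF (c • u) = c • curlF u := by
  ext K x : 2
  exact curl3_const_smul c (hu K x)

end calculus

variable (T) in
/-- The Raviart-Thomas space as a submodule. -/
def rtSub (s : ℕ) : Submodule ℝ T.VField where
  carrier := T.RT s
  zero_mem' := by
    rw [mem_RT_iff]
    refine ⟨fun K => IsLocalRT.zero s, fun φ _ _ => ?_⟩
    have : divF (0 : T.VField) = 0 := by
      ext K x; simp [divF, div3, pderiv]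
    simp [this, integral, glue]
  add_mem' := by
    intro u v hu hv
    rw [mem_RT_iff] at hu hv ⊢
    have du (K) := (hu.1 K).isPolyVec
    have dv (K) := (hv.1 K).isPolyVec
    refine ⟨fun K => (hu.1 K).add (hv.1 K), fun φ h1 h2 => ?_⟩
    have hc {w : T.VField} (dw : ∀ K, IsPolyVec (s + 1) (w K)) :
        Cont fun K x => inner ℝ (w K x) (gradient φ x) + divF w K x * φ x := fun K =>
      ((dw K).continuous.inner (contDiff_gradient h1).continuous).add
        ((dw K).div3.continuous.mul h1.continuous)
    have := integral_add (hc du) (hc dv)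
    rw [hu.2 φ h1 h2, hv.2 φ h1 h2, add_zero] at this
    rw [← this, divF_add (fun K => (du K).differentiable) (fun K => (dv K).differentiable)]
    congr 1
    ext K x
    simp only [Pi.add_apply, inner_add_left]
    ring
  smul_mem' := by
    intro c u hu
    rw [mem_RT_iff] at hu ⊢
    have du (K) := (hu.1 K).isPolyVec
    refine ⟨fun K => (hu.1 K).smul c, fun φ h1 h2 => ?_⟩
    have := integral_const_mul c (fun K x => inner ℝ (u K x) (gradient φ x) + divF u K x * φ x)
    rw [hu.2 φ h1 h2, mul_zero] at this
    rw [← this, divF_smul c (fun K => (du K).differentiable)]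
    congr 1
    ext K x
    simp only [Pi.smul_apply, inner_smul_left, smul_eq_mul, conj_trivial]
    ring

variable (T) in
/-- The Nedelec space as a submodule. -/
def nedSub (s : ℕ) : Submodule ℝ T.VField where
  carrier := T.NED s
  zero_mem' := by
    rw [mem_NED_iff]
    refine ⟨fun K => IsLocalNED.zero s, fun φ _ _ => ?_⟩
    have : curlF (0 : T.VField) = 0 := by
      ext K x : 2
      apply E3.ext <;> simp [curlF, curl3, pderiv]
    simp [this, integral, glue]
  add_mem' := by
    intro u v hu hv
    rw [mem_NED_iff] at hu hv ⊢
    have du (K) := (hu.1 K).isPolyVec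
    have dv (K) := (hv.1 K).isPolyVec
    refine ⟨fun K => (hu.1 K).add (hv.1 K), fun φ h1 h2 => ?_⟩
    have hc {w : T.VField} (dw : ∀ K, IsPolyVec (s + 1) (w K)) :
        Cont fun K x => inner ℝ (w K x) (curl3 φ x) + (-1) * inner ℝ (curlF w K x) (φ x) := fun K =>
      ((dw K).continuous.inner (continuous_curl3 (h1.of_le (by norm_cast)))).add
        (continuous_const.mul ((dw K).curl3.continuous.inner h1.continuous))
    have := integral_add (hc du) (hc dv)
    rw [hu.2 φ h1 h2, hv.2 φ h1 h2, add_zero] at this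
    rw [← this, curlF_add (fun K => (du K).differentiable) (fun K => (dv K).differentiable)]
    congr 1
    ext K x
    simp only [Pi.add_apply, inner_add_left]
    ring
  smul_mem' := by
    intro c u hu
    rw [mem_NED_iff] at hu ⊢
    have du (K) := (hu.1 K).isPolyVec
    refine ⟨fun K => (hu.1 K).smul c, fun φ h1 h2 => ?_⟩
    have := integral_const_mul c
      (fun K x => inner ℝ (u K x) (curl3 φ x) + (-1) * inner ℝ (curlF u K x) (φ x))
    rw [hu.2 φ h1 h2, mul_zero] at this
    rw [← this, curlF_smul c (fun K => (du K).differentiable)]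
    congr 1
    ext K x
    simp only [Pi.smul_apply, inner_smul_left, conj_trivial]
    ring

lemma rtSub_le (s : ℕ) : T.rtSub s ≤ T.pvSub (s + 1) :=
  fun _ hu => mem_pvSub.2 fun K => IsLocalRT.isPolyVec (hu.1 K)

lemma nedSub_le (s : ℕ) : T.nedSub s ≤ T.pvSub (s + 1) :=
  fun _ hu => mem_pvSub.2 fun K => IsLocalNED.isPolyVec (hu.1 K)

instance (s : ℕ) : FiniteDimensional ℝ (T.rtSub s) := Submodule.finiteDimensional_of_le (rtSub_le s)

instance (s : ℕ) : FiniteDimensional ℝ (T.nedSub s) :=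
  Submodule.finiteDimensional_of_le (nedSub_le s)

lemma RT.isPolyVec {s : ℕ} {u : T.VField} (hu : u ∈ T.RT s) (K : T.Cell) :
    IsPolyVec (s + 1) (u K) := IsLocalRT.isPolyVec (hu.1 K)

lemma NED.isPolyVec {s : ℕ} {u : T.VField} (hu : u ∈ T.NED s) (K : T.Cell) :
    IsPolyVec (s + 1) (u K) := IsLocalNED.isPolyVec (hu.1 K)

lemma RT.cont {s : ℕ} {u : T.VField} (hu : u ∈ T.RT s) : Cont u :=
  fun K => (RT.isPolyVec hu K).continuous

lemma NED.cont {s : ℕ} {u : T.VField} (hu : u ∈ T.NED s) : Cont u :=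
  fun K => (NED.isPolyVec hu K).continuous

lemma NED.hasCurlZeroTrace {s : ℕ} {u : T.VField} (hu : u ∈ T.NED s) :
    HasCurlZeroTrace T.domain (glue u) (glue (curlF u)) := by
  obtain ⟨g, hg⟩ := hu.2
  have h := weakCurl_ae_eq (fun K => (NED.isPolyVec hu K).contDiff) hg
  refine ⟨hg.1, (memLp_congr_ae h).1 hg.2.1, fun φ h1 h2 => ?_⟩
  rw [hg.2.2 φ h1 h2]
  refine integral_congr_ae ?_
  filter_upwards [h] with x hx
  rw [hx]

lemma RT.hasDivZeroTrace {s : ℕ} {u : T.VField} (hu : u ∈ T.RT s) :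
    HasDivZeroTrace T.domain (glue u) (glue (divF u)) := by
  obtain ⟨g, hg⟩ := hu.2
  have h := weakDiv_ae_eq (fun K => (RT.isPolyVec hu K).contDiff) hg
  refine ⟨hg.1, (memLp_congr_ae h).1 hg.2.1, fun φ h1 h2 => ?_⟩
  rw [hg.2.2 φ h1 h2]
  congr 1
  refine integral_congr_ae ?_
  filter_upwards [h] with x hx
  rw [hx]

/-- The curl maps the Nedelec space to the Raviart-Thomas space. -/
lemma curlF_mem_RT {s : ℕ} {z : T.VField} (hz : z ∈ T.NED s) : curlF z ∈ T.RT s := by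
  rw [mem_RT_iff]
  refine ⟨fun K => IsLocalNED.isLocalRT_curl3 (hz.1 K), fun φ h1 h2 => ?_⟩
  -- The test field `∇φ` is allowed although it need not vanish on the boundary; thus the zero
  -- tangential trace of `z` yields the zero normal trace of its curl.
  have h := (mem_NED_iff.1 hz).2 _ (contDiff_gradient h1) (hasCompactSupport_gradient h2)
  have hc := integral_const_mul (-1) (fun K x =>
    inner ℝ (z K x) (curl3 (gradient φ) x) + (-1) * inner ℝ (curlF z K x) (gradient φ x))
  rw [h, mul_zero] at hc
  rw [← hc]
  congr 1
  ext K x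
  have hd : divF (curlF z) K x = 0 := div3_curl3 (NED.isPolyVec hz K).contDiff
  rw [hd, curl3_gradient h1, inner_zero_right]
  ring

lemma divF_curlF {s : ℕ} {z : T.VField} (hz : z ∈ T.NED s) : divF (curlF z) = 0 := by
  ext K x
  exact div3_curl3 (NED.isPolyVec hz K).contDiff

/-! ### Definiteness -/

lemma eq_zero_of_ip_self {s : ℕ} {f : T.SField} (hf : f ∈ T.DG s) (h : ip f f = 0) : f = 0 := by
  ext K : 1
  refine (hf K).eq_zero_of_isOpen isOpen_interior K.interior_nonempty fun x hx => ?_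
  exact mul_self_eq_zero.1 (integral_nonneg_eq_zero (f := fun K x => f K x * f K x)
    (fun K => (hf K).continuous.mul (hf K).continuous) (fun K x => mul_self_nonneg _) h K x hx)

lemma eq_zero_of_ipV_self {s : ℕ} {u : T.VField} (hu : ∀ K, IsPolyVec s (u K))
    (h : ipV u u = 0) : u = 0 := by
  ext K : 1
  refine (hu K).eq_zero_of_isOpen isOpen_interior K.interior_nonempty fun x hx => ?_
  exact inner_self_eq_zero.1 (integral_nonneg_eq_zero (f := fun K x => inner ℝ (u K x) (u K x))
    (fun K => (hu K).continuous.inner (hu K).continuous) (fun K x => real_inner_self_nonneg) h K x hx)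

/-! ### The projections -/

lemma exists_projDG (m : ℕ) {f : T.SField} (hf : Cont f) :
    ∃ P ∈ T.DG m, ∀ σ ∈ T.DG m, ip P σ = ip f σ := by
  have hcont (σ : T.dgSub m) : Cont σ.1 := DG.cont (mem_dgSub.1 σ.2)
  let β : T.dgSub m →ₗ[ℝ] T.dgSub m →ₗ[ℝ] ℝ := LinearMap.mk₂ ℝ (fun P σ => ip P.1 σ.1)
    (fun P P' σ => ip_add_left (hcont P) (hcont P') (hcont σ)) (fun c P σ => ip_smul_left c)
    (fun P σ σ' => ip_add_right (hcont P) (hcont σ) (hcont σ')) (fun c P σ => ip_smul_right c)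
  let ℓ : T.dgSub m →ₗ[ℝ] ℝ :=
    { toFun := fun σ => ip f σ.1
      map_add' := fun σ σ' => ip_add_right hf (hcont σ) (hcont σ')
      map_smul' := fun c σ => ip_smul_right c }
  obtain ⟨P, hP⟩ := exists_eq_of_definite β
    (fun v hv => Subtype.ext (eq_zero_of_ip_self (mem_dgSub.1 v.2) hv)) ℓ
  exact ⟨P.1, mem_dgSub.1 P.2, fun σ hσ => LinearMap.congr_fun hP ⟨σ, mem_dgSub.2 hσ⟩⟩

lemma exists_projCurl (s : ℕ) {u : T.VField} (hu : Cont u) :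
    ∃ P ∈ T.NED s, ∀ z ∈ T.NED s, ipV P z = ipV u z := by
  have hcont (σ : T.nedSub s) : Cont σ.1 := NED.cont σ.2
  let β : T.nedSub s →ₗ[ℝ] T.nedSub s →ₗ[ℝ] ℝ := LinearMap.mk₂ ℝ (fun P σ => ipV P.1 σ.1)
    (fun P P' σ => ipV_add_left (hcont P) (hcont P') (hcont σ)) (fun c P σ => ipV_smul_left c)
    (fun P σ σ' => ipV_add_right (hcont P) (hcont σ) (hcont σ')) (fun c P σ => ipV_smul_right c)
  let ℓ : T.nedSub s →ₗ[ℝ] ℝ :=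
    { toFun := fun σ => ipV u σ.1
      map_add' := fun σ σ' => ipV_add_right hu (hcont σ) (hcont σ')
      map_smul' := fun c σ => ipV_smul_right c }
  obtain ⟨P, hP⟩ := exists_eq_of_definite β
    (fun v hv => Subtype.ext (eq_zero_of_ipV_self (NED.isPolyVec v.2) hv)) ℓ
  exact ⟨P.1, P.2, fun σ hσ => LinearMap.congr_fun hP ⟨σ, hσ⟩⟩

/-- For continuous pieces the projection exists, because the `L²` form is definite on a
finite-dimensional space; the default value `0` in the definition is not taken. -/
lemma projDG_spec (m : ℕ) {f : T.SField} (hf : Cont f) :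
    projDG m f ∈ T.DG m ∧ ∀ σ ∈ T.DG m, ip (projDG m f) σ = ip f σ := by
  have h := exists_projDG m hf
  rw [projDG, dif_pos h]
  exact h.choose_spec

lemma projCurl_spec (s : ℕ) {u : T.VField} (hu : Cont u) :
    projCurl s u ∈ T.NED s ∧ ∀ z ∈ T.NED s, ipV (projCurl s u) z = ipV u z := by
  have h := exists_projCurl s hu
  rw [projCurl, dif_pos h]
  exact h.choose_spec

lemma projDG_eq {m : ℕ} {f P : T.SField} (hP : P ∈ T.DG m)
    (h : ∀ σ ∈ T.DG m, ip P σ = ip f σ) : projDG m f = P := by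
  have he : ∃ P ∈ T.DG m, ∀ σ ∈ T.DG m, ip P σ = ip f σ := ⟨P, hP, h⟩
  rw [projDG, dif_pos he]
  obtain ⟨h1, h2⟩ := he.choose_spec
  have hd : he.choose - P ∈ T.DG m :=
    mem_dgSub.1 ((T.dgSub m).sub_mem (mem_dgSub.2 h1) (mem_dgSub.2 hP))
  refine sub_eq_zero.1 (eq_zero_of_ip_self hd ?_)
  have h3 : ip (he.choose - P) (he.choose - P) + ip P (he.choose - P) =
      ip he.choose (he.choose - P) := by
    rw [← ip_add_left (DG.cont hd) (DG.cont hP) (DG.cont hd), sub_add_cancel]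
  rw [h2 _ hd, h _ hd] at h3
  linarith

lemma projCurl_eq {s : ℕ} {u P : T.VField} (hP : P ∈ T.NED s)
    (h : ∀ z ∈ T.NED s, ipV P z = ipV u z) : projCurl s u = P := by
  have he : ∃ P ∈ T.NED s, ∀ z ∈ T.NED s, ipV P z = ipV u z := ⟨P, hP, h⟩
  rw [projCurl, dif_pos he]
  obtain ⟨h1, h2⟩ := he.choose_spec
  have hd : he.choose - P ∈ T.NED s := (T.nedSub s).sub_mem h1 hP
  refine sub_eq_zero.1 (eq_zero_of_ipV_self (NED.isPolyVec hd) ?_)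
  rw [ipV_sub_left (NED.cont h1) (NED.cont hP) (NED.cont hd), h2 _ hd, h _ hd, sub_self]

lemma projDG_of_mem {m : ℕ} {f : T.SField} (hf : f ∈ T.DG m) : projDG m f = f :=
  projDG_eq hf fun _ _ => rfl

lemma projCurl_zero (s : ℕ) : projCurl s (0 : T.VField) = 0 :=
  projCurl_eq (T.nedSub s).zero_mem fun _ _ => rfl

lemma projCurl_neg (s : ℕ) {u : T.VField} (hu : Cont u) :
    projCurl s (-u) = - projCurl s u := by
  refine projCurl_eq ((T.nedSub s).neg_mem (projCurl_spec s hu).1) fun z hz => ?_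
  rw [ipV_neg_left, ipV_neg_left, (projCurl_spec s hu).2 z hz]

/-! ### The trilinear form `a_h` -/

lemma crossF_self (u : T.VField) : crossF u u = 0 := by
  ext K x : 2
  exact cross_self_eq_zero _

lemma crossF_swap (u v : T.VField) : crossF u v = - crossF v u := by
  ext K x : 2
  exact cross_swap _ _

lemma cont_crossF {u v : T.VField} (hu : Cont u) (hv : Cont v) : Cont (crossF u v) := by
  intro K
  refine (PiLp.continuous_toLp 2 _).comp ?_
  have h (w : T.VField) (hw : Cont w) (i : Fin 3) : Continuous fun x => w K x i :=
    (EuclideanSpace.proj i : E3 →L[ℝ] ℝ).continuous.comp (hw K)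
  refine continuous_pi fun i => ?_
  fin_cases i <;> simp only [cross_apply] <;> simp <;>
    exact ((h u hu _).mul (h v hv _)).sub ((h u hu _).mul (h v hv _))

lemma curlF_zero : curlF (0 : T.VField) = 0 := by
  ext K x : 2
  apply E3.ext <;> simp [curlF, curl3, pderiv]

lemma aForm_self (s : ℕ) (w u : T.VField) : aForm s w u u = 0 := by
  rw [aForm, crossF_self, projCurl_zero, curlF_zero, ipV_comm, ipV_zero_left]

lemma aForm_swap {s : ℕ} (w : T.VField) {u v : T.VField} (hu : Cont u) (hv : Cont v) :
    aForm s w u v = - aForm s w v u := by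
  have hc := cont_crossF (NED.cont (projCurl_spec s hv).1) (NED.cont (projCurl_spec s hu).1)
  rw [aForm, aForm, crossF_swap, projCurl_neg s hc, ← neg_one_smul ℝ, curlF_smul (-1)
    (fun K => (NED.isPolyVec (projCurl_spec s hc).1 K).differentiable), ipV_smul_right, neg_one_mul]

end Triangulation

namespace Triangulation

variable {T : Triangulation}

/-! ### Barycentric coordinates -/

/-- The vertices of a cell as an affine basis. -/
def Cell.basis (K : T.Cell) : AffineBasis K.1 ℝ E3 :=
  ⟨(↑), K.affineIndependent,
    K.affineIndependent.affineSpan_eq_top_iff_card_eq_finrank_add_one.2 (by simp [K.2.2])⟩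

lemma Cell.basis_apply (K : T.Cell) (v : K.1) : K.basis v = v := rfl

lemma Cell.mem_interior_iff (K : T.Cell) (x : E3) :
    x ∈ interior K.hull ↔ ∀ v : K.1, 0 < K.basis.coord v x := by
  have h := K.basis.interior_convexHull
  have hr : Set.range K.basis = (K.1 : Set E3) := by
    ext x; simp [Cell.basis_apply]
  rw [hr] at h
  rw [Cell.hull, h]
  rfl

lemma Cell.coord_vertex (K : T.Cell) (v : K.1) {w : E3} (hw : w ∈ K.1) :
    K.basis.coord v w = if v.1 = w then 1 else 0 := by
  have := K.basis.coord_apply v ⟨w, hw⟩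
  rw [Cell.basis_apply] at this
  rw [this]
  simp [Subtype.ext_iff]

lemma affineMap_barycentre (f : E3 →ᵃ[ℝ] ℝ) {e : Finset E3} (he : e.Nonempty) :
    f (barycentre e) = (e.card : ℝ)⁻¹ * ∑ v ∈ e, f v := by
  have hf : ∀ x, f x = f.linear x + f 0 := fun x => congrFun f.decomp x
  have hc : (e.card : ℝ) ≠ 0 := by exact_mod_cast he.card_pos.ne'
  rw [hf, barycentre, map_smul, map_sum, Finset.sum_congr rfl fun v _ => hf v,
    Finset.sum_add_distrib]
  simp only [smul_eq_mul, Finset.sum_const, nsmul_eq_mul]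
  field_simp

lemma affineMap_segment (f : E3 →ᵃ[ℝ] ℝ) (x y : E3) (t : ℝ) :
    f (x + t • (y - x)) = (1 - t) * f x + t * f y := by
  have hf : ∀ x, f x = f.linear x + f 0 := fun x => congrFun f.decomp x
  rw [hf, hf x, hf y]
  simp only [map_add, map_smul, map_sub, smul_eq_mul]
  ring

lemma affineMap_nonneg_of_mem_convexHull (f : E3 →ᵃ[ℝ] ℝ) {e : Set E3} (h : ∀ v ∈ e, 0 ≤ f v)
    {x : E3} (hx : x ∈ convexHull ℝ e) : 0 ≤ f x :=
  convexHull_min (t := f ⁻¹' Set.Ici 0) h ((convex_Ici 0).affine_preimage f) hx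

lemma barycentre_mem_convexHull {e : Finset E3} (he : e.Nonempty) :
    barycentre e ∈ convexHull ℝ (e : Set E3) := by
  have hc : (0 : ℝ) < e.card := by exact_mod_cast he.card_pos
  rw [barycentre, Finset.smul_sum]
  refine (convex_convexHull ℝ _).sum_mem (fun _ _ => by positivity) ?_
    fun v hv => subset_convexHull ℝ _ hv
  rw [Finset.sum_const, nsmul_eq_mul, mul_inv_cancel₀ hc.ne']

/-! ### Faces of cells -/

lemma Cell.exists_erase {K : T.Cell} {e : Finset E3} (he : e.card = 3) (h : e ⊆ K.1) :
    ∃ a ∈ K.1, e = K.1.erase a := by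
  have hc : (K.1 \ e).card = 1 := by
    rw [Finset.card_sdiff_of_subset h, K.2.2, he]
  obtain ⟨a, ha⟩ := Finset.card_eq_one.1 hc
  refine ⟨a, (Finset.mem_sdiff.1 (ha ▸ Finset.mem_singleton_self a : a ∈ K.1 \ e)).1, ?_⟩
  rw [← Finset.sdiff_singleton_eq_erase, ← ha, Finset.sdiff_sdiff_eq_self h]

/-- Both normals are unit vectors in the orthogonal complement of the plane of `e`, which is a line.
-/
lemma outwardNormal_eq_or_neg {K L : T.Cell} {e : Finset E3} (he : e.card = 3) (hK : e ⊆ K.1)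
    (hL : e ⊆ L.1) : outwardNormal L.1 e = outwardNormal K.1 e ∨
      outwardNormal L.1 e = - outwardNormal K.1 e := by
  have hne : e.Nonempty := by rw [← Finset.card_pos, he]; norm_num
  have hmem (M : T.Cell) : outwardNormal M.1 e ∈ (vectorSpan ℝ (e : Set E3))ᗮ :=
    Submodule.smul_mem _ _ (Submodule.starProjection_apply_mem _ _)
  have hnorm (M : T.Cell) (hM : e ⊆ M.1) : ‖outwardNormal M.1 e‖ = 1 := by
    obtain ⟨a, ha, rfl⟩ := M.exists_erase he hM
    exact (outwardNormal_spec M.affineIndependent ha hne).1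
  have hind : AffineIndependent ℝ ((↑) : e → E3) := K.affineIndependent.mono hK
  have hrank : Module.finrank ℝ (vectorSpan ℝ (e : Set E3)) = 2 := by
    have := hind.finrank_vectorSpan (n := 2) (by simp [he])
    rwa [Subtype.range_coe_subtype] at this
  have hrank' : Module.finrank ℝ (vectorSpan ℝ (e : Set E3))ᗮ = 1 := by
    have := Submodule.finrank_add_finrank_orthogonal (vectorSpan ℝ (e : Set E3))
    rw [hrank, finrank_euclideanSpace_fin] at this
    omega
  have hK0 : (⟨_, hmem K⟩ : (vectorSpan ℝ (e : Set E3))ᗮ) ≠ 0 := by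
    intro h
    have h1 := hnorm K hK
    have h' : outwardNormal K.1 e = 0 := congrArg Subtype.val h
    rw [h'] at h1
    simp at h1
  obtain ⟨c, hc⟩ := (finrank_eq_one_iff_of_nonzero' _ hK0).1 hrank' ⟨_, hmem L⟩
  have hc' : c • outwardNormal K.1 e = outwardNormal L.1 e := congrArg Subtype.val hc
  have h2 := hnorm L hL
  rw [← hc', norm_smul, hnorm K hK, mul_one, Real.norm_eq_abs] at h2
  rcases eq_or_eq_neg_of_abs_eq h2 with h | h
  · left; rw [← hc', h, one_smul]
  · right; rw [← hc', h, neg_one_smul]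

/-- Two different cells lie on opposite sides of a common face. -/
lemma outwardNormal_ne {K L : T.Cell} (hKL : K ≠ L) {e : Finset E3} (he : e.card = 3)
    (hK : e ⊆ K.1) (hL : e ⊆ L.1) : outwardNormal L.1 e ≠ outwardNormal K.1 e := by
  intro heq
  have hne : e.Nonempty := by rw [← Finset.card_pos, he]; norm_num
  obtain ⟨a, ha, hea⟩ := K.exists_erase he hK
  obtain ⟨a', ha', hea'⟩ := L.exists_erase he hL
  obtain ⟨b, hb⟩ := hne
  have hsK := (outwardNormal_spec K.affineIndependent ha (hea ▸ ⟨b, hb⟩)).2.2 b (hea ▸ hb)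
  have hsL := outwardNormal_spec L.affineIndependent ha' (hea' ▸ ⟨b, hb⟩)
  rw [← hea] at hsK
  rw [← hea'] at hsL
  -- If the normals agreed, the vertex `a` of `K` opposite `e` would be on the same side of `e` as
  -- the vertex `a'` of `L`. Pairing with the normal removes every barycentric term except the one
  -- of `a'`.
  have hcoord : 0 < L.basis.coord ⟨a', ha'⟩ a := by
    have h1 : ∑ v : L.1, L.basis.coord v a • (v.1 - b) = a - b := by
      simp only [smul_sub, Finset.sum_sub_distrib, ← Finset.sum_smul]
      rw [L.basis.sum_coord_apply_eq_one, one_smul]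
      congr 1
      exact L.basis.linear_combination_coord_eq_self a
    have h2 : inner ℝ (outwardNormal L.1 e) (a - b) =
        L.basis.coord ⟨a', ha'⟩ a * inner ℝ (outwardNormal L.1 e) (a' - b) := by
      rw [← h1, inner_sum, Finset.sum_eq_single ⟨a', ha'⟩]
      · rw [inner_smul_right]
      · intro v _ hv
        have hve : v.1 ∈ e := by
          rw [hea', Finset.mem_erase]
          exact ⟨fun h => hv (Subtype.ext h), v.2⟩
        rw [inner_smul_right, hsL.2.1 b hb v hve, mul_zero]
      · simp
    rw [← heq, h2] at hsK
    exact pos_of_mul_neg_left hsK (hsL.2.2 b hb).le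
  -- The segment from the barycentre of `e` to `a` then runs inside `K` and, for small positive
  -- parameters, also inside `L`: the coordinates of the vertices of `e` start at `1/3`, and that of
  -- `a'` grows from zero. This contradicts disjointness of the interiors.
  let γ : ℝ → E3 := fun t => barycentre e + t • (a - barycentre e)
  have hcardR : (e.card : ℝ)⁻¹ = 1 / 3 := by rw [he]; norm_num
  have hbary (M : T.Cell) (hM : e ⊆ M.1) (v : M.1) :
      M.basis.coord v (barycentre e) = if v.1 ∈ e then 1 / 3 else 0 := by
    rw [affineMap_barycentre _ ⟨b, hb⟩, hcardR,
      Finset.sum_congr rfl fun w hw => M.coord_vertex v (hM hw), Finset.sum_ite_eq]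
    split_ifs <;> simp
  have hγK : ∀ t ∈ Set.Ioo (0 : ℝ) 1, γ t ∈ interior K.hull := by
    intro t ht
    rw [K.mem_interior_iff]
    intro v
    rw [affineMap_segment, hbary K hK, K.coord_vertex v ha]
    have h1 := ht.1
    have h2 := ht.2
    by_cases hv : v.1 = a
    · have : v.1 ∉ e := by rw [hea, hv]; simp
      rw [if_neg this, if_pos hv]
      linarith
    · have : v.1 ∈ e := by rw [hea]; exact Finset.mem_erase.2 ⟨hv, v.2⟩
      rw [if_pos this, if_neg hv]
      linarith
  have hγL : ∀ᶠ t in nhdsWithin (0 : ℝ) (Set.Ioi 0), γ t ∈ interior L.hull := by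
    simp only [L.mem_interior_iff]
    rw [Filter.eventually_all]
    intro v
    simp only [γ, affineMap_segment, hbary L hL]
    by_cases hv : v.1 = a'
    · have : v.1 ∉ e := by rw [hea', hv]; simp
      have hv' : v = ⟨a', ha'⟩ := Subtype.ext hv
      rw [if_neg this, hv']
      filter_upwards [self_mem_nhdsWithin] with t ht
      have : 0 < t := ht
      rw [mul_zero, zero_add]
      positivity
    · have : v.1 ∈ e := by rw [hea']; exact Finset.mem_erase.2 ⟨hv, v.2⟩
      rw [if_pos this]
      have hcont : Continuous fun t : ℝ => (1 - t) * (1 / 3) + t * L.basis.coord v a := by fun_prop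
      refine nhdsWithin_le_nhds ((isOpen_lt continuous_const hcont).mem_nhds ?_)
      norm_num
  have hIoo : ∀ᶠ t in nhdsWithin (0 : ℝ) (Set.Ioi 0), t ∈ Set.Ioo (0 : ℝ) 1 :=
    Ioo_mem_nhdsGT one_pos
  obtain ⟨t, h1, h2⟩ := (hγL.and hIoo).exists
  exact (Cell.disjoint_interior hKL).ne_of_mem (hγK t h2) h1 rfl

lemma outwardNormal_neg {K L : T.Cell} (hKL : K ≠ L) {e : Finset E3} (he : e.card = 3)
    (hK : e ⊆ K.1) (hL : e ⊆ L.1) : outwardNormal L.1 e = - outwardNormal K.1 e :=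
  (outwardNormal_eq_or_neg he hK hL).resolve_left (outwardNormal_ne hKL he hK hL)

/-- At most two cells share a face. -/
lemma cell_eq_or_eq {K L M : T.Cell} (hKL : K ≠ L) {e : Finset E3} (he : e.card = 3)
    (hK : e ⊆ K.1) (hL : e ⊆ L.1) (hM : e ⊆ M.1) : M = K ∨ M = L := by
  by_contra! h
  have h1 := outwardNormal_neg hKL he hK hL
  have h2 := outwardNormal_neg h.1.symm he hK hM
  exact outwardNormal_ne h.2.symm he hL hM (h2.trans h1.symm)

open Classical in
/-- The cells that contain given points. -/
def cellsAt (T : Triangulation) (e : Finset E3) : Finset T.Cell := {K | e ⊆ K.1}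

lemma mem_cellsAt {e : Finset E3} {K : T.Cell} : K ∈ T.cellsAt e ↔ e ⊆ K.1 := by
  simp [cellsAt]

lemma adjacent_eq_cellsAt (e : T.InteriorFace) : adjacent e = T.cellsAt e.1 := by
  ext K; simp [adjacent, cellsAt]

lemma exists_adjacent_eq (e : T.InteriorFace) :
    ∃ K L : T.Cell, K ≠ L ∧ e.1 ⊆ K.1 ∧ e.1 ⊆ L.1 ∧
      ∀ {A : Type} [AddCommMonoid A] (f : T.Cell → A), ∑ M ∈ adjacent e, f M = f K + f L := by
  classical
  obtain ⟨he, hc, K, L, hKL, hK, hL⟩ := e.2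
  refine ⟨K, L, hKL, hK, hL, fun f => ?_⟩
  have : adjacent e = {K, L} := by
    ext M
    rw [adjacent_eq_cellsAt, mem_cellsAt, Finset.mem_insert, Finset.mem_singleton]
    constructor
    · exact fun h => cell_eq_or_eq hKL hc hK hL h
    · rintro (rfl | rfl) <;> assumption
  rw [this, Finset.sum_pair hKL]

open Classical in
/-- All triangles of the mesh. -/
def triangles (T : Triangulation) : Finset (Finset E3) :=
  Finset.univ.biUnion fun K : T.Cell => K.1.powersetCard 3

lemma mem_triangles {e : Finset E3} :
    e ∈ T.triangles ↔ e.card = 3 ∧ ∃ K : T.Cell, e ⊆ K.1 := by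
  simp only [triangles, Finset.mem_biUnion, Finset.mem_univ, true_and, Finset.mem_powersetCard]
  tauto

lemma triangle_mem_faces {e : Finset E3} (he : e ∈ T.triangles) : e ∈ T.faces := by
  obtain ⟨hc, K, hK⟩ := mem_triangles.1 he
  exact T.down_closed K.2.1 hK (by rw [← Finset.card_pos, hc]; norm_num)

lemma sum_faces_eq_sum_triangles (F : T.Cell → Finset E3 → ℝ) :
    ∑ K : T.Cell, ∑ a ∈ K.1, F K (K.1.erase a) = ∑ e ∈ T.triangles, ∑ K ∈ T.cellsAt e, F K e := by
  classical
  have h1 : ∀ K : T.Cell, ∑ a ∈ K.1, F K (K.1.erase a) = ∑ e ∈ K.1.powersetCard 3, F K e := by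
    intro K
    refine Finset.sum_bij (fun a _ => K.1.erase a) ?_ ?_ ?_ ?_
    · intro a ha
      rw [Finset.mem_powersetCard]
      exact ⟨Finset.erase_subset _ _, by rw [Finset.card_erase_of_mem ha, K.2.2]⟩
    · intro a ha b hb h
      by_contra hab
      have : a ∈ K.1.erase b := Finset.mem_erase.2 ⟨hab, ha⟩
      rw [← h] at this
      simp at this
    · intro e he
      rw [Finset.mem_powersetCard] at he
      obtain ⟨a, ha, rfl⟩ := K.exists_erase he.2 he.1
      exact ⟨a, ha, rfl⟩
    · intros; rfl
  simp only [h1]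
  refine Finset.sum_comm' fun K e => ?_
  simp only [Finset.mem_univ, true_and, Finset.mem_powersetCard, mem_cellsAt, mem_triangles]
  constructor
  · rintro ⟨h1, h2⟩; exact ⟨h1, h2, K, h1⟩
  · rintro ⟨h1, h2, -⟩; exact ⟨h1, h2⟩

lemma integrableOn_triangle {e : Finset E3} (he : e ∈ T.triangles) {f : E3 → ℝ}
    (hf : Continuous f) :
    IntegrableOn f (convexHull ℝ (e : Set E3)) (μHE[2] : Measure E3) := by
  obtain ⟨hc, K, hK⟩ := mem_triangles.1 he
  obtain ⟨a, ha, rfl⟩ := K.exists_erase hc hK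
  exact integrableOn_face K.affineIndependent K.2.2 ha hf

/-! ### Normal continuity of Raviart-Thomas fields -/

/-- The sum of the outward normal components of a piecewise smooth field on a face. -/
def fluxJump (u : T.VField) (e : Finset E3) (x : E3) : ℝ :=
  ∑ K ∈ T.cellsAt e, inner ℝ (u K x) (outwardNormal K.1 e)

/-- The divergence theorem on all cells. -/
lemma sum_integral_div3 {u : T.VField} (hu : ∀ K, ContDiff ℝ 1 (u K)) :
    ∑ K : T.Cell, ∫ x in K.hull, div3 (u K) x =
      ∑ e ∈ T.triangles, ∫ x in convexHull ℝ (e : Set E3), fluxJump u e x ∂(μHE[2] : Measure E3) := by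
  have h1 : ∀ K : T.Cell, ∫ x in K.hull, div3 (u K) x = ∑ a ∈ K.1,
      ∫ x in convexHull ℝ ((K.1.erase a : Finset E3) : Set E3),
        inner ℝ (u K x) (outwardNormal K.1 (K.1.erase a)) ∂(μHE[2] : Measure E3) := fun K =>
    integral_div3_tetrahedron K.affineIndependent K.2.2 (hu K)
  simp only [h1]
  rw [sum_faces_eq_sum_triangles fun K e => ∫ x in convexHull ℝ (e : Set E3),
        inner ℝ (u K x) (outwardNormal K.1 e) ∂(μHE[2] : Measure E3)]
  refine Finset.sum_congr rfl fun e he => ?_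
  simp only [fluxJump]
  rw [integral_finsetSum]
  exact fun K _ => integrableOn_triangle he ((hu K).continuous.inner continuous_const)

/-- This passes from almost everywhere vanishing, which gives vanishing on the open interior, to the
closed simplex. -/
lemma cornerSimplex_subset_closure_interior (n : ℕ) :
    cornerSimplex n ⊆ closure (interior (cornerSimplex n)) := by
  have hconv : Convex ℝ (cornerSimplex n) := by
    intro x hx y hy a b ha hb hab
    refine ⟨fun i => ?_, ?_⟩
    · have := hx.1 i
      have := hy.1 i
      simp only [Pi.add_apply, Pi.smul_apply, smul_eq_mul]
      positivity
    · simp only [Pi.add_apply, Pi.smul_apply, smul_eq_mul, Finset.sum_add_distrib, ← Finset.mul_sum]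
      nlinarith [hx.2, hy.2]
  have hne : (interior (cornerSimplex n)).Nonempty := by
    refine ⟨fun _ => 1 / (n + 1), ?_⟩
    rw [mem_interior]
    refine ⟨(⋂ i, {y : Fin n → ℝ | 0 < y i}) ∩ {y | ∑ i, y i < 1}, ?_, ?_, ?_⟩
    · rintro y ⟨h1, h2⟩
      exact ⟨fun i => (Set.mem_iInter.1 h1 i).le, le_of_lt h2⟩
    · exact (isOpen_iInter_of_finite fun i => isOpen_lt continuous_const (continuous_apply i)).inter
        (isOpen_lt (by fun_prop) continuous_const)
    · refine ⟨Set.mem_iInter.2 fun i => ?_, ?_⟩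
      · show (0 : ℝ) < 1 / (n + 1)
        positivity
      · show ∑ _i : Fin n, (1 : ℝ) / (n + 1) < 1
        rw [Finset.sum_const, Finset.card_univ, Fintype.card_fin, nsmul_eq_mul]
        rw [mul_one_div, div_lt_one (by positivity)]
        linarith
  rw [hconv.closure_interior_eq_closure_of_nonempty_interior hne]
  exact subset_closure

/-- A nonnegative continuous function whose surface integral vanishes is zero. -/
lemma eq_zero_of_integral_triangle {e : Finset E3} (he : e ∈ T.triangles) {f : E3 → ℝ}
    (hf : Continuous f) (h0 : ∀ x, 0 ≤ f x)
    (h : ∫ x in convexHull ℝ (e : Set E3), f x ∂(μHE[2] : Measure E3) = 0) :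
    ∀ x ∈ convexHull ℝ (e : Set E3), f x = 0 := by
  obtain ⟨hc, K, hK⟩ := mem_triangles.1 he
  obtain ⟨a, ha, hea⟩ := K.exists_erase hc hK
  obtain ⟨p, hp⟩ : (K.1.erase a).Nonempty := by rw [← hea, ← Finset.card_pos, hc]; norm_num
  have hap := (Finset.ne_of_mem_erase hp).symm
  obtain ⟨q, r, hKe, haq, har, hpq, hpr, hqr⟩ :=
    exists_vertices K.2.2 ha (Finset.mem_of_mem_erase hp) hap
  -- The edge `a - p` is transversal to the face, so its determinant is nonzero and the surface
  -- integral can be replaced by one over the flat simplex.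
  have hI := (integral_face K.affineIndependent hKe hap haq har hpq hpr hqr).2 (a - p) f
  have hK' : K.1 = {p, a, q, r} := by rw [hKe, Finset.insert_comm]
  have hdet := det3_ne_zero_of_affineIndependent K.affineIndependent hK' hap.symm hpq hpr haq har hqr
  rw [← hea, h, mul_zero] at hI
  have hI' := (mul_eq_zero.1 hI.symm).resolve_left (abs_ne_zero.2 hdet)
  have hcont : Continuous fun z : Fin 2 → ℝ => f (p + (z 0 • (q - p) + z 1 • (r - p))) :=
    hf.comp (by fun_prop)
  rw [setIntegral_eq_zero_iff_of_nonneg_ae (Filter.Eventually.of_forall fun z => h0 _)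
    (hcont.continuousOn.integrableOn_compact (isCompact_cornerSimplex 2))] at hI'
  have h2 := Measure.eqOn_open_of_ae_eq (ae_restrict_of_ae_restrict_of_subset interior_subset hI')
    isOpen_interior hcont.continuousOn continuousOn_const
  have h3 : Set.EqOn _ _ (cornerSimplex 2) := (h2.of_subset_closure (t := cornerSimplex 2)
    hcont.continuousOn continuousOn_const interior_subset (cornerSimplex_subset_closure_interior 2))
  intro x hx
  have hr : (e : Set E3) = Set.range ![p, q, r] := by
    have : e = {p, q, r} := by
      rw [hea, hKe, Finset.erase_insert]
      simp [hap, haq, har]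
    rw [this]; ext x; simp; tauto
  rw [hr, convexHull_range_eq_image_cornerSimplex] at hx
  obtain ⟨z, hz, rfl⟩ := hx
  have := h3 hz
  simpa [Fin.sum_univ_two] using this

lemma contDiff_fluxJump {s : ℕ} {u : T.VField} (hu : u ∈ T.RT s) (e : Finset E3)
    {n : WithTop ℕ∞} : ContDiff ℝ n (fluxJump u e) :=
  ContDiff.sum fun K _ => ((RT.isPolyVec hu K).contDiff).inner ℝ contDiff_const

/-- Integrals of the flux jumps against test functions vanish. -/
lemma sum_integral_fluxJump {s : ℕ} {u : T.VField} (hu : u ∈ T.RT s) {φ : E3 → ℝ}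
    (h1 : ContDiff ℝ ∞ φ) (h2 : HasCompactSupport φ) :
    ∑ e ∈ T.triangles, ∫ x in convexHull ℝ (e : Set E3), φ x * fluxJump u e x
      ∂(μHE[2] : Measure E3) = 0 := by
  have hp := RT.isPolyVec hu
  have hφ1 : ContDiff ℝ 1 φ := h1.of_le (by norm_cast)
  have h := (mem_RT_iff.1 hu).2 φ h1 h2
  rw [integral_eq (f := fun K x => inner ℝ (u K x) (gradient φ x) + divF u K x * φ x) fun K => ((hp K).continuous.inner (contDiff_gradient h1).continuous).add
        ((hp K).div3.continuous.mul h1.continuous)] at h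
  -- The divergence theorem is applied to `φ u` on each cell; the sum of the volume integrals is the
  -- weak divergence identity, hence zero.
  have hs := sum_integral_div3 (u := fun K x => φ x • u K x) fun K => hφ1.smul (hp K).contDiff
  simp only [div3_smul (hφ1.differentiable (by simp) _) ((hp _).differentiable _)] at hs
  simp only [divF, mul_comm _ (φ _)] at h
  rw [h] at hs
  rw [hs]
  refine Finset.sum_congr rfl fun e _ => ?_
  congr 1
  ext x
  simp only [fluxJump, Finset.mul_sum, inner_smul_left, conj_trivial]

/-- The test function is `η` times the flux jump itself, with a bump `η` at `x₀` that avoids all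
other triangles. Only `e` contributes, with the nonnegative integrand `η (fluxJump u e)²`. -/
lemma fluxJump_eq_zero_of_notMem {s : ℕ} {u : T.VField} (hu : u ∈ T.RT s) {e : Finset E3}
    (he : e ∈ T.triangles) {x₀ : E3} (hx : x₀ ∈ convexHull ℝ (e : Set E3))
    (hx' : ∀ e' ∈ T.triangles, e' ≠ e → x₀ ∉ convexHull ℝ (e' : Set E3)) :
    fluxJump u e x₀ = 0 := by
  classical
  set C : Set E3 := ⋃ e' ∈ T.triangles.erase e, convexHull ℝ (e' : Set E3) with hC
  have hCc : IsClosed C := isClosed_biUnion_finset fun e' _ => (isCompact_convexHull_finset e').isClosed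
  have hxC : Cᶜ ∈ nhds x₀ := by
    refine hCc.isOpen_compl.mem_nhds fun h => ?_
    simp only [hC, Set.mem_iUnion] at h
    obtain ⟨e', he', h⟩ := h
    exact hx' e' (Finset.mem_of_mem_erase he') (Finset.ne_of_mem_erase he') h
  obtain ⟨η, hη1, hη2, hη3, hη4, hη5⟩ := exists_contDiff_tsupport_subset (n := ⊤) hxC
  have hη0 : ∀ x, 0 ≤ η x := fun x => (hη4 ⟨x, rfl⟩).1
  have hj : ContDiff ℝ ∞ (fluxJump u e) := contDiff_fluxJump hu e
  have h := sum_integral_fluxJump hu (hη3.mul hj) (hη2.mul_right (f' := fluxJump u e))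
  rw [Finset.sum_eq_single_of_mem e he] at h
  · have := eq_zero_of_integral_triangle he (f := fun x => η x * fluxJump u e x * fluxJump u e x)
      ((hη3.continuous.mul hj.continuous).mul hj.continuous)
      (fun x => by rw [mul_assoc]; exact mul_nonneg (hη0 x) (mul_self_nonneg _)) h x₀ hx
    simpa [hη5] using this
  · intro e' he' hne
    rw [setIntegral_congr_fun (g := fun _ => (0 : ℝ)) (isCompact_convexHull_finset e').measurableSet]
    · simp
    · intro x hx
      have hxη : η x = 0 := by
        refine image_eq_zero_of_notMem_tsupport fun hxt => hη1 hxt ?_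
        exact Set.mem_biUnion (Finset.mem_coe.2 (Finset.mem_erase.2 ⟨hne, he'⟩)) hx
      simp [hxη]

/-- The normal component of a Raviart-Thomas field is continuous across faces, and it vanishes on
the boundary. -/
lemma fluxJump_eq_zero {s : ℕ} {u : T.VField} (hu : u ∈ T.RT s) {e : Finset E3}
    (he : e ∈ T.triangles) {x : E3} (hx : x ∈ convexHull ℝ (e : Set E3)) :
    fluxJump u e x = 0 := by
  obtain ⟨hc, K, hK⟩ := mem_triangles.1 he
  have hne : e.Nonempty := by rw [← Finset.card_pos, hc]; norm_num
  -- A point of `e` may lie on other triangles, but the points on the way to the barycentre do not.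
  -- The jump vanishes at these and, by continuity, at the endpoint.
  let γ : ℝ → E3 := fun t => x + t • (barycentre e - x)
  have hγ : Continuous γ := by fun_prop
  have hγe : ∀ t ∈ Set.Ioo (0 : ℝ) 1, γ t ∈ convexHull ℝ (e : Set E3) := fun t ht =>
    (convex_convexHull ℝ _).add_smul_sub_mem hx (barycentre_mem_convexHull hne) ⟨ht.1.le, ht.2.le⟩
  have hγz : ∀ t ∈ Set.Ioo (0 : ℝ) 1, fluxJump u e (γ t) = 0 := by
    intro t ht
    refine fluxJump_eq_zero_of_notMem hu he (hγe t ht) fun e' he' hee' hmem => ?_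
    obtain ⟨hc', -⟩ := mem_triangles.1 he'
    obtain ⟨a, hae, hae'⟩ : ∃ a ∈ e, a ∉ e' := by
      by_contra! hsub
      exact hee' (Finset.eq_of_subset_of_card_le hsub (by rw [hc, hc'])).symm
    -- By conformity a point on another triangle lies in the hull of the common vertices. The
    -- barycentric coordinate of the missing vertex `a` is zero there, whereas it is positive along
    -- the open segment.
    have hint := T.inter_subset_convexHull (triangle_mem_faces he) (triangle_mem_faces he')
      ⟨hγe t ht, hmem⟩
    let f := K.basis.coord ⟨a, hK hae⟩
    have hf : ∀ v ∈ e, f v = if a = v then 1 else 0 := fun v hv => K.coord_vertex _ (hK hv)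
    have hneg : 0 ≤ (-f) (γ t) := by
      refine affineMap_nonneg_of_mem_convexHull (-f) (fun v hv => ?_) hint
      have hav : a ≠ v := fun h => hae' (h ▸ hv.2)
      simp [hf v hv.1, hav]
    have hfx : 0 ≤ f x := affineMap_nonneg_of_mem_convexHull f
      (fun v hv => by rw [hf v hv]; split_ifs <;> norm_num) hx
    have hfb : 0 < f (barycentre e) := by
      rw [affineMap_barycentre f hne, Finset.sum_congr rfl hf, Finset.sum_ite_eq, if_pos hae, hc]
      norm_num
    have hpos : 0 < f (γ t) := by
      rw [affineMap_segment]
      have h1 := ht.1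
      have h2 := sub_pos.2 ht.2
      positivity
    have : (-f) (γ t) = - f (γ t) := rfl
    linarith
  have hcont : Continuous fun t => fluxJump u e (γ t) :=
    (contDiff_fluxJump hu e (n := 0)).continuous.comp hγ
  have hcl : Set.EqOn (fun t => fluxJump u e (γ t)) (fun _ => 0) (closure (Set.Ioo 0 1)) :=
    Set.EqOn.closure hγz hcont continuous_const
  have h0 := hcl (x := 0) (by rw [closure_Ioo (by norm_num)]; simp)
  simpa [γ] using h0

/-- Elementwise divergences of `g u` add up to the integrals of the jumps over interior faces. -/
lemma sum_integral_div3_smul {s k : ℕ} {u : T.VField} (hu : u ∈ T.RT s) {g : T.SField}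
    (hg : g ∈ T.DG k) :
    ∑ K : T.Cell, ∫ x in K.hull, div3 (fun y => g K y • u K y) x =
      ∑ e : T.InteriorFace, ∫ x in convexHull ℝ (e.1 : Set E3),
        inner ℝ (avg u e x) (jump g e x) ∂(μHE[2] : Measure E3) := by
  classical
  rw [sum_integral_div3 (u := fun K y => g K y • u K y)
    fun K => (hg K).contDiff.smul (RT.isPolyVec hu K).contDiff]
  have hset : ∀ e : T.InteriorFace, e.1 ∈ T.triangles := fun e =>
    mem_triangles.2 ⟨e.2.2.1, e.2.2.2.choose, e.2.2.2.choose_spec.choose_spec.2.1⟩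
  rw [← Finset.sum_filter_add_sum_filter_not T.triangles T.IsInteriorFace,
    Finset.sum_subtype (p := T.IsInteriorFace) (T.triangles.filter T.IsInteriorFace) (fun e => by
      rw [Finset.mem_filter]
      exact ⟨fun h => h.2, fun h => ⟨hset ⟨e, h⟩, h⟩⟩)]
  rw [Finset.sum_eq_zero (s := T.triangles.filter fun e => ¬ T.IsInteriorFace e), add_zero]
  · refine Finset.sum_congr rfl fun e _ => ?_
    refine setIntegral_congr_fun (isCompact_convexHull_finset _).measurableSet fun x hx => ?_
    have h0 := fluxJump_eq_zero hu (hset e) hx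
    obtain ⟨K, L, hKL, hK, hL, hsum⟩ := exists_adjacent_eq e
    simp only [fluxJump, avg, jump, ← adjacent_eq_cellsAt, hsum] at h0 ⊢
    rw [outwardNormal_neg hKL e.2.2.1 hK hL] at h0 ⊢
    simp only [inner_neg_right, inner_add_left, inner_add_right, inner_smul_left, inner_smul_right,
      conj_trivial] at h0 ⊢
    -- Write `n` for the normal from `K`. The difference of the sides is the mean of `g` times
    -- `u_K·n - u_L·n`, which is the vanishing flux jump.
    linear_combination (1 / 2 * (g K x + g L x)) * h0
  -- A triangle that is not an interior face belongs to one cell, so its flux jump is the normal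
  -- trace on the boundary, which is zero.
  · intro e he
    rw [Finset.mem_filter] at he
    obtain ⟨hc, K, hK⟩ := mem_triangles.1 he.1
    have hcells : T.cellsAt e = {K} := by
      ext L
      rw [mem_cellsAt, Finset.mem_singleton]
      constructor
      · intro hL
        by_contra hne
        exact he.2 ⟨triangle_mem_faces he.1, hc, L, K, hne, hL, hK⟩
      · rintro rfl; exact hK
    rw [setIntegral_congr_fun (g := fun _ => (0 : ℝ)) (isCompact_convexHull_finset e).measurableSet]
    · simp
    · intro x hx
      have h0 := fluxJump_eq_zero hu he.1 hx
      simp only [fluxJump, hcells, Finset.sum_singleton, inner_smul_left] at h0 ⊢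
      rw [h0, mul_zero]

end Triangulation

namespace Triangulation

variable {T : Triangulation}

/-! ### The advection form `b_h` -/

lemma jump_const (c : ℝ) (e : T.InteriorFace) (x : E3) :
    jump (fun _ _ => c : T.SField) e x = 0 := by
  obtain ⟨K, L, hKL, hK, hL, hsum⟩ := exists_adjacent_eq e
  rw [jump, hsum, outwardNormal_neg hKL e.2.2.1 hK hL]
  simp

lemma avg_const (c : ℝ) (e : T.InteriorFace) (x : E3) :
    avg (fun _ _ => c : T.SField) e x = c := by
  obtain ⟨K, L, hKL, hK, hL, hsum⟩ := exists_adjacent_eq e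
  rw [avg, hsum, smul_eq_mul]
  ring

lemma const_mem_DG (m : ℕ) (c : ℝ) : (fun _ _ => c : T.SField) ∈ T.DG m :=
  fun _ => IsPolyFun.const m c

lemma bForm_const_left (m : ℕ) (c : ℝ) (g : T.SField) (u : T.VField) :
    bForm m (fun _ _ => c) g u = 0 := by
  rw [bForm, projDG_of_mem (const_mem_DG m c)]
  have hg : ∀ x : E3, gradient (fun _ : E3 => c) x = 0 := fun x => by simp [gradient]
  simp [jump_const, hg]

lemma bForm_congr_left {m : ℕ} {f f' : T.SField} (h : projDG m f = projDG m f') (g : T.SField)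
    (u : T.VField) : bForm m f g u = bForm m f' g u := by
  rw [bForm, bForm, h]

/-- For divergence-free `u` the volume integrand is `div (u π_h f)`, and by normal continuity its
integrals add up to those of the face terms. -/
lemma bForm_const_right {m s : ℕ} {f : T.SField} (hf : Cont f) {u : T.VField} (hu : u ∈ T.RT s)
    (hd : DivFree u) : bForm m f (fun _ _ => 1) u = 0 := by
  have hP := (projDG_spec m hf).1
  rw [bForm, projDG_of_mem (const_mem_DG m 1)]
  simp only [mul_one, avg_const]
  rw [← sum_integral_div3_smul hu hP, neg_add_eq_zero]
  refine Finset.sum_congr rfl fun K _ => ?_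
  refine setIntegral_congr_fun K.isCompact_hull.measurableSet fun x hx => ?_
  have hd' : div3 (u K) x = 0 := hd K x hx
  simp only [div3_smul ((hP K).differentiable x) ((RT.isPolyVec hu K).differentiable x), hd']
  ring

/-- Elementwise `f u·∇f = div (½ f² u)`, and on faces `⟦½ f²⟧ = ⟦f⟧ {f}`; the central average in the
face term is what makes the two parts cancel. -/
lemma bForm_self {m s : ℕ} {f : T.SField} (hf : f ∈ T.DG m) {u : T.VField} (hu : u ∈ T.RT s)
    (hd : DivFree u) : bForm m f f u = 0 := by
  have hg : (fun K x => 1 / 2 * (f K x * f K x) : T.SField) ∈ T.DG (m + m) := fun K =>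
    ((hf K).mul (hf K)).const_mul _
  have key := sum_integral_div3_smul hu hg
  rw [bForm, projDG_of_mem hf, neg_add_eq_zero]
  have h1 : ∀ K : T.Cell, ∫ x in K.hull, inner ℝ (u K x) (gradient (f K) x) * f K x =
      ∫ x in K.hull, div3 (fun y => (1 / 2 * (f K y * f K y)) • u K y) x := by
    intro K
    refine setIntegral_congr_fun K.isCompact_hull.measurableSet fun x hx => ?_
    have hd' : div3 (u K) x = 0 := hd K x hx
    have df := (hf K).differentiable x
    simp only [div3_smul ((hg K).differentiable x) ((RT.isPolyVec hu K).differentiable x), hd',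
      inner_gradient_eq, dpart_const_mul _ _ (df.fun_mul df), dpart_mul _ df df]
    ring
  have h2 : ∀ e : T.InteriorFace, ∫ x in convexHull ℝ (e.1 : Set E3),
      inner ℝ (avg u e x) (jump f e x) * avg f e x ∂(μHE[2] : Measure E3) =
      ∫ x in convexHull ℝ (e.1 : Set E3), inner ℝ (avg u e x)
        (jump (fun K x => 1 / 2 * (f K x * f K x)) e x) ∂(μHE[2] : Measure E3) := by
    intro e
    congr 1
    ext x
    obtain ⟨K, L, hKL, hK, hL, hsum⟩ := exists_adjacent_eq e
    simp only [jump, hsum, outwardNormal_neg hKL e.2.2.1 hK hL, inner_add_right, inner_smul_right,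
      inner_neg_right]
    rw [avg.eq_1 f, hsum, smul_eq_mul]
    ring
  rw [Finset.sum_congr rfl fun K _ => h1 K, Finset.sum_congr rfl fun e _ => h2 e]
  exact key

/-- The mean vanishes because the weak identity may be tested with a function equal to `1` on all of
`Ω`: test functions need not vanish on the boundary. -/
lemma divF_mem_DGZero {s : ℕ} {u : T.VField} (hu : u ∈ T.RT s) : divF u ∈ T.DGZero s := by
  refine ⟨fun K => IsLocalRT.isPolyFun_div3 (hu.1 K), ?_⟩
  obtain ⟨r, hr0, hr⟩ := T.isCompact_space.isBounded.subset_ball_lt 0 0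
  let φ : ContDiffBump (0 : E3) := ⟨r, r + 1, hr0, by linarith⟩
  have hdom : T.domain ⊆ Metric.ball 0 r := T.domain_subset_space.trans hr
  have h := (RT.hasDivZeroTrace hu).2.2 φ φ.contDiff φ.hasCompactSupport
  have h1 : ∀ x ∈ T.domain, φ x = 1 := fun x hx =>
    φ.one_of_mem_closedBall (Metric.ball_subset_closedBall (hdom hx))
  have h2 : ∀ x ∈ T.domain, gradient φ x = 0 := by
    intro x hx
    have he : (φ : E3 → ℝ) =ᶠ[nhds x] fun _ => 1 := by
      filter_upwards [T.isOpen_domain.mem_nhds hx] with y hy using h1 y hy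
    rw [gradient, he.fderiv_eq]
    simp
  have h3 : ∫ x in T.domain, inner ℝ (glue u x) (gradient φ x) = 0 :=
    setIntegral_eq_zero_of_forall_eq_zero fun x hx => by rw [h2 x hx, inner_zero_right]
  have h4 : ∫ x in T.domain, glue (divF u) x * φ x = integral (divF u) :=
    setIntegral_congr_fun T.isOpen_domain.measurableSet fun x hx => by simp [h1 x hx]
  rw [h3, h4] at h
  exact neg_eq_zero.1 h.symm

end Triangulation

/-! ### Symmetry of the weak curl -/

lemma curl3_smul_const {f : E3 → ℝ} {x : E3} (hf : DifferentiableAt ℝ f x) (c : E3) :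
    curl3 (fun y => f y • c) x = cross (gradient f x) c := by
  have h : DifferentiableAt ℝ (fun y => f y • c) x := hf.smul_const c
  have hd (i j : Fin 3) : dpart i (fun y => f y * c j) x = dpart i f x * c j := by
    rw [dpart_mul _ hf (differentiableAt_const _)]
    simp [dpart]
  apply E3.ext
  · simp only [curl3_zero h, cross_zero_apply, gradient_apply, PiLp.smul_apply, smul_eq_mul, hd]
  · simp only [curl3_one h, cross_one_apply, gradient_apply, PiLp.smul_apply, smul_eq_mul, hd]
  · simp only [curl3_two h, cross_two_apply, gradient_apply, PiLp.smul_apply, smul_eq_mul, hd]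

lemma norm_cross_le (u v : E3) : ‖cross u v‖ ≤ ‖u‖ * ‖v‖ := by
  refine abs_le_of_sq_le_sq' ?_ (by positivity) |>.2
  rw [mul_pow, ← real_inner_self_eq_norm_sq, ← real_inner_self_eq_norm_sq,
    ← real_inner_self_eq_norm_sq]
  have h : inner ℝ (cross u v) (cross u v) = inner ℝ u u * inner ℝ v v - inner ℝ u v ^ 2 := by
    simp only [E3.inner_eq, cross_zero_apply, cross_one_apply, cross_two_apply]
    ring
  rw [h]
  linarith [sq_nonneg (inner ℝ u v)]

lemma gradient_comp_sub_const {f : E3 → ℝ} (y x : E3) :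
    gradient (fun z => f (z - y)) x = gradient f (x - y) := by
  rw [gradient, gradient, fderiv_comp_sub]

lemma gradient_comp_const_sub {f : E3 → ℝ} (hf : Differentiable ℝ f) (y x : E3) :
    gradient (fun z => f (y - z)) x = - gradient f (y - x) := by
  have h : HasFDerivAt (fun z => f (y - z)) (- fderiv ℝ f (y - x)) x := by
    have h1 : HasFDerivAt (fun z : E3 => y - z) (-(ContinuousLinearMap.id ℝ E3)) x :=
      (hasFDerivAt_id x).const_sub y
    refine ((hf (y - x)).hasFDerivAt.comp x h1).congr_fderiv ?_
    ext z; simp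
  rw [gradient, gradient, h.fderiv, map_neg]

lemma setIntegral_smul_eq_convolution {Ω : Set E3} (hΩ : MeasurableSet Ω) (ψ : E3 → ℝ)
    (G : E3 → E3) (x : E3) : ∫ y in Ω, ψ (x - y) • G y =
      convolution ψ (Ω.indicator G) (ContinuousLinearMap.lsmul ℝ ℝ) volume x := by
  rw [convolution_eq_swap, ← integral_indicator hΩ]
  congr 1
  ext1 y
  by_cases hy : y ∈ Ω <;> simp [hy]

/-- Bump functions that approximate the Dirac measure at the origin. -/
def diracBump (n : ℕ) : ContDiffBump (0 : E3) :=
  ⟨1 / (n + 1), 2 / (n + 1), by positivity, by gcongr; norm_num⟩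

/-- The inner integral is the mollification of the zero extension of `G`. It converges almost
everywhere and inherits the bound `C`, so `C ‖A‖` dominates. -/
lemma tendsto_integral_inner_mollified {Ω : Set E3} (hΩ : MeasurableSet Ω) (hfin : volume Ω ≠ ⊤)
    {G A : E3 → E3} {C : ℝ} (hG : AEStronglyMeasurable G (volume.restrict Ω))
    (hC : ∀ x, ‖G x‖ ≤ C) (hA : IntegrableOn A Ω) :
    Filter.Tendsto (fun n => ∫ x in Ω,
        inner ℝ (∫ y in Ω, (diracBump n).normed volume (x - y) • G y) (A x)) Filter.atTop
      (nhds (∫ x in Ω, inner ℝ (G x) (A x))) := by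
  have hC0 : 0 ≤ C := (norm_nonneg _).trans (hC 0)
  have : IsFiniteMeasure (volume.restrict Ω) := ⟨by
    rwa [Measure.restrict_apply_univ, lt_top_iff_ne_top]⟩
  have hGi : IntegrableOn G Ω := Integrable.of_bound hG C (Filter.Eventually.of_forall hC)
  have hloc : LocallyIntegrable (Ω.indicator G) volume := (hGi.integrable_indicator hΩ).locallyIntegrable
  have hae : ∀ᵐ x : E3, Filter.Tendsto (fun n => ∫ y in Ω, (diracBump n).normed volume (x - y) • G y)
      Filter.atTop (nhds (Ω.indicator G x)) := by
    -- Almost everywhere convergence requires a bounded ratio of outer to inner radius; for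
    -- `diracBump` it is always `2`.
    have h := ContDiffBump.ae_convolution_tendsto_right_of_locallyIntegrable (φ := diracBump)
      (l := Filter.atTop) (K := 2) (μ := volume) ?_ ?_ hloc
    · filter_upwards [h] with x hx
      simpa only [setIntegral_smul_eq_convolution hΩ] using hx
    · have h : Filter.Tendsto (fun n : ℕ => 2 * (1 / ((n : ℝ) + 1))) Filter.atTop (nhds (2 * 0)) :=
        tendsto_one_div_add_atTop_nhds_zero_nat.const_mul 2
      rw [mul_zero] at h
      refine h.congr fun n => ?_
      simp only [diracBump]
      ring
    · refine Filter.Eventually.of_forall fun n => le_of_eq ?_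
      simp only [diracBump]
      ring
  have hbound : ∀ n x, ‖∫ y in Ω, (diracBump n).normed volume (x - y) • G y‖ ≤ C := by
    intro n x
    have hi : Integrable (fun y => (diracBump n).normed volume (x - y)) volume :=
      (diracBump n).integrable_normed.comp_sub_left x
    calc ‖∫ y in Ω, (diracBump n).normed volume (x - y) • G y‖
        ≤ ∫ y in Ω, (diracBump n).normed volume (x - y) * C := by
          refine norm_integral_le_of_norm_le (hi.mul_const C).integrableOn
            (Filter.Eventually.of_forall fun y => ?_)
          rw [norm_smul, Real.norm_of_nonneg ((diracBump n).nonneg_normed _)]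
          exact mul_le_mul_of_nonneg_left (hC y) ((diracBump n).nonneg_normed _)
      _ ≤ ∫ y, (diracBump n).normed volume (x - y) * C :=
          setIntegral_le_integral (hi.mul_const C) (Filter.Eventually.of_forall fun y =>
            mul_nonneg ((diracBump n).nonneg_normed _) hC0)
      _ = C := by
          rw [MeasureTheory.integral_mul_const, integral_sub_left_eq_self
            (fun y => (diracBump n).normed volume y), ContDiffBump.integral_normed, one_mul]
  refine tendsto_integral_of_dominated_convergence (fun x => C * ‖A x‖) (fun n => ?_)
    (hA.norm.const_mul C) (fun n => Filter.Eventually.of_forall fun x => ?_) ?_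
  · refine AEStronglyMeasurable.inner ?_ hA.aestronglyMeasurable
    have hcont := (diracBump n).hasCompactSupport_normed.continuous_convolution_left
      (ContinuousLinearMap.lsmul ℝ ℝ) ((diracBump n).continuous_normed (μ := volume)) hloc
    refine (hcont.congr fun x => ?_).aestronglyMeasurable
    rw [setIntegral_smul_eq_convolution hΩ]
  · exact (norm_inner_le_norm _ _).trans (mul_le_mul_of_nonneg_right (hbound n x) (norm_nonneg _))
  · filter_upwards [ae_restrict_of_ae hae, ae_restrict_mem hΩ] with x hx hxΩ
    rw [Set.indicator_of_mem hxΩ] at hx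
    exact hx.inner tendsto_const_nhds

section

variable {Ω : Set E3} {A A' g g' : E3 → E3}

lemma continuous_cross : Continuous fun p : E3 × E3 => cross p.1 p.2 :=
  (ContDiff.continuous (𝕜 := ℝ) (n := 0)) <| by
    have h (a b : Fin 3) : ContDiff ℝ 0 fun p : E3 × E3 => p.1 a * p.2 b :=
      (contDiff_euclidean.1 contDiff_fst a).mul (contDiff_euclidean.1 contDiff_snd b)
    rw [contDiff_euclidean]
    intro i
    fin_cases i
    · simpa only [Fin.zero_eta, cross_zero_apply] using (h 1 2).sub (h 2 1)
    · simpa only [Fin.mk_one, cross_one_apply] using (h 2 0).sub (h 0 2)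
    · simpa only [Fin.reduceFinMk, cross_two_apply] using (h 0 1).sub (h 1 0)

lemma MeasureTheory.AEStronglyMeasurable.cross3 {α : Type*} [MeasurableSpace α] {μ : Measure α}
    {f g : α → E3} (hf : AEStronglyMeasurable f μ) (hg : AEStronglyMeasurable g μ) :
    AEStronglyMeasurable (fun p => cross (f p) (g p)) μ := by
  have h : AEStronglyMeasurable (fun p => (f p, g p)) μ := hf.prodMk hg
  exact continuous_cross.comp_aestronglyMeasurable h

/-- Mollified form of the symmetry of the curl. -/
lemma integral_inner_mollified_comm (hfin : volume Ω ≠ ⊤) (hA : HasCurlZeroTrace Ω A g)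
    (hA' : HasCurlZeroTrace Ω A' g') {ψ : E3 → ℝ} (hψ : ContDiff ℝ ∞ ψ)
    (hc : HasCompactSupport ψ) :
    ∫ y in Ω, (∫ x in Ω, ψ (x - y) * inner ℝ (g' x) (A y)) =
      ∫ x in Ω, (∫ y in Ω, ψ (x - y) * inner ℝ (g y) (A' x)) := by
  have : IsFiniteMeasure (volume.restrict Ω) := ⟨by
    rwa [Measure.restrict_apply_univ, lt_top_iff_ne_top]⟩
  have iA : Integrable A (volume.restrict Ω) := hA.1.integrable (by norm_num)
  have iA' : Integrable A' (volume.restrict Ω) := hA'.1.integrable (by norm_num)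
  have dψ : Differentiable ℝ ψ := hψ.differentiable (by simp)
  have cψ : Continuous (gradient ψ) := continuous_gradient (hψ.of_le (by norm_cast))
  obtain ⟨C, hC⟩ := (hasCompactSupport_gradient hc).exists_bound_of_continuous cψ
  -- With `y` frozen, the identity for `A'` is tested with `ψ(x - y) A(y)`; below, with `x` frozen,
  -- that for `A` is tested with `ψ(x - y) A'(x)`. The sign from differentiating in `y` is absorbed
  -- by the antisymmetry of the triple product, so both give the same double integrand and Fubini
  -- concludes.
  have h1 : ∀ y, ∫ x in Ω, ψ (x - y) * inner ℝ (g' x) (A y) =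
      ∫ x in Ω, inner ℝ (A' x) (cross (gradient ψ (x - y)) (A y)) := by
    intro y
    have hs : ContDiff ℝ ∞ fun x => ψ (x - y) := hψ.comp (contDiff_id.sub contDiff_const)
    have hcs : HasCompactSupport fun x => ψ (x - y) :=
      hc.comp_homeomorph (Homeomorph.subRight y)
    have h := hA'.2.2 (fun x => ψ (x - y) • A y) (hs.smul contDiff_const)
      (hcs.smul_right (f' := fun _ => A y))
    simp only [inner_smul_right] at h
    rw [← h]
    congr 1
    ext x
    rw [curl3_smul_const (hs.differentiable (by simp) x), gradient_comp_sub_const]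
  have h2 : ∀ x, ∫ y in Ω, ψ (x - y) * inner ℝ (g y) (A' x) =
      ∫ y in Ω, inner ℝ (A' x) (cross (gradient ψ (x - y)) (A y)) := by
    intro x
    have hs : ContDiff ℝ ∞ fun y => ψ (x - y) := hψ.comp (contDiff_const.sub contDiff_id)
    have hcs : HasCompactSupport fun y => ψ (x - y) :=
      hc.comp_homeomorph (Homeomorph.subLeft x)
    have h := hA.2.2 (fun y => ψ (x - y) • A' x) (hs.smul contDiff_const)
      (hcs.smul_right (f' := fun _ => A' x))
    simp only [inner_smul_right] at h
    rw [← h]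
    congr 1
    ext y
    rw [curl3_smul_const (hs.differentiable (by simp) y), gradient_comp_const_sub dψ]
    simp only [E3.inner_eq, cross_zero_apply, cross_one_apply, cross_two_apply, PiLp.neg_apply]
    ring
  simp only [h1, h2]
  have hint : Integrable (fun p : E3 × E3 => inner ℝ (A' p.2) (cross (gradient ψ (p.2 - p.1)) (A p.1)))
      ((volume.restrict Ω).prod (volume.restrict Ω)) := by
    have hm1 : AEStronglyMeasurable (fun p : E3 × E3 => A' p.2)
      ((volume.restrict Ω).prod (volume.restrict Ω)) := iA'.aestronglyMeasurable.comp_snd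
    have hm2 : AEStronglyMeasurable (fun p : E3 × E3 => A p.1)
      ((volume.restrict Ω).prod (volume.restrict Ω)) := iA.aestronglyMeasurable.comp_fst
    have hm3 : AEStronglyMeasurable (fun p : E3 × E3 => gradient ψ (p.2 - p.1))
      ((volume.restrict Ω).prod (volume.restrict Ω)) :=
      (cψ.comp (continuous_snd.sub continuous_fst)).aestronglyMeasurable
    have hm4 : AEStronglyMeasurable (fun p : E3 × E3 => cross (gradient ψ (p.2 - p.1)) (A p.1))
        ((volume.restrict Ω).prod (volume.restrict Ω)) :=
      hm3.cross3 hm2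
    have hm5 : AEStronglyMeasurable
        (fun p : E3 × E3 => inner ℝ (A' p.2) (cross (gradient ψ (p.2 - p.1)) (A p.1)))
        ((volume.restrict Ω).prod (volume.restrict Ω)) := hm1.inner hm4
    refine Integrable.mono' ((iA.norm.const_mul C).mul_prod iA'.norm) hm5
      (Filter.Eventually.of_forall fun p => ?_)
    calc ‖inner ℝ (A' p.2) (cross (gradient ψ (p.2 - p.1)) (A p.1))‖
        ≤ ‖A' p.2‖ * ‖cross (gradient ψ (p.2 - p.1)) (A p.1)‖ := norm_inner_le_norm _ _
      _ ≤ ‖A' p.2‖ * (C * ‖A p.1‖) := mul_le_mul_of_nonneg_left ((norm_cross_le _ _).trans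
          (mul_le_mul_of_nonneg_right (hC _) (norm_nonneg _))) (norm_nonneg _)
      _ = C * ‖A p.1‖ * ‖A' p.2‖ := mul_comm _ _
  exact integral_integral_swap hint

/-- The curl with vanishing tangential trace is symmetric. -/
lemma HasCurlZeroTrace.integral_inner_comm (hΩ : MeasurableSet Ω) (hfin : volume Ω ≠ ⊤)
    (hA : HasCurlZeroTrace Ω A g) (hA' : HasCurlZeroTrace Ω A' g') {C C' : ℝ}
    (hC : ∀ x, ‖g x‖ ≤ C) (hC' : ∀ x, ‖g' x‖ ≤ C') :
    ∫ x in Ω, inner ℝ (A x) (g' x) = ∫ x in Ω, inner ℝ (A' x) (g x) := by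
  have : IsFiniteMeasure (volume.restrict Ω) := ⟨by
    rwa [Measure.restrict_apply_univ, lt_top_iff_ne_top]⟩
  have h1 := tendsto_integral_inner_mollified hΩ hfin hA'.2.1.aestronglyMeasurable hC'
    (hA.1.integrable (by norm_num))
  have h2 := tendsto_integral_inner_mollified hΩ hfin hA.2.1.aestronglyMeasurable hC
    (hA'.1.integrable (by norm_num))
  simp only [real_inner_comm _ (A _), real_inner_comm _ (A' _)]
  refine tendsto_nhds_unique h1 (h2.congr fun n => ?_)
  have key := integral_inner_mollified_comm hfin hA hA'
    ((diracBump n).contDiff_normed (n := ⊤) (μ := volume)) (diracBump n).hasCompactSupport_normed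
  have hint : ∀ {F G : E3 → E3}, (∀ x, ‖F x‖ ≤ max C C') →
      AEStronglyMeasurable F (volume.restrict Ω) → ∀ x,
      ∫ y in Ω, (diracBump n).normed volume (x - y) * inner ℝ (F y) (G x) =
        inner ℝ (∫ y in Ω, (diracBump n).normed volume (x - y) • F y) (G x) := by
    intro F G hF hm x
    rw [real_inner_comm, ← integral_inner]
    · simp only [inner_smul_right, real_inner_comm]
    · have hb : Continuous fun y => (diracBump n).normed volume (x - y) :=
        (diracBump n).continuous_normed.comp (continuous_const.sub continuous_id)
      obtain ⟨D, hD⟩ := (diracBump n).hasCompactSupport_normed.exists_bound_of_continuous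
        ((diracBump n).continuous_normed (μ := volume))
      refine Integrable.of_bound (hb.aestronglyMeasurable.smul hm) (D * max C C')
        (Filter.Eventually.of_forall fun y => ?_)
      rw [norm_smul]
      exact mul_le_mul (hD _) (hF y) (norm_nonneg _) ((norm_nonneg _).trans (hD 0))
  simp only [hint (F := g) (G := A') (fun x => (hC x).trans (le_max_left _ _))
    hA.2.1.aestronglyMeasurable] at key
  rw [← key]
  congr 1
  ext y
  rw [← hint (F := g') (G := A) (fun x => (hC' x).trans (le_max_right _ _))
    hA'.2.1.aestronglyMeasurable]
  congr 1
  ext x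
  -- The two mollifications use `ψ(x - y)` and `ψ(y - x)`; they agree because the bump is even.
  rw [← neg_sub, ContDiffBump.normed_neg]

end

namespace Triangulation

variable {T : Triangulation}

/-! ### Differentiation in time -/

section time

variable {W : Type*} [NormedAddCommGroup W] [NormedSpace ℝ W]
  {V : Submodule ℝ (T.Cell → E3 → W)} [FiniteDimensional ℝ V]
  {I : Set ℝ} {f : ℝ → T.Cell → E3 → W} {f' : T.Cell → E3 → W} {t : ℝ}

/-- The space of fields carries the topology of pointwise convergence, so pointwise derivatives are
limits of difference quotients in it. -/
lemma tendsto_slope_field (hd : ∀ K x, HasDerivWithinAt (fun τ => f τ K x) (f' K x) I t) :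
    Filter.Tendsto (fun τ => (τ - t)⁻¹ • (f τ - f t)) (nhdsWithin t (I \ {t})) (nhds f') := by
  refine tendsto_pi_nhds.2 fun K => tendsto_pi_nhds.2 fun x => ?_
  exact hasDerivWithinAt_iff_tendsto_slope.1 (hd K x)

lemma eventually_mem_of_sdiff (I : Set ℝ) (t : ℝ) : ∀ᶠ τ in nhdsWithin t (I \ {t}), τ ∈ I := by
  filter_upwards [self_mem_nhdsWithin] with τ hτ using hτ.1

/-- Difference quotients stay in `V`, which is closed because it is finite-dimensional. At an
isolated point of `I`, as when `I` is a single point, `derivWithin` is zero by convention. -/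
lemma dt_mem (hf : ∀ τ ∈ I, f τ ∈ V) (hd : TimeDiff I f) (ht : t ∈ I) : dt I f t ∈ V := by
  by_cases hne : (nhdsWithin t (I \ {t})).NeBot
  · refine V.closed_of_finiteDimensional.mem_of_tendsto
      (tendsto_slope_field fun K x => (hd K x t ht).hasDerivWithinAt) ?_
    filter_upwards [eventually_mem_of_sdiff I t] with τ hτ
    exact V.smul_mem _ (V.sub_mem (hf τ hτ) (hf t ht))
  · have h0 : dt I f t = 0 := by
      ext K x
      exact derivWithin_zero_of_not_accPt (by rwa [accPt_principal_iff_nhdsWithin])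
    rw [h0]
    exact V.zero_mem

/-- Linear maps on a finite-dimensional space of fields commute with the time derivative. -/
lemma hasDerivWithinAt_of_linear {F : Type*} [NormedAddCommGroup F] [NormedSpace ℝ F]
    (hf : ∀ τ ∈ I, f τ ∈ V) (ht : t ∈ I)
    (hd : ∀ K x, HasDerivWithinAt (fun τ => f τ K x) (f' K x) I t)
    (L : V →ₗ[ℝ] F) {Λ : (T.Cell → E3 → W) → F} (hΛ : ∀ v : V, L v = Λ v) :
    HasDerivWithinAt (fun τ => Λ (f τ)) (Λ f') I t := by
  rw [hasDerivWithinAt_iff_tendsto_slope]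
  by_cases hne : (nhdsWithin t (I \ {t})).NeBot
  · have hslope := tendsto_slope_field hd
    have hmem : ∀ τ ∈ I, (τ - t)⁻¹ • (f τ - f t) ∈ V := fun τ hτ =>
      V.smul_mem _ (V.sub_mem (hf τ hτ) (hf t ht))
    have hf' : f' ∈ V := by
      refine V.closed_of_finiteDimensional.mem_of_tendsto hslope ?_
      filter_upwards [eventually_mem_of_sdiff I t] with τ hτ using hmem τ hτ
    classical
    -- The functional `L` acts on `V` alone, so the difference quotients are lifted to `V` before
    -- its continuity is used; outside `I` the value is irrelevant.
    let g : ℝ → V := fun τ => if h : τ ∈ I then ⟨_, hmem τ h⟩ else 0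
    have hg : Filter.Tendsto g (nhdsWithin t (I \ {t})) (nhds ⟨f', hf'⟩) := by
      refine tendsto_subtype_rng.2 (hslope.congr' ?_)
      filter_upwards [eventually_mem_of_sdiff I t] with τ hτ
      simp [g, hτ]
    have hL := (L.continuous_of_finiteDimensional.tendsto _).comp hg
    rw [hΛ ⟨f', hf'⟩] at hL
    refine hL.congr' ?_
    filter_upwards [eventually_mem_of_sdiff I t] with τ hτ
    have hgτ : g τ = (τ - t)⁻¹ • (⟨f τ, hf τ hτ⟩ - ⟨f t, hf t ht⟩ : V) := by
      simp only [g, hτ, dif_pos]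
      rfl
    rw [Function.comp_apply, hgτ, map_smul, map_sub, hΛ, hΛ]
    rfl
  · rw [Filter.not_neBot.1 hne]
    exact Filter.tendsto_bot

lemma hasDerivWithinAt_integral {N : ℕ} {f : ℝ → T.SField} {f' : T.SField}
    (hf : ∀ τ ∈ I, f τ ∈ T.DG N) (ht : t ∈ I)
    (hd : ∀ K x, HasDerivWithinAt (fun τ => f τ K x) (f' K x) I t) :
    HasDerivWithinAt (fun τ => integral (f τ)) (integral f') I t := by
  let L : T.dgSub N →ₗ[ℝ] ℝ :=
    { toFun := fun v => integral v.1
      map_add' := fun v w => integral_add (DG.cont (mem_dgSub.1 v.2)) (DG.cont (mem_dgSub.1 w.2))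
      map_smul' := fun c v => integral_const_mul c v.1 }
  exact hasDerivWithinAt_of_linear (fun τ hτ => mem_dgSub.2 (hf τ hτ)) ht hd L fun _ => rfl

lemma eq_of_hasDerivWithinAt_zero (hI : I.OrdConnected) {h : ℝ → ℝ}
    (hd : ∀ t ∈ I, HasDerivWithinAt h 0 I t) {t₀ : ℝ} (ht₀ : t₀ ∈ I) (ht : t ∈ I) :
    h t = h t₀ := by
  have := Convex.norm_image_sub_le_of_norm_hasDerivWithin_le (C := 0) hd
    (fun x _ => by simp) hI.convex ht₀ ht
  rw [zero_mul, norm_le_zero_iff, sub_eq_zero] at this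
  exact this

lemma eq_of_dt_linear_eq_zero (hI : I.OrdConnected) (hf : ∀ τ ∈ I, f τ ∈ V) (hd : TimeDiff I f)
    (L : V →ₗ[ℝ] ℝ) {Λ : (T.Cell → E3 → W) → ℝ} (hΛ : ∀ v : V, L v = Λ v)
    (h0 : ∀ τ ∈ I, Λ (dt I f τ) = 0) {t₀ : ℝ} (ht₀ : t₀ ∈ I) (ht : t ∈ I) : Λ (f t) = Λ (f t₀) :=
  eq_of_hasDerivWithinAt_zero (h := fun τ => Λ (f τ)) hI (fun τ hτ => by
    have := hasDerivWithinAt_of_linear (f' := dt I f τ) hf hτ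
      (fun K x => (hd K x τ hτ).hasDerivWithinAt) L hΛ
    rwa [h0 τ hτ] at this) ht₀ ht

/-- A field whose time derivative lies in a subspace moves parallel to that subspace. -/
lemma sub_mem_of_dt_mem (hI : I.OrdConnected) (hf : ∀ τ ∈ I, f τ ∈ V) (hd : TimeDiff I f)
    {W' : Submodule ℝ (T.Cell → E3 → W)} (h : ∀ τ ∈ I, dt I f τ ∈ W') {t₀ : ℝ} (ht₀ : t₀ ∈ I)
    (ht : t ∈ I) : f t - f t₀ ∈ W' := by
  classical
  by_contra hn
  let x : V := ⟨f t, hf t ht⟩ - ⟨f t₀, hf t₀ ht₀⟩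
  have hx : x ∉ W'.comap V.subtype := hn
  -- A functional on `V` that annihilates `V ∩ W'` but not the increment would be constant along the
  -- motion, a contradiction.
  obtain ⟨φ, hφ, hφ'⟩ := Submodule.exists_dual_map_eq_bot_of_notMem hx inferInstance
  let Λ : (T.Cell → E3 → W) → ℝ := fun v => if h : v ∈ V then φ ⟨v, h⟩ else 0
  have hΛ : ∀ v : V, φ v = Λ v := fun v => by simp [Λ]
  refine hφ ?_
  rw [map_sub, hΛ, hΛ, sub_eq_zero]
  refine eq_of_dt_linear_eq_zero hI hf hd φ hΛ (fun τ hτ => ?_) ht₀ ht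
  have hm := dt_mem hf hd hτ
  rw [← hΛ ⟨_, hm⟩]
  have : φ ⟨_, hm⟩ ∈ (W'.comap V.subtype).map φ := Submodule.mem_map_of_mem (h τ hτ)
  rwa [hφ', Submodule.mem_bot] at this

end time

end Triangulation

namespace Triangulation

variable {T : Triangulation}

/-! ### The reduced form of the scheme -/

lemma bForm_smul_left {m : ℕ} {f f' : T.SField} (hf' : Cont f') {c : ℝ}
    (h : projDG m f = c • projDG m f') (g : T.SField) (u : T.VField) :
    bForm m f g u = c * bForm m f' g u := by
  have hP := (projDG_spec m hf').1
  have h1 : ∀ (K : T.Cell) (x v : E3), inner ℝ v (gradient ((c • projDG m f') K) x) =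
      c * inner ℝ v (gradient (projDG m f' K) x) := by
    intro K x v
    have hd (i : Fin 3) : dpart i ((c • projDG m f') K) x = c * dpart i (projDG m f' K) x :=
      dpart_const_mul _ _ ((hP K).differentiable x)
    rw [inner_gradient_eq, inner_gradient_eq, hd, hd, hd]
    ring
  have h2 : ∀ (e : T.InteriorFace) (x : E3),
      jump (c • projDG m f') e x = c • jump (projDG m f') e x := by
    intro e x
    simp only [jump, Finset.smul_sum, Pi.smul_apply, smul_smul, smul_eq_mul]
  simp only [bForm, h, h1, h2, inner_smul_right, mul_assoc, MeasureTheory.integral_const_mul,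
    ← Finset.mul_sum]
  ring

lemma ipV_crossF_left (u v w : T.VField) : ipV (crossF u v) w = ipV u (crossF v w) := by
  simp only [ipV, crossF, inner_cross_comm]

lemma cont_dotF {u v : T.VField} (hu : Cont u) (hv : Cont v) : Cont (dotF u v) :=
  fun K => (hu K).inner (hv K)

section

variable {s m : ℕ} {I : Set ℝ} {u B : ℝ → T.VField} {ρ p : ℝ → T.SField}

/-- Uniqueness of projections gives `U = πu`, `H = πB`, `E = π(H × U)` and `2θ = π_h(u·u)`. Thus the
auxiliary fields can be eliminated. -/
lemma SolvesMixed.solvesForms {θ : ℝ → T.SField} {w J H U E α : ℝ → T.VField}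
    (h : SolvesMixed s m I u B ρ p θ w J H U E α) : SolvesForms s m I u B ρ p := by
  refine ⟨h.diff_u, h.diff_B, h.diff_ρ, h.mem_u, h.mem_B, h.mem_ρ, h.mem_p, ?_, ?_, h.density,
    h.incompressible⟩
  · intro t ht v hv
    obtain ⟨hw, hJ, hH, hU, hE, hα⟩ := h.mem_aux t ht
    have eU : projCurl s (u t) = U t := projCurl_eq hU (h.eq_U t ht)
    have eH : projCurl s (B t) = H t := projCurl_eq hH (h.eq_H t ht)
    have cu := RT.cont (h.mem_u t ht)
    have hz := projCurl_spec s (RT.cont hv)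
    -- The chain is `⟨w × X, πv⟩ = ⟨w, X × πv⟩ = ⟨w, π(X × πv)⟩ = ⟨a, curl π(X × πv)⟩`, where the
    -- second equality holds because `w` is a Nedelec field.
    have hform : ∀ {w X : T.VField} {a b : T.VField}, w ∈ T.NED s → X ∈ T.NED s →
        projCurl s b = X → (∀ z ∈ T.NED s, ipV w z = ipV a (curlF z)) →
        ipV (crossF w X) (projCurl s v) = aForm s a b v := by
      intro w X a b hw hX hb hwz
      have hc := projCurl_spec s (cont_crossF (NED.cont hX) (NED.cont hz.1))
      rw [ipV_crossF_left, ipV_comm, ← hc.2 w hw, ipV_comm, hwz _ hc.1, aForm, hb]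
    have e1 : ipV (α t) v = aForm s (smulF (ρ t) (u t)) (u t) v - aForm s (B t) (B t) v := by
      rw [ipV_comm, ← hz.2 _ hα, ipV_comm, h.eq_α t ht _ hz.1,
        ipV_sub_left (cont_crossF (NED.cont hw) (NED.cont hU))
          (cont_crossF (NED.cont hJ) (NED.cont hH)) (NED.cont hz.1),
        hform hw hU eU (h.eq_w t ht), hform hJ hH eH (h.eq_J t ht)]
    have hθ := h.mem_θ t ht
    have e2 : bForm m (dotF (u t) (u t)) (ρ t) v = 2 * bForm m (θ t) (ρ t) v := by
      refine bForm_smul_left (DG.cont hθ) ?_ _ _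
      rw [projDG_of_mem hθ]
      refine projDG_eq (mem_dgSub.1 ((T.dgSub m).smul_mem 2 (mem_dgSub.2 hθ))) fun σ hσ => ?_
      rw [ip_smul_left, h.eq_θ t ht σ hσ]
      ring
    have := h.momentum t ht v hv
    rw [e1] at this
    rw [e2, ← this]
    ring
  · intro t ht C hC
    obtain ⟨hw, hJ, hH, hU, hE, hα⟩ := h.mem_aux t ht
    have eU : projCurl s (u t) = U t := projCurl_eq hU (h.eq_U t ht)
    have eH : projCurl s (B t) = H t := projCurl_eq hH (h.eq_H t ht)
    have eE : projCurl s (crossF (H t) (U t)) = E t := projCurl_eq hE fun z hz => by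
      rw [h.eq_E t ht z hz, crossF_swap (H t), ipV_neg_left]
    rw [aForm, eU, eH, eE, ipV_comm C]
    exact h.magnetic t ht C hC

/-! ### Constraints -/

lemma hasDivZeroTrace_of_divFree {u : T.VField} (hu : u ∈ T.RT s) (hd : DivFree u) :
    HasDivZeroTrace T.domain (glue u) 0 := by
  have h : glue (divF u) = 0 := by
    ext x
    by_cases hx : ∃ K : T.Cell, x ∈ interior K.hull
    · obtain ⟨K, hK⟩ := hx
      rw [glue_eq_of_mem _ hK, hd K x (interior_subset hK)]
      rfl
    · push Not at hx
      exact glue_eq_zero _ hx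
  rw [← h]
  exact RT.hasDivZeroTrace hu

namespace SolvesForms

lemma divF_velocity (h : SolvesForms s m I u B ρ p) {t : ℝ} (ht : t ∈ I) : divF (u t) = 0 :=
  have hd := divF_mem_DGZero (h.mem_u t ht)
  eq_zero_of_ip_self hd.1 (h.incompressible t ht _ hd)

lemma divFree_velocity (h : SolvesForms s m I u B ρ p) {t : ℝ} (ht : t ∈ I) : DivFree (u t) := fun K x _ => by
  rw [h.divF_velocity ht]
  rfl

lemma dt_density_mem (h : SolvesForms s m I u B ρ p) {t : ℝ} (ht : t ∈ I) : dt I ρ t ∈ T.DG m :=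
  mem_dgSub.1 (dt_mem (fun τ hτ => mem_dgSub.2 (h.mem_ρ τ hτ)) h.diff_ρ ht)

lemma dt_velocity_mem (h : SolvesForms s m I u B ρ p) {t : ℝ} (ht : t ∈ I) : dt I u t ∈ T.RT s :=
  dt_mem (V := T.rtSub s) h.mem_u h.diff_u ht

lemma dt_magnetic_mem (h : SolvesForms s m I u B ρ p) {t : ℝ} (ht : t ∈ I) : dt I B t ∈ T.RT s :=
  dt_mem (V := T.rtSub s) h.mem_B h.diff_B ht

/-- The product `ρ u` in general leaves the Raviart-Thomas space, but it is piecewise polynomial,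
which suffices for continuity of its time derivative on each cell. -/
lemma dt_momentum_mem (h : SolvesForms s m I u B ρ p) {t : ℝ} (ht : t ∈ I) :
    dt I (fun τ => smulF (ρ τ) (u τ)) t ∈ T.pvSub (m + (s + 1)) := by
  refine dt_mem (fun τ hτ => mem_pvSub.2 fun K => ?_) (fun K x τ hτ => ?_) ht
  · exact (RT.isPolyVec (h.mem_u τ hτ) K).smul (h.mem_ρ τ hτ K)
  · exact (h.diff_ρ K x τ hτ).smul (h.diff_u K x τ hτ)

end SolvesForms

/-! ### The strong induction equation and its constraint -/

/-- The discrete electric field, up to its sign. -/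
def emf (s : ℕ) (B u : T.VField) : T.VField :=
  projCurl s (crossF (projCurl s B) (projCurl s u))

lemma emf_spec (s : ℕ) {B u : T.VField} (hB : Cont B) (hu : Cont u) : emf s B u ∈ T.NED s ∧
    ∀ z ∈ T.NED s, ipV (emf s B u) z = ipV (crossF (projCurl s B) (projCurl s u)) z :=
  projCurl_spec s (cont_crossF (NED.cont (projCurl_spec s hB).1) (NED.cont (projCurl_spec s hu).1))

/-- Since the discrete electric field is a Nedelec field, `B` may be replaced by its projection;
that projection is orthogonal to its own cross product with anything. -/
lemma ipV_emf_self (s : ℕ) {B u : T.VField} (hB : Cont B) (hu : Cont u) :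
    ipV (emf s B u) B = 0 := by
  have hG := emf_spec s hB hu
  have hP := projCurl_spec s hB
  rw [ipV_comm, ← hP.2 _ hG.1, ipV_comm, hG.2 _ hP.1, crossF_swap, ipV_neg_left, ipV_crossF_left,
    crossF_self, ipV_comm, ipV_zero_left, neg_zero]

namespace SolvesForms

/-- The residual `∂ₜB + curl G` is itself a Raviart-Thomas field, so it can be tested with itself.
-/
lemma dt_magnetic (h : SolvesForms s m I u B ρ p) {t : ℝ} (ht : t ∈ I) : dt I B t = - curlF (emf s (B t) (u t)) := by
  have hG := (emf_spec s (RT.cont (h.mem_B t ht)) (RT.cont (h.mem_u t ht))).1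
  have h1 := h.dt_magnetic_mem ht
  have h2 := curlF_mem_RT hG
  have h3 : dt I B t + curlF (emf s (B t) (u t)) ∈ T.RT s := (T.rtSub s).add_mem h1 h2
  refine eq_neg_of_add_eq_zero_left (eq_zero_of_ipV_self (RT.isPolyVec h3) ?_)
  rw [ipV_add_left (RT.cont h1) (RT.cont h2) (RT.cont h3), ipV_comm (curlF _)]
  exact h.magnetic t ht _ h3

lemma divF_magnetic (h : SolvesForms s m I u B ρ p) (hI : I.OrdConnected) {t₀ t : ℝ} (ht₀ : t₀ ∈ I) (ht : t ∈ I) :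
    divF (B t) = divF (B t₀) := by
  ext K x
  let L : T.rtSub s →ₗ[ℝ] ℝ :=
    { toFun := fun v => divF v.1 K x
      map_add' := fun v w => by
        rw [Submodule.coe_add, divF_add (fun K => (RT.isPolyVec v.2 K).differentiable)
          (fun K => (RT.isPolyVec w.2 K).differentiable)]
        rfl
      map_smul' := fun c v => by
        rw [Submodule.coe_smul, divF_smul c (fun K => (RT.isPolyVec v.2 K).differentiable)]
        rfl }
  refine eq_of_dt_linear_eq_zero (Λ := fun v => divF v K x) hI h.mem_B h.diff_B L (fun _ => rfl)
    (fun τ hτ => ?_) ht₀ ht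
  have hG := (emf_spec s (RT.cont (h.mem_B τ hτ)) (RT.cont (h.mem_u τ hτ))).1
  simp only [h.dt_magnetic hτ, ← neg_one_smul ℝ (curlF _),
    divF_smul (-1) (fun K => (RT.isPolyVec (curlF_mem_RT hG) K).differentiable), divF_curlF hG,
    smul_zero, Pi.zero_apply]

end SolvesForms

end

end Triangulation

lemma MeasureTheory.Integrable.inner_of_bound {α : Type*} [MeasurableSpace α] {μ : Measure α}
    {F G : α → E3} (hF : Integrable F μ) (hG : AEStronglyMeasurable G μ) {C : ℝ}
    (hC : ∀ x, ‖G x‖ ≤ C) : Integrable (fun x => inner ℝ (F x) (G x)) μ :=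
  (hF.norm.mul_const C).mono' (hF.aestronglyMeasurable.inner hG) (Filter.Eventually.of_forall
    fun x => (norm_inner_le_norm _ _).trans (mul_le_mul_of_nonneg_left (hC x) (norm_nonneg _)))

lemma HasCurlZeroTrace.add {Ω : Set E3} [IsFiniteMeasure (volume.restrict Ω)]
    {A A' g g' : E3 → E3} (h : HasCurlZeroTrace Ω A g) (h' : HasCurlZeroTrace Ω A' g') :
    HasCurlZeroTrace Ω (A + A') (g + g') := by
  refine ⟨h.1.add h'.1, h.2.1.add h'.2.1, fun φ h1 h2 => ?_⟩
  have hint : ∀ {F G : E3 → E3}, MemLp F 2 (volume.restrict Ω) → Continuous G →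
      HasCompactSupport G → Integrable (fun x => inner ℝ (F x) (G x)) (volume.restrict Ω) := by
    intro F G hF hG hc
    obtain ⟨C, hC⟩ := hc.exists_bound_of_continuous hG
    exact (hF.integrable (by norm_num)).inner_of_bound hG.aestronglyMeasurable hC
  have hφ : Continuous (curl3 φ) := continuous_curl3 (h1.of_le (by norm_cast))
  have hφ' : HasCompactSupport (curl3 φ) :=
    HasCompactSupport.intro h2 fun x hx => curl3_eq_zero_of_notMem_tsupport hx
  simp only [Pi.add_apply, inner_add_left]
  rw [MeasureTheory.integral_add (hint h.1 hφ hφ') (hint h'.1 hφ hφ'),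
    MeasureTheory.integral_add (hint h.2.1 h1.continuous h2) (hint h'.2.1 h1.continuous h2),
    h.2.2 φ h1 h2, h'.2.2 φ h1 h2]

namespace Triangulation

variable {T : Triangulation} {s m : ℕ} {I : Set ℝ} {u B : ℝ → T.VField} {ρ p : ℝ → T.SField}

lemma RT.divF_eq_zero {u : T.VField} (hu : u ∈ T.RT s) (hd : DivFree u) : divF u = 0 := by
  ext K : 1
  exact ((divF_mem_DGZero hu).1 K).eq_zero_of_isOpen isOpen_interior K.interior_nonempty
    fun x hx => hd K x (interior_subset hx)

lemma ip_zero_right (f : T.SField) : ip f 0 = 0 := by rw [ip_comm, ip_zero_left]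

namespace SolvesForms

/-! ### Conservation of mass, squared density and energy -/

lemma integral_density (h : SolvesForms s m I u B ρ p) (hI : I.OrdConnected) {t₀ t : ℝ}
    (ht₀ : t₀ ∈ I) (ht : t ∈ I) : integral (ρ t) = integral (ρ t₀) := by
  refine eq_of_hasDerivWithinAt_zero (h := fun τ => integral (ρ τ)) hI (fun τ hτ => ?_) ht₀ ht
  have hd := hasDerivWithinAt_integral (f' := dt I ρ τ) h.mem_ρ hτ
    fun K x => (h.diff_ρ K x τ hτ).hasDerivWithinAt
  have h1 := h.density τ hτ _ (const_mem_DG m 1)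
  simp only [bForm_const_left, add_zero, ip, mul_one] at h1
  rwa [h1] at hd

lemma ip_density_self (h : SolvesForms s m I u B ρ p) (hI : I.OrdConnected) {t₀ t : ℝ}
    (ht₀ : t₀ ∈ I) (ht : t ∈ I) : ip (ρ t) (ρ t) = ip (ρ t₀) (ρ t₀) := by
  refine eq_of_hasDerivWithinAt_zero (h := fun τ => ip (ρ τ) (ρ τ)) hI (fun τ hτ => ?_) ht₀ ht
  have hd := hasDerivWithinAt_integral (f := fun τ K x => ρ τ K x * ρ τ K x)
    (f' := fun K x => 2 * (dt I ρ τ K x * ρ τ K x)) (N := m + m)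
    (fun τ hτ K => (h.mem_ρ τ hτ K).mul (h.mem_ρ τ hτ K)) hτ fun K x => by
      have hx := (h.diff_ρ K x τ hτ).hasDerivWithinAt
      refine (hx.fun_mul hx).congr_deriv ?_
      simp only [dt]
      ring
  have h1 := h.density τ hτ _ (h.mem_ρ τ hτ)
  rw [bForm_self (h.mem_ρ τ hτ) (h.mem_u τ hτ) (h.divFree_velocity hτ), add_zero] at h1
  rwa [integral_const_mul, ← ip.eq_1 (dt I ρ τ) (ρ τ), h1, mul_zero] at hd

lemma energy (h : SolvesForms s m I u B ρ p) (hI : I.OrdConnected) {t₀ t : ℝ}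
    (ht₀ : t₀ ∈ I) (ht : t ∈ I) :
    integral (fun K x => ρ t K x * inner ℝ (u t K x) (u t K x) + inner ℝ (B t K x) (B t K x)) =
      integral (fun K x => ρ t₀ K x * inner ℝ (u t₀ K x) (u t₀ K x)
        + inner ℝ (B t₀ K x) (B t₀ K x)) := by
  refine eq_of_hasDerivWithinAt_zero (h := fun τ => integral (fun K x =>
    ρ τ K x * inner ℝ (u τ K x) (u τ K x) + inner ℝ (B τ K x) (B τ K x))) hI
    (fun τ hτ => ?_) ht₀ ht
  set M := dt I (fun τ => smulF (ρ τ) (u τ)) τ with hM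
  have hd := hasDerivWithinAt_integral
    (f := fun τ K x => ρ τ K x * inner ℝ (u τ K x) (u τ K x) + inner ℝ (B τ K x) (B τ K x))
    (f' := (2 : ℝ) • (fun K x => inner ℝ (M K x) (u τ K x)) +
      ((-1 : ℝ) • (fun K x => dt I ρ τ K x * dotF (u τ) (u τ) K x) +
        (2 : ℝ) • (fun K x => inner ℝ (dt I B τ K x) (B τ K x))))
    (N := m + (s + 1 + (s + 1)))
    (fun τ hτ K => ((h.mem_ρ τ hτ K).mul
      ((RT.isPolyVec (h.mem_u τ hτ) K).inner (RT.isPolyVec (h.mem_u τ hτ) K))).add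
      (((RT.isPolyVec (h.mem_B τ hτ) K).inner (RT.isPolyVec (h.mem_B τ hτ) K)).mono (by omega)))
    hτ fun K x => by
      have hρ := (h.diff_ρ K x τ hτ).hasDerivWithinAt
      have hu := (h.diff_u K x τ hτ).hasDerivWithinAt
      have hB := (h.diff_B K x τ hτ).hasDerivWithinAt
      have hm : HasDerivWithinAt (fun τ => ρ τ K x • u τ K x) (M K x) I τ :=
        ((h.diff_ρ K x τ hτ).smul (h.diff_u K x τ hτ)).hasDerivWithinAt
      -- Writing `ρ|u|²` as `2 (ρu)·u - ρ|u|²` makes the derivative contain `∂ₜ(ρu)` and `∂ₜρ` but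
      -- no `∂ₜu`, because the terms with `∂ₜu` cancel.
      have e : ∀ τ, ρ τ K x * inner ℝ (u τ K x) (u τ K x) + inner ℝ (B τ K x) (B τ K x) =
          2 * inner ℝ (ρ τ K x • u τ K x) (u τ K x) - ρ τ K x * inner ℝ (u τ K x) (u τ K x) +
            inner ℝ (B τ K x) (B τ K x) := fun τ => by
        rw [inner_smul_left, conj_trivial]
        ring
      simp only [e]
      refine ((((hm.inner ℝ hu).const_mul 2).fun_sub (hρ.fun_mul (hu.inner ℝ hu))).fun_add
        (hB.inner ℝ hB)).congr_deriv ?_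
      simp only [Pi.add_apply, Pi.smul_apply, smul_eq_mul, dotF, dt,
        real_inner_comm (derivWithin (fun τ => B τ K x) I τ),
        real_inner_comm (derivWithin (fun τ => u τ K x) I τ), inner_smul_right]
      ring
  have cu := RT.cont (h.mem_u τ hτ)
  have cB := RT.cont (h.mem_B τ hτ)
  have cM : Cont M := cont_of_mem_pvSub (h.dt_momentum_mem hτ)
  have cρ := DG.cont (h.dt_density_mem hτ)
  have cB' := RT.cont (h.dt_magnetic_mem hτ)
  have c1 : Cont (fun K x => inner ℝ (M K x) (u τ K x) : T.SField) := cont_dotF cM cu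
  have c2 : Cont (fun K x => dt I ρ τ K x * dotF (u τ) (u τ) K x : T.SField) :=
    fun K => (cρ K).mul (cont_dotF cu cu K)
  have c3 : Cont (fun K x => inner ℝ (dt I B τ K x) (B τ K x) : T.SField) := cont_dotF cB' cB
  have e := (integral_add (c1.smul 2) ((c2.smul (-1)).add (c3.smul 2))).trans
    (congrArg₂ (· + ·) (integral_const_mul 2 _) ((integral_add (c2.smul (-1)) (c3.smul 2)).trans
      (congrArg₂ (· + ·) (integral_const_mul (-1) _) (integral_const_mul 2 _))))
  simp only [← ipV.eq_1, ← ip.eq_1] at e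
  have hP := projDG_spec m (cont_dotF cu cu)
  have h1 := h.momentum τ hτ _ (h.mem_u τ hτ)
  rw [← hM, aForm_self, h.divF_velocity hτ, ip_zero_right] at h1
  have h2 := h.magnetic τ hτ _ (h.mem_B τ hτ)
  have h3 := h.density τ hτ _ hP.1
  -- The function `u·u` is not in `F_h`, but its projection may replace it: `∂ₜρ` lies in `F_h`, and
  -- `b_h` sees only projections.
  rw [ip_comm, hP.2 _ (h.dt_density_mem hτ), ip_comm,
    bForm_congr_left (projDG_of_mem hP.1)] at h3
  exact hd.congr_deriv (e.trans (by linarith))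

/-! ### Conservation of the cross-helicity -/

/-- With `v = B` the pressure and the advection term drop out because `div B = 0`, and `a_h(B,B,B) =
0`. The remaining `a_h(u,u,B)` is minus the term `a_h(u,B,u)` of the magnetic equation tested with
`u`. -/
lemma cross_helicity (h : SolvesForms s m I u B ρ p) (hI : I.OrdConnected) {t₀ t : ℝ}
    (ht₀ : t₀ ∈ I) (hB : ∀ τ ∈ I, DivFree (B τ)) (hρ : ∀ τ ∈ I, ∀ K x, ρ τ K x = 1)
    (ht : t ∈ I) : ipV (u t) (B t) = ipV (u t₀) (B t₀) := by
  refine eq_of_hasDerivWithinAt_zero (h := fun τ => ipV (u τ) (B τ)) hI (fun τ hτ => ?_) ht₀ ht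
  have hd := hasDerivWithinAt_integral (f := fun τ K x => inner ℝ (u τ K x) (B τ K x))
    (f' := (fun K x => inner ℝ (dt I u τ K x) (B τ K x)) +
      (fun K x => inner ℝ (dt I B τ K x) (u τ K x))) (N := s + 1 + (s + 1))
    (fun τ hτ K => (RT.isPolyVec (h.mem_u τ hτ) K).inner (RT.isPolyVec (h.mem_B τ hτ) K)) hτ
    fun K x => by
      refine ((h.diff_u K x τ hτ).hasDerivWithinAt.inner ℝ
        (h.diff_B K x τ hτ).hasDerivWithinAt).congr_deriv ?_
      simp only [Pi.add_apply, dt, real_inner_comm (derivWithin (fun τ => B τ K x) I τ)]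
      ring
  have cu := RT.cont (h.mem_u τ hτ)
  have cB := RT.cont (h.mem_B τ hτ)
  have cu' := RT.cont (h.dt_velocity_mem hτ)
  have cB' := RT.cont (h.dt_magnetic_mem hτ)
  have e : integral ((fun K x => inner ℝ (dt I u τ K x) (B τ K x)) +
      (fun K x => inner ℝ (dt I B τ K x) (u τ K x))) =
      ipV (dt I u τ) (B τ) + ipV (dt I B τ) (u τ) :=
    integral_add (cont_dotF cu' cB) (cont_dotF cB' cu)
  have hM : dt I (fun τ => smulF (ρ τ) (u τ)) τ = dt I u τ := by
    ext K x : 2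
    exact derivWithin_congr (fun τ' hτ' => by simp [smulF, hρ τ' hτ' K x])
      (by simp [smulF, hρ τ hτ K x])
  have hρu : smulF (ρ τ) (u τ) = u τ := by
    ext K x : 2
    simp [smulF, hρ τ hτ K x]
  have hρ1 : ρ τ = fun _ _ => 1 := by
    ext K x
    exact hρ τ hτ K x
  have h1 := h.momentum τ hτ _ (h.mem_B τ hτ)
  rw [hM, hρu, hρ1, bForm_const_right (cont_dotF cu cu) (h.mem_B τ hτ) (hB τ hτ), aForm_self,
    RT.divF_eq_zero (h.mem_B τ hτ) (hB τ hτ), ip_zero_right, aForm_swap _ cu cB] at h1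
  have h2 := h.magnetic τ hτ _ (h.mem_u τ hτ)
  exact hd.congr_deriv (e.trans (by linarith))

end SolvesForms

/-! ### Conservation of the magnetic helicity -/

lemma integral_potential_comm {A A' : E3 → E3} {b b' : T.VField} (hb : Cont b) (hb' : Cont b')
    (h : HasCurlZeroTrace T.domain A (glue b)) (h' : HasCurlZeroTrace T.domain A' (glue b')) :
    ∫ x in T.domain, inner ℝ (A x) (glue b' x) = ∫ x in T.domain, inner ℝ (A' x) (glue b x) := by
  obtain ⟨C, hC⟩ := hb.exists_bound_glue
  obtain ⟨C', hC'⟩ := hb'.exists_bound_glue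
  exact h.integral_inner_comm T.isOpen_domain.measurableSet
    ((measure_mono T.domain_subset_space).trans_lt T.isCompact_space.measure_lt_top).ne h' hC hC'

lemma integral_inner_glue_glue (u v : T.VField) :
    ∫ x in T.domain, inner ℝ (glue u x) (glue v x) = ipV u v := by
  simp only [glue_inner_glue]
  rfl

lemma integrable_inner_glue {A : E3 → E3} (hA : MemLp A 2 (volume.restrict T.domain))
    {b : T.VField} (hb : Cont b) :
    Integrable (fun x => inner ℝ (A x) (glue b x)) (volume.restrict T.domain) :=
  have ⟨_, hC⟩ := hb.exists_bound_glue
  (hA.integrable (by norm_num)).inner_of_bound (hb.aestronglyMeasurable_glue _) hC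

/-- The curl on the Nedelec space. -/
def curlNED (T : Triangulation) (s : ℕ) : T.nedSub s →ₗ[ℝ] T.VField where
  toFun z := curlF z.1
  map_add' z w := curlF_add (fun K => (NED.isPolyVec z.2 K).differentiable)
    (fun K => (NED.isPolyVec w.2 K).differentiable)
  map_smul' c z := curlF_smul c (fun K => (NED.isPolyVec z.2 K).differentiable)

/-- A discrete potential, linear in the field. -/
lemma exists_discrete_potential (T : Triangulation) (s : ℕ) :
    ∃ R : LinearMap.range (T.curlNED s) →ₗ[ℝ] T.nedSub s, ∀ b, curlF (R b).1 = b := by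
  obtain ⟨R, hR⟩ := (T.curlNED s).rangeRestrict.exists_rightInverse_of_surjective
    (LinearMap.range_rangeRestrict _)
  exact ⟨R, fun b => congrArg Subtype.val (LinearMap.congr_fun hR b)⟩

/-- The field `B(t₀)` itself need not have a discrete potential, but its increments do, because
`∂ₜB` is a curl of a Nedelec field. Adding such a potential to `A₀` gives a reference potential that
is differentiable in time. -/
lemma SolvesForms.magnetic_helicity (h : SolvesForms s m I u B ρ p) (hI : I.OrdConnected)
    {t₀ t : ℝ} (ht₀ : t₀ ∈ I) (ht : t ∈ I) {A A₀ : E3 → E3}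
    (hA : HasCurlZeroTrace T.domain A (glue (B t)))
    (hA₀ : HasCurlZeroTrace T.domain A₀ (glue (B t₀))) :
    ∫ x in T.domain, inner ℝ (A x) (glue (B t) x) =
      ∫ x in T.domain, inner ℝ (A₀ x) (glue (B t₀) x) := by
  classical
  obtain ⟨R, hR⟩ := exists_discrete_potential T s
  have hB' : ∀ τ ∈ I, dt I B τ ∈ LinearMap.range (T.curlNED s) := fun τ hτ => by
    rw [h.dt_magnetic hτ]
    exact Submodule.neg_mem _ ⟨⟨_, (emf_spec s (RT.cont (h.mem_B τ hτ))
      (RT.cont (h.mem_u τ hτ))).1⟩, rfl⟩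
  have hsub : ∀ τ ∈ I, B τ - B t₀ ∈ LinearMap.range (T.curlNED s) := fun τ hτ =>
    sub_mem_of_dt_mem (V := T.rtSub s) hI h.mem_B h.diff_B hB' ht₀ hτ
  -- The discrete potential is extended by zero outside the range of the curl, so that it can be
  -- written without membership proofs.
  let P : T.VField → T.VField := fun b =>
    if hb : b ∈ LinearMap.range (T.curlNED s) then (R ⟨b, hb⟩).1 else 0
  have hP : ∀ b : LinearMap.range (T.curlNED s), P b = R b := fun b => dif_pos b.2
  have hPmem : ∀ b ∈ LinearMap.range (T.curlNED s), P b ∈ T.NED s ∧ curlF (P b) = b :=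
    fun b hb => by
      rw [hP ⟨b, hb⟩]
      exact ⟨(R ⟨b, hb⟩).2, hR ⟨b, hb⟩⟩
  have hP0 : P 0 = 0 := by
    have := hP 0
    rwa [map_zero] at this
  have hpot : ∀ τ ∈ I, HasCurlZeroTrace T.domain (A₀ + glue (P (B τ - B t₀))) (glue (B τ)) := by
    intro τ hτ
    have h1 := NED.hasCurlZeroTrace (hPmem _ (hsub τ hτ)).1
    rw [(hPmem _ (hsub τ hτ)).2] at h1
    have h2 := hA₀.add h1
    have e : glue (B t₀) + glue (B τ - B t₀) = glue (B τ) := by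
      ext1 x
      rw [Pi.add_apply, ← glue_add, add_sub_cancel]
    rwa [e] at h2
  have hPd : ∀ τ ∈ I, ∀ K x, HasDerivWithinAt (fun τ => P (B τ - B t₀) K x)
      (P (dt I B τ) K x) I τ := by
    intro τ hτ K x
    let L : LinearMap.range (T.curlNED s) →ₗ[ℝ] E3 :=
      { toFun := fun b => (R b).1 K x
        map_add' := fun b c => by rw [map_add]; rfl
        map_smul' := fun c b => by rw [map_smul]; rfl }
    refine hasDerivWithinAt_of_linear (f := fun τ => B τ - B t₀) (Λ := fun b => P b K x) hsub hτ
      (fun K x => ?_) L fun b => by rw [hP]; rfl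
    exact (h.diff_B K x τ hτ).hasDerivWithinAt.sub_const _
  have hsplit : ∀ τ ∈ I, ∀ b : T.VField, Cont b →
      ∫ x in T.domain, inner ℝ ((A₀ + glue (P (B τ - B t₀))) x) (glue b x) =
        (∫ x in T.domain, inner ℝ (A₀ x) (glue b x)) + ipV (P (B τ - B t₀)) b := by
    intro τ hτ b hb
    simp only [Pi.add_apply, inner_add_left]
    rw [MeasureTheory.integral_add (integrable_inner_glue hA₀.1 hb) (integrable_inner_glue
      (NED.hasCurlZeroTrace (hPmem _ (hsub τ hτ)).1).1 hb), integral_inner_glue_glue]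
  -- With `A = A₀ + Z` the derivative is `∫ A·∂ₜB + ∫ ∂ₜZ·B`. By symmetry of the curl the second
  -- integral equals the first, and the first is `-∫ A·curl G = -∫ G·B = 0`.
  have hcons : ∀ τ ∈ I, HasDerivWithinAt (fun τ =>
      (∫ x in T.domain, inner ℝ (A₀ x) (glue (B τ) x)) + ipV (P (B τ - B t₀)) (B τ)) 0 I τ := by
    intro τ hτ
    have cB := RT.cont (h.mem_B τ hτ)
    have cB' := RT.cont (h.dt_magnetic_mem hτ)
    have hZ := hPmem _ (hsub τ hτ)
    have hZ' := hPmem _ (hB' τ hτ)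
    let L : T.rtSub s →ₗ[ℝ] ℝ :=
      { toFun := fun b => ∫ x in T.domain, inner ℝ (A₀ x) (glue b.1 x)
        map_add' := fun b c => by
          rw [← MeasureTheory.integral_add (integrable_inner_glue hA₀.1 (RT.cont b.2))
            (integrable_inner_glue hA₀.1 (RT.cont c.2))]
          simp only [Submodule.coe_add, glue_add, inner_add_right]
        map_smul' := fun c b => by
          simp only [Submodule.coe_smul, glue_smul, inner_smul_right,
            MeasureTheory.integral_const_mul]
          rfl }
    have h1 := hasDerivWithinAt_of_linear (V := T.rtSub s) (f' := dt I B τ) h.mem_B hτ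
      (fun K x => (h.diff_B K x τ hτ).hasDerivWithinAt) L
      (Λ := fun b => ∫ x in T.domain, inner ℝ (A₀ x) (glue b x)) fun _ => rfl
    have h2 := hasDerivWithinAt_integral
      (f := fun τ K x => inner ℝ (P (B τ - B t₀) K x) (B τ K x))
      (f' := (fun K x => inner ℝ (P (B τ - B t₀) K x) (dt I B τ K x)) +
        fun K x => inner ℝ (P (dt I B τ) K x) (B τ K x)) (N := s + 1 + (s + 1))
      (fun τ hτ K => (NED.isPolyVec (hPmem _ (hsub τ hτ)).1 K).inner
        (RT.isPolyVec (h.mem_B τ hτ) K)) hτ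
      fun K x => (hPd τ hτ K x).inner ℝ (h.diff_B K x τ hτ).hasDerivWithinAt
    have e : integral ((fun K x => inner ℝ (P (B τ - B t₀) K x) (dt I B τ K x)) +
        fun K x => inner ℝ (P (dt I B τ) K x) (B τ K x)) =
        ipV (P (B τ - B t₀)) (dt I B τ) + ipV (P (dt I B τ)) (B τ) :=
      integral_add (cont_dotF (NED.cont hZ.1) cB') (cont_dotF (NED.cont hZ'.1) cB)
    have hG := (emf_spec s cB (RT.cont (h.mem_u τ hτ))).1
    have e1 := integral_potential_comm cB (RT.cont (curlF_mem_RT hG)) (hpot τ hτ)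
      (NED.hasCurlZeroTrace hG)
    rw [integral_inner_glue_glue, ipV_emf_self s cB (RT.cont (h.mem_u τ hτ))] at e1
    have e2 : ∫ x in T.domain, inner ℝ ((A₀ + glue (P (B τ - B t₀))) x) (glue (dt I B τ) x) = 0 := by
      rw [h.dt_magnetic hτ, ← neg_one_smul ℝ]
      simp only [glue_smul, inner_smul_right, MeasureTheory.integral_const_mul, e1, mul_zero]
    have hpot' := NED.hasCurlZeroTrace hZ'.1
    rw [hZ'.2] at hpot'
    have e3 := integral_potential_comm cB' cB hpot' (hpot τ hτ)
    rw [integral_inner_glue_glue, e2] at e3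
    rw [hsplit τ hτ _ cB'] at e2
    refine (h1.fun_add h2).congr_deriv ?_
    rw [e, e3, add_zero, e2]
  have hfin := eq_of_hasDerivWithinAt_zero hI hcons ht₀ ht
  simp only [← hsplit t ht _ (RT.cont (h.mem_B t ht)), sub_self, hP0, ipV_zero_left,
    add_zero] at hfin
  -- Symmetry applied to two potentials of the same field exchanges the arbitrary `A` for the
  -- reference potential.
  rw [integral_potential_comm (RT.cont (h.mem_B t ht)) (RT.cont (h.mem_B t ht)) hA (hpot t ht),
    hfin]

end Triangulation

end

/-! ### The conservation theorem -/

theorem mainTheorem2 (T : Triangulation) (s m : ℕ)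
    (I : Set ℝ) (hI : I.OrdConnected) (t₀ : ℝ) (ht₀ : t₀ ∈ I)
    (u B : ℝ → T.VField) (ρ p : ℝ → T.SField)
    (hsol : Triangulation.SolvesForms s m I u B ρ p ∨
      ∃ (θ : ℝ → T.SField) (w J H U E α : ℝ → T.VField),
        Triangulation.SolvesMixed s m I u B ρ p θ w J H U E α)
    (hB : Triangulation.DivFree (B t₀)) :
    -- mass
    (∀ t ∈ I, Triangulation.integral (ρ t) = Triangulation.integral (ρ t₀)) ∧
    -- total squared density
    (∀ t ∈ I, Triangulation.ip (ρ t) (ρ t) = Triangulation.ip (ρ t₀) (ρ t₀)) ∧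
    -- energy
    (∀ t ∈ I,
      Triangulation.integral
          (fun K x => ρ t K x * inner ℝ (u t K x) (u t K x) + inner ℝ (B t K x) (B t K x)) =
        Triangulation.integral
          (fun K x => ρ t₀ K x * inner ℝ (u t₀ K x) (u t₀ K x)
            + inner ℝ (B t₀ K x) (B t₀ K x))) ∧
    -- magnetic helicity, for arbitrary magnetic potentials of `B` at the two times
    (∀ t ∈ I, ∀ A A₀ : E3 → E3,
      HasCurlZeroTrace T.domain A (Triangulation.glue (B t)) →
      HasCurlZeroTrace T.domain A₀ (Triangulation.glue (B t₀)) →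
      ∫ x in T.domain, inner ℝ (A x) (Triangulation.glue (B t) x) =
        ∫ x in T.domain, inner ℝ (A₀ x) (Triangulation.glue (B t₀) x)) ∧
    -- cross-helicity, for constant density
    ((∀ t ∈ I, ∀ K x, ρ t K x = 1) →
      ∀ t ∈ I, Triangulation.ipV (u t) (B t) = Triangulation.ipV (u t₀) (B t₀)) ∧
    -- pointwise incompressibility and absence of magnetic charges, with the boundary conditions
    (∀ t ∈ I, Triangulation.DivFree (u t) ∧
      HasDivZeroTrace T.domain (Triangulation.glue (u t)) 0) ∧
    (∀ t ∈ I, Triangulation.DivFree (B t) ∧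
      HasDivZeroTrace T.domain (Triangulation.glue (B t)) 0) := by
  have h : Triangulation.SolvesForms s m I u B ρ p := by
    rcases hsol with h | ⟨θ, w, J, H, U, E, α, h⟩
    · exact h
    · exact h.solvesForms
  have hdB : ∀ t ∈ I, Triangulation.DivFree (B t) := fun t ht K x hx => by
    rw [h.divF_magnetic hI ht₀ ht]
    exact hB K x hx
  exact ⟨fun t ht => h.integral_density hI ht₀ ht, fun t ht => h.ip_density_self hI ht₀ ht,
    fun t ht => h.energy hI ht₀ ht, fun t ht A A₀ hA hA₀ => h.magnetic_helicity hI ht₀ ht hA hA₀,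
    fun hρ t ht => h.cross_helicity hI ht₀ hdB hρ ht,
    fun t ht => ⟨h.divFree_velocity ht,
      Triangulation.hasDivZeroTrace_of_divFree (h.mem_u t ht) (h.divFree_velocity ht)⟩,
    fun t ht => ⟨hdB t ht, Triangulation.hasDivZeroTrace_of_divFree (h.mem_B t ht) (hdB t ht)⟩⟩
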